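/- **Setting.** Let $\mathcal R\subset\mathbb Z^d$ be finite and nonempty, let $\mathcal G=\{\sum_{z\in\mathcal R}a_z z: a_z\in\mathbb Z\}$ be the additive group it generates, and let $\mathcal U\subset\mathbb R^d$ be the convex hull of $\mathcal R$. Let $P$ (with expectation $E$) be the law of the random walk $(X_k)_{k\ge 0}$ on $\mathbb Z^d$ with $X_0=0$ whose steps $Z_k=X_k-X_{k-1}$, $k\ge1$, are i.i.d. uniform on $\mathcal R$. Let $(\Omega,\mathfrak S,\mathbb P)$ be a probability space with an action of $\mathcal G$ by measurable $\mathbb P$-preserving maps $T_x$, $x\in\mathcal G$ ($T_{x+y}=T_xT_y$, $T_0=\mathrm{id}$); no ergodicity is assumed. Fix an integer $\ell\ge0$. For $g:\Omega\times\mathcal R^\ell\to\mathbb R$ put $$ nR_n(g)=\sum_{k=0}^{n-1} g\big(T_{X_k}\omega,(Z_{k+1},\dots,Z_{k+\ell})\big).$$ The function $g$ belongs to the class $\mathcal L$ if for every $w\in\mathcal R^\ell$: $g(\cdot,w)\in L^1(\mathbb P)$, and for every nonzero $z\in\mathcal R$, $$\limsup_{\varepsilon\searrow0}\ \limsup_{n\to\infty}\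 \max_{x\in\mathcal G:\,|x|\le n}\ \frac1n\sum_{0\le k\le\varepsilon n}\big|g(T_{x+kz}\omega,w)\big|=0\qquad\text{for $\mathbb P$-a.e. }\omega .$$ For $\zeta\in\mathcal U$, choose weights $\beta_z\in[0,1]$, $z\in\mathcal R$, with $\sum_z\beta_z=1$ and $\sum_z\beta_z z=\zeta$, all rational if $\zeta\in\mathbb Q^d$; and, for each $n\ge0$, numbers $b^{(n)}_z\in\{0,1\}$ with $b^{(n)}_z=0$ whenever $\beta_z=0$ and $\sum_z b_z^{(n)}=n-\sum_z\lfloor n\beta_z\rfloor$ (such choices exist). Put $$\hat x_n(\zeta)=\sum_{z\in\mathcal R}\big(\lfloor n\beta_z\rfloor+b_z^{(n)}\big)z .$$ **Theorem.** Let $g\in\mathcal L$. Then for $\mathbb P$-a.e. $\omega$ the following hold. (a) Simultaneously for all $\zeta\in\mathcal U$, the limit $$\Lambda_\ell(g,\zeta;\omega)=\lim_{n\to\infty}n^{-1}\log E\big[e^{nR_n(g)}\mathbf 1\{X_n=\hat x_n(\zeta)\}\big]$$ exists in $(-\infty,\infty]$, for every choice as above of the weights $\beta_z$ and of the numbers $b^{(n)}_z$,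 and its value does not depend on that choice. (b) The limit $$\Lambda_\ell(g;\omega)=\lim_{n\to\infty}n^{-1}\log E\big[e^{nR_n(g)}\big]$$ exists in $(-\infty,\infty]$, and $$\Lambda_\ell(g;\omega)=\sup_{\xi\in\mathbb Q^d\cap\mathcal U}\Lambda_\ell(g,\xi;\omega)=\sup_{\zeta\in\mathcal U}\Lambda_\ell(g,\zeta;\omega).$$ -/

import Mathlib

open MeasureTheory Filter Topology

namespace RWRP

noncomputable section

/-- The additive group `𝒢` generated by the finite set `R ⊂ ℤ^d` of admissible steps. -/
abbrev stepGroup {d : ℕ} (R : Finset (Fin d → ℤ)) : AddSubgroup (Fin d → ℤ) :=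
  AddSubgroup.closure (R : Set (Fin d → ℤ))

/-- An admissible step, as an element of the group `𝒢`. -/
def stepElt {d : ℕ} {R : Finset (Fin d → ℤ)} (z : R) : stepGroup R :=
  ⟨z.1, AddSubgroup.subset_closure z.2⟩

/-- The embedding of `ℤ^d` into Euclidean space `ℝ^d`. -/
def latticePt {d : ℕ} (x : Fin d → ℤ) : EuclideanSpace ℝ (Fin d) :=
  WithLp.toLp 2 (fun i => (x i : ℝ))

/-- The convex hull `𝒰` of the step set in `ℝ^d`. -/
def hull {d : ℕ} (R : Finset (Fin d → ℤ)) : Set (EuclideanSpace ℝ (Fin d)) :=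
  convexHull ℝ (latticePt '' (R : Set (Fin d → ℤ)))

/-- The points of `ℝ^d` with rational coordinates. -/
def rationalPts (d : ℕ) : Set (EuclideanSpace ℝ (Fin d)) :=
  {ζ | ∀ i, ∃ q : ℚ, ζ i = (q : ℝ)}

/-- The law `P` of the step sequence of the walk: independent steps, uniform on `R`.
The coordinate `s i` is the step `Z_{i+1}`. -/
def walkLaw {d : ℕ} (R : Finset (Fin d → ℤ)) [Nonempty R] : Measure (ℕ → R) :=
  Measure.infinitePi (fun _ : ℕ => (PMF.uniformOfFintype R).toMeasure)

/-- The position `X_k = Z_1 + ⋯ + Z_k` of the walk started at `0`. -/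
def walkPos {d : ℕ} {R : Finset (Fin d → ℤ)} (s : ℕ → R) (k : ℕ) : stepGroup R :=
  ∑ i ∈ Finset.range k, stepElt (s i)

/-- The energy `n R_n^ℓ(g) = ∑_{k=0}^{n-1} g(T_{X_k} ω, Z_{k+1}, …, Z_{k+ℓ})` of a path,
where the shift `T_x ω` is written `x +ᵥ ω`. -/
def energy {d : ℕ} {R : Finset (Fin d → ℤ)} {Ω : Type*} [AddAction (stepGroup R) Ω] {ℓ : ℕ}
    (g : Ω → (Fin ℓ → R) → ℝ) (ω : Ω) (n : ℕ) (s : ℕ → R) : ℝ :=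
  ∑ k ∈ Finset.range n, g (walkPos s k +ᵥ ω) (fun i : Fin ℓ => s (k + i))

/-- The point-to-point partition function `E[exp(n R_n^ℓ(g)) 𝟙{X_n = x}]`. -/
def pointPartition {d : ℕ} {R : Finset (Fin d → ℤ)} [Nonempty R] {Ω : Type*}
    [AddAction (stepGroup R) Ω] {ℓ : ℕ} (g : Ω → (Fin ℓ → R) → ℝ) (ω : Ω) (n : ℕ)
    (x : Fin d → ℤ) : ℝ :=
  ∫ s, Set.indicator {s : ℕ → R | (walkPos s n : Fin d → ℤ) = x}
    (fun s => Real.exp (energy g ω n s)) s ∂(walkLaw R)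

/-- The point-to-line partition function `E[exp(n R_n^ℓ(g))]`. -/
def linePartition {d : ℕ} {R : Finset (Fin d → ℤ)} [Nonempty R] {Ω : Type*}
    [AddAction (stepGroup R) Ω] {ℓ : ℕ} (g : Ω → (Fin ℓ → R) → ℝ) (ω : Ω) (n : ℕ) : ℝ :=
  ∫ s, Real.exp (energy g ω n s) ∂(walkLaw R)

/-- The class `𝓛` of potentials. The supremum, over a finite nonempty set, and the upper limits
are taken in `[0, ∞]`; the sum is over the integers `0 ≤ k ≤ ε n`. -/
def ClassL {d : ℕ} {R : Finset (Fin d → ℤ)} {Ω : Type*} [MeasurableSpace Ω]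
    [AddAction (stepGroup R) Ω] (μ : Measure Ω) {ℓ : ℕ} (g : Ω → (Fin ℓ → R) → ℝ) : Prop :=
  ∀ w : Fin ℓ → R,
    Integrable (fun ω => g ω w) μ ∧
    ∀ z : R, (z : Fin d → ℤ) ≠ 0 → ∀ᵐ ω ∂μ,
      limsup (fun ε : ℝ =>
        limsup (fun n : ℕ =>
          ⨆ (x : stepGroup R) (_ : ‖latticePt (x : Fin d → ℤ)‖ ≤ (n : ℝ)),
            ENNReal.ofReal ((1 / (n : ℝ)) *
              ∑ k ∈ Finset.range (⌊ε * (n : ℝ)⌋₊ + 1), |g ((x + k • stepElt z) +ᵥ ω) w|))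
          atTop)
        (𝓝[>] 0) = 0

/-- `β` is an admissible family of weights for a convex representation `ζ = ∑ β_z z`:
the weights have to be rational when `ζ` is rational. -/
structure IsConvexRep {d : ℕ} {R : Finset (Fin d → ℤ)} (ζ : EuclideanSpace ℝ (Fin d))
    (β : R → ℝ) : Prop where
  mem_unit : ∀ z, β z ∈ Set.Icc (0 : ℝ) 1
  sum_eq_one : ∑ z, β z = 1
  sum_eq : ∑ z, β z • latticePt (z : Fin d → ℤ) = ζ
  rational : ζ ∈ rationalPts d → ∀ z, ∃ q : ℚ, β z = (q : ℝ)

/-- `b n z = b_z^{(n)} ∈ {0, 1}` vanishes where `β_z` does, and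
`∑_z b_z^{(n)} = n - ∑_z ⌊n β_z⌋`. -/
structure IsRounding {d : ℕ} {R : Finset (Fin d → ℤ)} (β : R → ℝ) (b : ℕ → R → ℤ) : Prop where
  zero_or_one : ∀ n z, b n z = 0 ∨ b n z = 1
  eq_zero : ∀ n z, β z = 0 → b n z = 0
  sum_eq : ∀ n : ℕ, ∑ z, b n z = (n : ℤ) - ∑ z, ⌊(n : ℝ) * β z⌋

/-- The lattice point `x̂_n(ζ) = ∑_z (⌊n β_z⌋ + b_z^{(n)}) z`. -/
def xhat {d : ℕ} {R : Finset (Fin d → ℤ)} (β : R → ℝ) (b : ℕ → R → ℤ) (n : ℕ) : Fin d → ℤ :=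
  ∑ z : R, (⌊(n : ℝ) * β z⌋ + b n z) • (z : Fin d → ℤ)

end

end RWRP

/-!
A path is recorded by its step counts `a : R → ℕ`, and `countEnergy g ω a` is the logarithm of the
partition function of the paths with the same length and endpoint. The theorem is a statement about
the growth of this function, and it rests on three facts.

*Superadditivity.* Concatenating words makes the partition functions supermultiplicative. The only
obstruction is that `g` looks `ℓ` steps ahead, so that the last terms of the energy of the first
word change; this costs at most `boundaryCost`, an integrable function of the environment at the
junction (`wordPartition_mul_le`). After subtracting it, the free energy along the multiples
`q • a` of a fixed step count is a superadditive process over the shift by `countPos a`, and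
Kingman's theorem applies. It is needed without ergodicity and with limits in `(-∞, ∞]`; here it
follows from Hopf's maximal inequality and a covering of orbits by good blocks
(`ae_hasLinearGrowth_of_superadditive`).

*Cheap connections.* For a potential of class `𝓛` a path of length of order `n` can be continued by
few further steps at the price `o(n)`, one straight run for each nonzero step. Repetitions of the
zero step are not controlled by the class `𝓛`, but along a run there is a site with a small
potential at which they can be made, provided that the run is not much shorter than their number
(`HasSmallRuns.exists_word`). Thus the free energy is nearly monotone under the addition of few
steps with comparable counts (`StableUnderFewSteps`), and the free energies along two sequences
with nearly the same frequencies of steps can be compared.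

*Diophantine approximation.* Two representations `β`, `β'` of the same point have integer
approximations with a common denominator which lead to exactly the same lattice point, since they
satisfy the same integral linear equations up to an error less than one
(`exists_isApprox_pair`). Squeezing the paths to `x̂_n` between multiples of such approximations
gives the existence of the limit in part (a) and its independence of all choices
(`StableUnderFewSteps.eventually_le_of_frequently`).

For part (b), the number of endpoints is polynomial in `n`, so only the best endpoint matters, and
by the pigeonhole principle it can be dominated, infinitely often, by multiples of a single step
count with positive entries; its direction is rational
(`StableUnderFewSteps.exists_eventually_le`).

Existence of a limit of `u n / n` in `(-∞, ∞]` is carried through the argument as the elementary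
property `HasLinearGrowth`.
-/

namespace RWRP

set_option linter.unusedSectionVars false

/-! ### A superadditive ergodic theorem -/

/-- The sequence `u n / n` has a limit in `(-∞, ∞]`, phrased without extended reals: `u` has a
linear lower bound, and any slope exceeded infinitely often is, up to an arbitrarily small loss,
eventually exceeded. See `HasLinearGrowth.exists_tendsto`. -/
def HasLinearGrowth (u : ℕ → ℝ) : Prop :=
  (∃ M : ℝ, ∀ᶠ n : ℕ in atTop, M * n ≤ u n) ∧
    ∀ M₁ M₂ : ℝ, M₂ < M₁ → (∃ᶠ n : ℕ in atTop, M₁ * n ≤ u n) → ∀ᶠ n : ℕ in atTop, M₂ * n ≤ u n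

/-- Linear growth is insensitive to perturbations of order `o(n)`. -/
lemma HasLinearGrowth.congr {u v : ℕ → ℝ} (hu : HasLinearGrowth u)
    (h : ∀ δ : ℝ, 0 < δ → ∀ᶠ n : ℕ in atTop, |u n - v n| ≤ δ * n) : HasLinearGrowth v := by
  obtain ⟨⟨M, hM⟩, hu⟩ := hu
  refine ⟨⟨M - 1, ?_⟩, fun M₁ M₂ hlt hfr => ?_⟩
  · filter_upwards [hM, h 1 one_pos] with n h1 h2
    linarith [(abs_le.1 h2).2]
  · have h' := h ((M₁ - M₂) / 3) (by linarith)
    have h1 : ∃ᶠ n : ℕ in atTop, (M₁ - (M₁ - M₂) / 3) * n ≤ u n := by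
      refine (hfr.and_eventually h').mono ?_
      rintro n ⟨h1, h2⟩
      linarith [(abs_le.1 h2).1]
    filter_upwards [hu _ (M₂ + (M₁ - M₂) / 3) (by linarith) h1, h'] with n h1 h2
    linarith [(abs_le.1 h2).2]

lemma HasLinearGrowth.of_abs_sub_le {u v : ℕ → ℝ} (hu : HasLinearGrowth u) {C : ℝ}
    (h : ∀ n, |u n - v n| ≤ C) : HasLinearGrowth v := by
  refine hu.congr fun δ hδ => ?_
  obtain ⟨N, hN⟩ := exists_nat_gt (C / δ)
  filter_upwards [eventually_ge_atTop N] with n hn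
  rw [div_lt_iff₀ hδ] at hN
  have : (N : ℝ) * δ ≤ n * δ := mul_le_mul_of_nonneg_right (by exact_mod_cast hn) hδ.le
  linarith [h n]

section Ergodic

variable {α : Type*}

/-- The maximum of the Birkhoff sums of `f` over at most `N` steps, the empty sum included. -/
noncomputable def maxBirkhoff (T : α → α) (f : α → ℝ) : ℕ → α → ℝ
  | 0 => fun _ => 0
  | N + 1 => fun x => max 0 (f x + maxBirkhoff T f N (T x))

lemma maxBirkhoff_nonneg (T : α → α) (f : α → ℝ) (N : ℕ) (x : α) : 0 ≤ maxBirkhoff T f N x := by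
  cases N <;> simp [maxBirkhoff]

lemma maxBirkhoff_le_succ (T : α → α) (f : α → ℝ) (N : ℕ) (x : α) :
    maxBirkhoff T f N x ≤ maxBirkhoff T f (N + 1) x := by
  induction N generalizing x with
  | zero => exact maxBirkhoff_nonneg T f 1 x
  | succ N ih =>
    simp only [maxBirkhoff] at ih ⊢
    exact max_le_max le_rfl (by linarith [ih (T x)])

lemma birkhoffSum_le_maxBirkhoff (T : α → α) (f : α → ℝ) (n : ℕ) (x : α) :
    birkhoffSum T f n x ≤ maxBirkhoff T f n x := by
  induction n generalizing x with
  | zero => simp [maxBirkhoff]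
  | succ n ih =>
    rw [birkhoffSum_succ']
    exact le_trans (by linarith [ih (T x)]) (le_max_right _ _)

/-- The covering argument behind the superadditive ergodic theorem: an orbit segment of length `N`
is cut into blocks of length at most `L` on which `G` has slope at least `c`, and single sites
in the exceptional set `B`; the last `L` sites are given up. -/
theorem superadditive_covering {T : α → α} {G : ℕ → α → ℝ}
    (hG : ∀ m n x, 1 ≤ m → 1 ≤ n → G m x + G n (T^[m] x) ≤ G (m + n) x)
    {f ψ : α → ℝ} (hG1 : ∀ x, -f x ≤ G 1 x) {c : ℝ} (hψ0 : ∀ x, 0 ≤ ψ x)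
    (hψ : ∀ x, c + f x ≤ ψ x) {S B : Set α} (hS : ∀ x ∈ S, T x ∈ S) {L : ℕ}
    (hB : ∀ x ∈ S, x ∈ B ∨ ∃ n, 1 ≤ n ∧ n ≤ L ∧ c * n ≤ G n x) (N : ℕ) (hN : 1 ≤ N) :
    ∀ x ∈ S, c * N - birkhoffSum T (B.indicator ψ) N x
      - ∑ k ∈ Finset.Ico (N - L) N, ψ (T^[k] x) ≤ G N x := by
  have hSn : ∀ n, ∀ x ∈ S, T^[n] x ∈ S := by
    intro n
    induction n with
    | zero => intro x hx; exact hx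
    | succ n ih => intro x hx; rw [Function.iterate_succ_apply]; exact ih _ (hS x hx)
  have hind : ∀ x, 0 ≤ B.indicator ψ x := fun x => Set.indicator_nonneg (fun y _ => hψ0 y) x
  have hbs : ∀ n x, 0 ≤ birkhoffSum T (B.indicator ψ) n x := fun n x =>
    Finset.sum_nonneg fun k _ => hind _
  induction N using Nat.strong_induction_on with
  | _ N ih =>
    intro x hx
    -- one step at the cost `ψ x`, used both in the exceptional set and near the end
    have hstep : ∀ M, N = M + 1 → 1 ≤ M →
        c * M - birkhoffSum T (B.indicator ψ) M (T x)
          - ∑ k ∈ Finset.Ico (M - L) M, ψ (T^[k] (T x)) - f x ≤ G N x := by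
      rintro M rfl hM
      have h1 := ih M (by omega) hM (T x) (hS x hx)
      have h2 := hG 1 M x le_rfl hM
      rw [add_comm 1 M] at h2
      have h3 := hG1 x
      simp only [Function.iterate_one] at h2
      linarith
    -- shifting a block of the tail sum
    have hshift : ∀ m M : ℕ, N = m + M → m ≤ N - L →
        ∑ k ∈ Finset.Ico (M - L) M, ψ (T^[k] (T^[m] x)) ≤
          ∑ k ∈ Finset.Ico (N - L) N, ψ (T^[k] x) := by
      rintro m M rfl hm
      have : ∑ k ∈ Finset.Ico (M - L) M, ψ (T^[k] (T^[m] x))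
          = ∑ k ∈ Finset.Ico (M - L + m) (M + m), ψ (T^[k] x) := by
        rw [← Finset.sum_Ico_add' (fun k => ψ (T^[k] x)) (M - L) M m]
        refine Finset.sum_congr rfl fun k _ => ?_
        rw [Function.iterate_add_apply]
      rw [this]
      refine Finset.sum_le_sum_of_subset_of_nonneg ?_ fun k _ _ => hψ0 _
      intro k hk
      simp only [Finset.mem_Ico] at hk ⊢
      omega
    rcases Nat.eq_or_lt_of_le hN with h1 | h1
    · subst h1
      rcases Nat.eq_zero_or_pos L with hL | hL
      · subst hL
        rcases hB x hx with hxB | ⟨n, hn1, hnL, -⟩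
        · have := hψ x
          have h3 := hG1 x
          simp [birkhoffSum_one, Set.indicator_of_mem hxB]
          linarith
        · omega
      · have h2 : Finset.Ico (1 - L) 1 = {0} := by
          have : 1 - L = 0 := by omega
          rw [this]; rfl
        have := hψ x
        have h3 := hG1 x
        have h4 := hbs 1 x
        simp [h2]
        simp at h4
        linarith
    · obtain ⟨M, rfl⟩ : ∃ M, N = M + 1 := ⟨N - 1, by omega⟩
      have hM : 1 ≤ M := by omega
      have hs := hstep M rfl hM
      have hbsum : birkhoffSum T (B.indicator ψ) (M + 1) x
          = B.indicator ψ x + birkhoffSum T (B.indicator ψ) M (T x) := birkhoffSum_succ' _ _ _ _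
      have hψx := hψ x
      rcases le_or_gt (M + 1) L with hNL | hNL
      · have e1 : M - L = 0 := by omega
        have e2 : M + 1 - L = 0 := by omega
        rw [hbsum, e2, Finset.sum_Ico_eq_sum_range, Nat.sub_zero, Finset.sum_range_succ']
        rw [e1, Finset.sum_Ico_eq_sum_range, Nat.sub_zero] at hs
        simp only [zero_add, Function.iterate_succ_apply, Function.iterate_zero, id] at hs ⊢
        have := hind x
        push_cast
        linarith
      · rcases hB x hx with hxB | ⟨n, hn1, hnL, hn⟩
        · have h5 := hshift 1 M (by omega) (by omega)
          rw [hbsum, Set.indicator_of_mem hxB]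
          simp only [Function.iterate_one] at h5
          push_cast
          linarith
        · obtain ⟨M', hM'⟩ : ∃ M', M + 1 = n + M' := ⟨M + 1 - n, by omega⟩
          have h5 := ih M' (by omega) (by omega) (T^[n] x) (hSn n x hx)
          have h6 := hG n M' x hn1 (by omega)
          have h7 := birkhoffSum_add T (B.indicator ψ) n M' x
          have h8 := hbs n x
          rw [← hM'] at h6 h7
          have h9 : ∑ k ∈ Finset.Ico (M' - L) M', ψ (T^[k] (T^[n] x)) ≤
              ∑ k ∈ Finset.Ico (M + 1 - L) (M + 1), ψ (T^[k] x) := by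
            rcases le_or_gt n (M + 1 - L) with h | h
            · exact hshift n M' hM' h
            · have e1 : M' - L = 0 := by omega
              rw [hM', e1, ← Finset.sum_Ico_consecutive _ (m := n + M' - L) (n := n) (by omega)
                (by omega), Finset.sum_Ico_eq_sum_range _ n]
              have e2 : n + M' - n = M' := by omega
              rw [e2, Finset.sum_Ico_eq_sum_range, Nat.sub_zero]
              have : ∀ k, T^[k] (T^[n] x) = T^[n + k] x := fun k => by
                rw [← Function.iterate_add_apply, add_comm]
              simp only [zero_add, this]
              have := Finset.sum_nonneg (s := Finset.Ico (n + M' - L) n)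
                (f := fun k => ψ (T^[k] x)) fun k _ => hψ0 _
              linarith
          have hc : c * ((M + 1 : ℕ) : ℝ) = c * n + c * M' := by
            rw [hM']; push_cast; ring
          rw [hc]
          linarith

variable [MeasurableSpace α] {μ : Measure α} {T : α → α}

lemma integrable_maxBirkhoff (hT : MeasurePreserving T μ μ) {f : α → ℝ} (hf : Integrable f μ)
    (N : ℕ) : Integrable (maxBirkhoff T f N) μ := by
  induction N with
  | zero => exact integrable_zero _ _ _
  | succ N ih =>
    exact (integrable_zero _ _ _).sup (hf.add (hT.integrable_comp_of_integrable ih))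

lemma measurable_maxBirkhoff (hT : Measurable T) {f : α → ℝ} (hf : Measurable f)
    (N : ℕ) : Measurable (maxBirkhoff T f N) := by
  induction N with
  | zero => exact measurable_const
  | succ N ih => exact measurable_const.max (hf.add (ih.comp hT))

/-- Hopf's maximal ergodic inequality. -/
theorem setIntegral_maxBirkhoff_nonneg (hT : MeasurePreserving T μ μ) {f : α → ℝ}
    (hf : Integrable f μ) (hfm : Measurable f) (N : ℕ) :
    0 ≤ ∫ x in {x | 0 < maxBirkhoff T f N x}, f x ∂μ := by
  cases N with
  | zero => simp [maxBirkhoff]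
  | succ N =>
    set A := {x | 0 < maxBirkhoff T f (N + 1) x}
    have hA : MeasurableSet A :=
      measurableSet_lt measurable_const (measurable_maxBirkhoff hT.measurable hfm _)
    have hM := integrable_maxBirkhoff hT hf (N + 1)
    have hMT : Integrable (fun x => maxBirkhoff T f (N + 1) (T x)) μ :=
      hT.integrable_comp_of_integrable hM
    have h1 : ∫ x in A, maxBirkhoff T f (N + 1) x ∂μ = ∫ x, maxBirkhoff T f (N + 1) x ∂μ := by
      refine setIntegral_eq_integral_of_forall_compl_eq_zero fun x hx => ?_
      exact le_antisymm (not_lt.1 hx) (maxBirkhoff_nonneg _ _ _ _)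
    have h2 : ∫ x in A, maxBirkhoff T f (N + 1) (T x) ∂μ ≤ ∫ x, maxBirkhoff T f (N + 1) x ∂μ := by
      refine (setIntegral_le_integral hMT
        (ae_of_all _ fun x => maxBirkhoff_nonneg _ _ _ _)).trans ?_
      have := integral_map (μ := μ) hT.measurable.aemeasurable
        (f := maxBirkhoff T f (N + 1)) (by rw [hT.map_eq]; exact hM.aestronglyMeasurable)
      rw [hT.map_eq] at this
      exact this.ge
    have h3 : ∫ x in A, maxBirkhoff T f (N + 1) x ∂μ
        ≤ ∫ x in A, (f x + maxBirkhoff T f (N + 1) (T x)) ∂μ := by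
      refine setIntegral_mono_on hM.integrableOn (hf.add hMT).integrableOn hA fun x hx => ?_
      have hx' : 0 < max 0 (f x + maxBirkhoff T f N (T x)) := hx
      have : maxBirkhoff T f (N + 1) x = f x + maxBirkhoff T f N (T x) := by
        rcases lt_max_iff.1 hx' with h | h
        · exact absurd h (lt_irrefl _)
        · exact max_eq_right h.le
      rw [this]
      linarith [maxBirkhoff_le_succ T f N (T x)]
    rw [integral_add hf.integrableOn hMT.integrableOn] at h3
    linarith

/-- The weak-type maximal inequality for ergodic averages of a nonnegative function. -/
theorem mul_measure_exists_lt_birkhoffSum_le [IsFiniteMeasure μ] (hT : MeasurePreserving T μ μ)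
    {h : α → ℝ} (hh : Integrable h μ) (hm : Measurable h) (h0 : ∀ x, 0 ≤ h x) {c : ℝ} (hc : 0 < c) :
    μ {x | ∃ n, c * n < birkhoffSum T h n x} ≤ ENNReal.ofReal ((∫ x, h x ∂μ) / c) := by
  set f : α → ℝ := fun x => h x - c
  have hf : Integrable f μ := hh.sub (integrable_const c)
  have hfm : Measurable f := hm.sub measurable_const
  set A : ℕ → Set α := fun N => {x | 0 < maxBirkhoff T f N x}
  have hAm : ∀ N, MeasurableSet (A N) := fun N =>
    measurableSet_lt measurable_const (measurable_maxBirkhoff hT.measurable hfm _)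
  have hmono : Monotone A := monotone_nat_of_le_succ fun N x hx =>
    lt_of_lt_of_le hx (maxBirkhoff_le_succ T f N x)
  have hsub : {x | ∃ n, c * n < birkhoffSum T h n x} ⊆ ⋃ N, A N := by
    rintro x ⟨n, hn⟩
    refine Set.mem_iUnion.2 ⟨n, lt_of_lt_of_le ?_ (birkhoffSum_le_maxBirkhoff T f n x)⟩
    have : birkhoffSum T f n x = birkhoffSum T h n x - c * n := by
      simp [birkhoffSum, f, Finset.sum_sub_distrib, mul_comm]
    linarith
  refine (measure_mono hsub).trans ?_
  rw [hmono.measure_iUnion]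
  refine iSup_le fun N => ?_
  have h1 := setIntegral_maxBirkhoff_nonneg hT hf hfm N
  rw [integral_sub hh.integrableOn (integrable_const c).integrableOn] at h1
  have h2 : ∫ x in A N, h x ∂μ ≤ ∫ x, h x ∂μ :=
    setIntegral_le_integral hh (ae_of_all _ h0)
  have h3 : ∫ _ in A N, c ∂μ = μ.real (A N) * c := by simp
  have h4 : μ.real (A N) ≤ (∫ x, h x ∂μ) / c := by
    rw [le_div_iff₀ hc]
    change 0 ≤ (∫ x in A N, h x ∂μ) - ∫ _ in A N, c ∂μ at h1
    linarith
  rw [← ofReal_measureReal]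
  exact ENNReal.ofReal_le_ofReal h4

/-- Almost everywhere the Birkhoff sums of a nonnegative integrable function grow at most
linearly. -/
theorem ae_exists_birkhoffSum_le [IsFiniteMeasure μ] (hT : MeasurePreserving T μ μ)
    {h : α → ℝ} (hh : Integrable h μ) (hm : Measurable h) (h0 : ∀ x, 0 ≤ h x) :
    ∀ᵐ x ∂μ, ∃ c : ℝ, ∀ n, birkhoffSum T h n x ≤ c * n := by
  rw [ae_iff]
  refine le_antisymm ?_ bot_le
  have hlim : Tendsto (fun j : ℕ => ENNReal.ofReal ((∫ x, h x ∂μ) / (j : ℝ))) atTop (𝓝 0) := by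
    rw [← ENNReal.ofReal_zero]
    exact ENNReal.tendsto_ofReal (tendsto_const_div_atTop_nhds_zero_nat _)
  refine ge_of_tendsto hlim ?_
  filter_upwards [eventually_gt_atTop 0] with j hj
  refine le_trans (measure_mono fun x hx => ?_)
    (mul_measure_exists_lt_birkhoffSum_le hT hh hm h0 (c := j) (by exact_mod_cast hj))
  simp only [Set.mem_ofPred_eq, not_exists, not_forall, not_le] at hx ⊢
  exact hx j

/-- If the integrals of `h L` tend to zero, then almost everywhere the supremum of the ergodic
averages of `h L` is arbitrarily small for suitable `L`. -/
theorem ae_exists_birkhoffSum_le_of_tendsto [IsFiniteMeasure μ] (hT : MeasurePreserving T μ μ)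
    {h : ℕ → α → ℝ} (hh : ∀ L, Integrable (h L) μ) (hm : ∀ L, Measurable (h L))
    (h0 : ∀ L x, 0 ≤ h L x) (hlim : Tendsto (fun L => ∫ x, h L x ∂μ) atTop (𝓝 0)) :
    ∀ᵐ x ∂μ, ∀ c : ℝ, 0 < c → ∃ L, ∀ n, birkhoffSum T (h L) n x ≤ c * n := by
  have key : ∀ j : ℕ, ∀ᵐ x ∂μ, ∃ L, ∀ n, birkhoffSum T (h L) n x ≤ (1 / ((j : ℝ) + 1)) * n := by
    intro j
    have hj : (0 : ℝ) < 1 / ((j : ℝ) + 1) := by positivity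
    rw [ae_iff]
    refine le_antisymm ?_ bot_le
    have hlim' : Tendsto (fun L => ENNReal.ofReal ((∫ x, h L x ∂μ) / (1 / ((j : ℝ) + 1))))
        atTop (𝓝 0) := by
      rw [← ENNReal.ofReal_zero]
      refine ENNReal.tendsto_ofReal ?_
      simpa using hlim.div_const (1 / ((j : ℝ) + 1))
    refine ge_of_tendsto' hlim' fun L => ?_
    refine le_trans (measure_mono fun x hx => ?_)
      (mul_measure_exists_lt_birkhoffSum_le hT (hh L) (hm L) (h0 L) hj)
    simp only [Set.mem_ofPred_eq, not_exists, not_forall, not_le] at hx ⊢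
    exact hx L
  filter_upwards [ae_all_iff.2 key] with x hx c hc
  obtain ⟨j, hj⟩ := exists_nat_one_div_lt hc
  obtain ⟨L, hL⟩ := hx j
  exact ⟨L, fun n => (hL n).trans (mul_le_mul_of_nonneg_right hj.le (Nat.cast_nonneg n))⟩

/-- A measurable set which contains `x` whenever it contains `T x` is almost invariant. -/
theorem ae_forall_iterate_mem [IsFiniteMeasure μ] (hT : MeasurePreserving T μ μ) {A : Set α}
    (hA : MeasurableSet A) (h : ∀ x, T x ∈ A → x ∈ A) :
    ∀ᵐ x ∂μ, ∀ k, T^[k] x ∈ A → T (T^[k] x) ∈ A := by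
  rw [ae_all_iff]
  intro k
  have h1 : ∀ᵐ x ∂μ, x ∈ A → T x ∈ A := by
    have h2 : μ (A \ T ⁻¹' A) = 0 := by
      rw [measure_sdiff (show T ⁻¹' A ⊆ A from h) (hT.measurable hA).nullMeasurableSet
        (measure_ne_top _ _), hT.measure_preimage hA.nullMeasurableSet, tsub_self]
    rw [ae_iff]
    convert h2 using 2
    ext x
    simp
  exact (hT.iterate k).quasiMeasurePreserving.ae h1

/-- **Superadditive ergodic theorem**, with limits in `(-∞, ∞]`: for a superadditive process whose
first term has an integrable lower bound, `G n / n` converges almost everywhere. -/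
theorem ae_hasLinearGrowth_of_superadditive [IsFiniteMeasure μ] (hT : MeasurePreserving T μ μ)
    {G : ℕ → α → ℝ} (hGm : ∀ n, Measurable (G n))
    (hG : ∀ m n x, 1 ≤ m → 1 ≤ n → G m x + G n (T^[m] x) ≤ G (m + n) x)
    {f : α → ℝ} (hfm : Measurable f) (hfi : Integrable f μ) (hf0 : ∀ x, 0 ≤ f x)
    (hG1 : ∀ x, -f x ≤ G 1 x) :
    ∀ᵐ x ∂μ, HasLinearGrowth fun n => G n x := by
  have hlow : ∀ n x, 1 ≤ n → -birkhoffSum T f n x ≤ G n x := by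
    intro n
    induction n with
    | zero => intro x h; omega
    | succ n ih =>
      intro x _
      rcases Nat.eq_zero_or_pos n with rfl | hn
      · simpa using hG1 x
      · have h1 := ih (T x) hn
        have h2 := hG 1 n x le_rfl hn
        have h3 := hG1 x
        rw [birkhoffSum_succ']
        rw [add_comm 1 n] at h2
        simp only [Function.iterate_one] at h2
        linarith
  -- the set where the upper limit of `G n / n` exceeds `c`
  set A : ℚ → Set α := fun c =>
    {x | ∃ j : ℕ, ∀ N : ℕ, ∃ n : ℕ, N ≤ n ∧ ((c : ℝ) + 1 / ((j : ℝ) + 1)) * n ≤ G n x} with hA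
  have hAm : ∀ c, MeasurableSet (A c) := by
    intro c
    have : A c = ⋃ j : ℕ, ⋂ N : ℕ, ⋃ n : ℕ, ⋃ _ : N ≤ n,
        {x | ((c : ℝ) + 1 / ((j : ℝ) + 1)) * n ≤ G n x} := by
      ext x; simp [hA]
    rw [this]
    exact .iUnion fun j => .iInter fun N => .iUnion fun n => .iUnion fun _ =>
      measurableSet_le measurable_const (hGm n)
  have hAinv : ∀ c x, T x ∈ A c → x ∈ A c := by
    rintro c x ⟨j, hj⟩
    refine ⟨j + 1, fun N => ?_⟩
    -- the slope lost in passing from `j` to `j + 1` pays for the first step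
    set e : ℝ := 1 / ((j : ℝ) + 1) - 1 / (((j + 1 : ℕ) : ℝ) + 1) with he
    have he0 : 0 < e := by
      have : 1 / (((j + 1 : ℕ) : ℝ) + 1) < 1 / ((j : ℝ) + 1) := by
        apply one_div_lt_one_div_of_lt
        · positivity
        · push_cast; linarith
      linarith
    obtain ⟨N', hN'⟩ := exists_nat_gt ((f x + |(c : ℝ) + 1 / (((j + 1 : ℕ) : ℝ) + 1)|) / e)
    obtain ⟨n, hn, hn'⟩ := hj (max (max N N') 1)
    simp only [max_le_iff] at hn
    refine ⟨n + 1, by omega, ?_⟩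
    have h1 := hG 1 n x le_rfl hn.2
    rw [add_comm 1 n] at h1
    simp only [Function.iterate_one] at h1
    have h2 := hG1 x
    rw [div_lt_iff₀ he0] at hN'
    have h3 : (N' : ℝ) ≤ n := by exact_mod_cast hn.1.2
    have h4 : (N' : ℝ) * e ≤ n * e := mul_le_mul_of_nonneg_right h3 he0.le
    have h5 := le_abs_self ((c : ℝ) + 1 / (((j + 1 : ℕ) : ℝ) + 1))
    set t := 1 / (((j + 1 : ℕ) : ℝ) + 1)
    have h6 : 1 / ((j : ℝ) + 1) = e + t := by rw [he]; ring
    rw [h6] at hn'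
    push_cast at hn' ⊢
    nlinarith
  have hAae : ∀ᵐ x ∂μ, ∀ c, ∀ k, T^[k] x ∈ A c → T (T^[k] x) ∈ A c :=
    ae_all_iff.2 fun c => ae_forall_iterate_mem hT (hAm c) (hAinv c)
  -- the points of `A c` with no block of length at most `L` and slope at least `c`
  set B : ℚ → ℕ → Set α := fun c L => {x | x ∈ A c ∧ ∀ n, 1 ≤ n → n ≤ L → G n x < c * n} with hB
  have hBm : ∀ c L, MeasurableSet (B c L) := by
    intro c L
    have : B c L = A c ∩ ⋂ n : ℕ, ⋂ _ : 1 ≤ n, ⋂ _ : n ≤ L, {x | G n x < c * n} := by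
      ext x; simp [hB]
    rw [this]
    exact (hAm c).inter (.iInter fun n => .iInter fun _ => .iInter fun _ =>
      measurableSet_lt (hGm n) measurable_const)
  set ψ : ℚ → α → ℝ := fun c x => f x + |(c : ℝ)| with hψ
  have hψ0 : ∀ c x, 0 ≤ ψ c x := fun c x => add_nonneg (hf0 x) (abs_nonneg _)
  have hψm : ∀ c, Measurable (ψ c) := fun c => hfm.add measurable_const
  have hψi : ∀ c, Integrable (ψ c) μ := fun c => hfi.add (integrable_const _)
  set C : ℚ → ℕ → Set α := fun c L => {x | (L : ℝ) < ψ c x} with hC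
  have hCm : ∀ c L, MeasurableSet (C c L) := fun c L => measurableSet_lt measurable_const (hψm c)
  set h : ℚ → ℕ → α → ℝ := fun c L x =>
    (B c L).indicator (ψ c) x + (C c L).indicator (ψ c) x with hh
  have hhm : ∀ c L, Measurable (h c L) := fun c L =>
    ((hψm c).indicator (hBm c L)).add ((hψm c).indicator (hCm c L))
  have hhi : ∀ c L, Integrable (h c L) μ := fun c L =>
    ((hψi c).indicator (hBm c L)).add ((hψi c).indicator (hCm c L))
  have hi0 : ∀ c (S : Set α) x, 0 ≤ S.indicator (ψ c) x := fun c S x =>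
    Set.indicator_nonneg (fun y _ => hψ0 c y) x
  have hi1 : ∀ c (S : Set α) x, S.indicator (ψ c) x ≤ ψ c x := fun c S x =>
    Set.indicator_le_self' (fun y _ => hψ0 c y) x
  have hlim : ∀ c, Tendsto (fun L => ∫ x, h c L x ∂μ) atTop (𝓝 0) := by
    intro c
    rw [← integral_zero α ℝ (μ := μ)]
    refine tendsto_integral_of_dominated_convergence (fun x => 2 * ψ c x)
      (fun L => (hhm c L).aestronglyMeasurable) ((hψi c).const_mul 2)
      (fun L => ae_of_all _ fun x => ?_) (ae_of_all _ fun x => ?_)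
    · rw [Real.norm_eq_abs, abs_of_nonneg (add_nonneg (hi0 _ _ _) (hi0 _ _ _))]
      linarith [hi1 c (B c L) x, hi1 c (C c L) x]
    · refine tendsto_const_nhds.congr' ?_
      have e1 : ∀ᶠ L : ℕ in atTop, x ∉ B c L := by
        by_cases hx : x ∈ A c
        · obtain ⟨j, hj⟩ := hx
          obtain ⟨n, hn1, hn⟩ := hj 1
          filter_upwards [eventually_ge_atTop n] with L hL hxB
          have h1 := hxB.2 n hn1 hL
          have h2 : (0 : ℝ) ≤ 1 / ((j : ℝ) + 1) * n := by positivity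
          linarith
        · exact Eventually.of_forall fun L hxB => hx hxB.1
      have e2 : ∀ᶠ L : ℕ in atTop, x ∉ C c L := by
        obtain ⟨N, hN⟩ := exists_nat_gt (ψ c x)
        filter_upwards [eventually_ge_atTop N] with L hL hxC
        have h1 : (L : ℝ) < ψ c x := hxC
        have h2 : (N : ℝ) ≤ L := by exact_mod_cast hL
        linarith
      filter_upwards [e1, e2] with L h1 h2
      simp [hh, Set.indicator_of_notMem h1, Set.indicator_of_notMem h2]
  have hmax : ∀ᵐ x ∂μ, ∀ c : ℚ, ∀ r : ℝ, 0 < r → ∃ L, ∀ n, birkhoffSum T (h c L) n x ≤ r * n :=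
    ae_all_iff.2 fun c => ae_exists_birkhoffSum_le_of_tendsto hT (hhi c) (hhm c)
      (fun L x => add_nonneg (hi0 _ _ _) (hi0 _ _ _)) (hlim c)
  filter_upwards [hAae, hmax, ae_exists_birkhoffSum_le hT hfi hfm hf0] with x hxA hxm hxf
  refine ⟨?_, fun M₁ M₂ hM hfr => ?_⟩
  · obtain ⟨r, hr⟩ := hxf
    refine ⟨-r, ?_⟩
    filter_upwards [eventually_ge_atTop 1] with n hn
    linarith [hr n, hlow n x hn]
  · obtain ⟨c, hc2, hc1⟩ := exists_rat_btwn hM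
    have hxAc : x ∈ A c := by
      obtain ⟨j, hj⟩ := exists_nat_one_div_lt (sub_pos.2 hc1)
      refine ⟨j, fun N => ?_⟩
      obtain ⟨n, hn, hn'⟩ := frequently_atTop.1 hfr N
      refine ⟨n, hn, le_trans (mul_le_mul_of_nonneg_right ?_ (Nat.cast_nonneg n)) hn'⟩
      linarith
    obtain ⟨L, hL⟩ := hxm c ((c - M₂) / 2) (by linarith)
    have hcov := superadditive_covering hG hG1 (c := (c : ℝ)) (ψ := ψ c) (hψ0 c)
      (fun y => by have := le_abs_self (c : ℝ); simp only [hψ]; linarith)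
      (S := {y | y ∈ A c ∧ ∃ k, y = T^[k] x}) (B := B c L) (L := L)
      (by
        rintro y ⟨hy, k, rfl⟩
        exact ⟨hxA c k hy, k + 1, (Function.iterate_succ_apply' T k x).symm⟩)
      (by
        rintro y ⟨hy, -⟩
        by_cases hyB : y ∈ B c L
        · exact Or.inl hyB
        · right
          by_contra hcon
          refine hyB ⟨hy, fun n h1 h2 => ?_⟩
          by_contra hlt
          exact hcon ⟨n, h1, h2, not_lt.1 hlt⟩)
    obtain ⟨N₀, hN₀⟩ := exists_nat_gt ((L : ℝ) * L / ((c - M₂) / 2))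
    rw [div_lt_iff₀ (by linarith)] at hN₀
    filter_upwards [eventually_ge_atTop 1, eventually_ge_atTop N₀] with N hN hN0
    have h1 := hcov N hN x ⟨hxAc, 0, rfl⟩
    have h2 := hL N
    have h3 : ∑ k ∈ Finset.Ico (N - L) N, ψ c (T^[k] x) ≤
        L * L + birkhoffSum T ((C c L).indicator (ψ c)) N x := by
      have h4 : ∀ y, ψ c y ≤ L + (C c L).indicator (ψ c) y := by
        intro y
        by_cases hy : y ∈ C c L
        · rw [Set.indicator_of_mem hy]; linarith [Nat.cast_nonneg (α := ℝ) L]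
        · rw [Set.indicator_of_notMem hy, add_zero]; exact not_lt.1 hy
      calc ∑ k ∈ Finset.Ico (N - L) N, ψ c (T^[k] x)
          ≤ ∑ k ∈ Finset.Ico (N - L) N, ((L : ℝ) + (C c L).indicator (ψ c) (T^[k] x)) :=
            Finset.sum_le_sum fun k _ => h4 _
        _ = (N - (N - L) : ℕ) * (L : ℝ)
            + ∑ k ∈ Finset.Ico (N - L) N, (C c L).indicator (ψ c) (T^[k] x) := by
            rw [Finset.sum_add_distrib]; simp
        _ ≤ _ := by
            refine add_le_add (mul_le_mul_of_nonneg_right ?_ (Nat.cast_nonneg _)) ?_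
            · exact_mod_cast (by omega : N - (N - L) ≤ L)
            · refine Finset.sum_le_sum_of_subset_of_nonneg ?_ fun k _ _ => hi0 _ _ _
              intro k hk
              simp only [Finset.mem_Ico, Finset.mem_range] at hk ⊢
              exact hk.2
    have h5 : birkhoffSum T (h c L) N x = birkhoffSum T ((B c L).indicator (ψ c)) N x
        + birkhoffSum T ((C c L).indicator (ψ c)) N x := by
      simp only [birkhoffSum, hh, Finset.sum_add_distrib]
    have h6 : (N₀ : ℝ) * ((c - M₂) / 2) ≤ N * ((c - M₂) / 2) :=
      mul_le_mul_of_nonneg_right (by exact_mod_cast hN0) (by linarith)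
    nlinarith

end Ergodic

/-- A sequence of linear growth has a limiting slope in `(-∞, ∞]`. -/
theorem HasLinearGrowth.exists_tendsto {u : ℕ → ℝ} (hu : HasLinearGrowth u) :
    ∃ L : EReal, ⊥ < L ∧
      Tendsto (fun n : ℕ => (((1 / (n : ℝ)) * u n : ℝ) : EReal)) atTop (𝓝 L) := by
  obtain ⟨⟨M, hM⟩, hu⟩ := hu
  have hpos : ∀ᶠ n : ℕ in atTop, (0 : ℝ) < n := by
    filter_upwards [eventually_gt_atTop 0] with n hn using by exact_mod_cast hn
  have hdiv : ∀ {n : ℕ} {c : ℝ}, (0 : ℝ) < n → (c ≤ 1 / (n : ℝ) * u n ↔ c * n ≤ u n) := by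
    intro n c hn
    rw [one_div_mul_eq_div, le_div_iff₀ hn]
  set v : ℕ → EReal := fun n => (((1 / (n : ℝ)) * u n : ℝ) : EReal) with hv
  refine ⟨limsup v atTop, ?_, tendsto_of_le_liminf_of_limsup_le ?_ le_rfl⟩
  · have : ((M : ℝ) : EReal) ≤ limsup v atTop := by
      refine le_trans ?_ (liminf_le_limsup (by isBoundedDefault) (by isBoundedDefault))
      refine le_liminf_of_le (by isBoundedDefault) ?_
      filter_upwards [hM, hpos] with n h1 h2
      exact EReal.coe_le_coe_iff.2 ((hdiv h2).2 h1)
    exact lt_of_lt_of_le (EReal.bot_lt_coe M) this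
  · refine EReal.ge_of_forall_gt_iff_ge.1 fun c hc => ?_
    obtain ⟨c', h1, h2⟩ := EReal.lt_iff_exists_real_btwn.1 hc
    have h3 : ∃ᶠ n in atTop, (c' : EReal) < v n :=
      frequently_lt_of_lt_limsup (by isBoundedDefault) h2
    have h4 : ∃ᶠ n : ℕ in atTop, c' * n ≤ u n := by
      refine (h3.and_eventually hpos).mono ?_
      rintro n ⟨h, hn⟩
      exact (hdiv hn).1 (EReal.coe_le_coe_iff.1 h.le)
    have h5 := hu c' c (EReal.coe_lt_coe_iff.1 h1) h4
    refine le_liminf_of_le (by isBoundedDefault) ?_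
    filter_upwards [h5, hpos] with n h hn
    exact EReal.coe_le_coe_iff.2 ((hdiv hn).2 h)

/-! ### Words and their partition functions -/

section Words

open Finset

variable {d : ℕ} {R : Finset (Fin d → ℤ)} [Nonempty R] {Ω : Type*}
  [AddAction (stepGroup R) Ω] {ℓ : ℕ}

/-- The infinite step sequence which starts with the word `s` and then repeats a fixed letter. -/
noncomputable def extendWord {n : ℕ} (s : Fin n → R) : ℕ → R :=
  fun i => if h : i < n then s ⟨i, h⟩ else Classical.arbitrary R

/-- The size `∑_w |g(ω, w)|` of the potential at the origin. -/
def envSum (g : Ω → (Fin ℓ → R) → ℝ) (ω : Ω) : ℝ := ∑ w, |g ω w|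

/-- A bound for the influence of the steps `Z_{n+1}, …, Z_{n+ℓ}` on the energy of a path whose
`n`-th position is the origin: it is made up of the sizes of the potential at all the sites
from which the origin is reached in at most `ℓ` steps. -/
def boundaryCost (g : Ω → (Fin ℓ → R) → ℝ) (ω : Ω) : ℝ :=
  2 * ∑ j ∈ range ℓ, ∑ v : Fin (j + 1) → R, envSum g (-(∑ i, stepElt (v i)) +ᵥ ω)

/-- The partition function `E[exp(n R_n(g)) 𝟙{X_n ∈ S}]` with the steps after time `n` frozen. -/
noncomputable def wordPartition (g : Ω → (Fin ℓ → R) → ℝ) (ω : Ω) (n : ℕ)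
    (S : Set (stepGroup R)) : ℝ :=
  ∑ s : Fin n → R, S.indicator
    (fun _ => (1 / (Fintype.card R : ℝ)) ^ n * Real.exp (energy g ω n (extendWord s)))
    (walkPos (extendWord s) n)

/-- The cost of following the word `u` from the origin: a bound for minus the logarithm of the
contribution of this single word to the partition function. -/
noncomputable def pathCost (g : Ω → (Fin ℓ → R) → ℝ) : Ω → List R → ℝ
  | _, [] => 0
  | ω, z :: u => envSum g ω + Real.log (Fintype.card R) + pathCost g (stepElt z +ᵥ ω) u

lemma envSum_nonneg (g : Ω → (Fin ℓ → R) → ℝ) (ω : Ω) : 0 ≤ envSum g ω :=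
  sum_nonneg fun _ _ => abs_nonneg _

lemma abs_le_envSum (g : Ω → (Fin ℓ → R) → ℝ) (ω : Ω) (w : Fin ℓ → R) : |g ω w| ≤ envSum g ω :=
  single_le_sum (f := fun w => |g ω w|) (fun _ _ => abs_nonneg _) (mem_univ w)

lemma boundaryCost_nonneg (g : Ω → (Fin ℓ → R) → ℝ) (ω : Ω) : 0 ≤ boundaryCost g ω :=
  mul_nonneg zero_le_two
    (sum_nonneg fun _ _ => sum_nonneg fun _ _ => envSum_nonneg g _)

lemma extendWord_apply {n : ℕ} (s : Fin n → R) {i : ℕ} (h : i < n) :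
    extendWord s i = s ⟨i, h⟩ := dif_pos h

lemma walkPos_zero (s : ℕ → R) : walkPos s 0 = 0 := by simp [walkPos]

lemma walkPos_add (s : ℕ → R) (m n : ℕ) :
    walkPos s (m + n) = walkPos s m + walkPos (fun i => s (m + i)) n :=
  sum_range_add _ _ _

lemma walkPos_congr {s s' : ℕ → R} {n : ℕ} (h : ∀ i < n, s i = s' i) :
    walkPos s n = walkPos s' n :=
  sum_congr rfl fun i hi => by rw [h i (mem_range.1 hi)]

lemma energy_add (g : Ω → (Fin ℓ → R) → ℝ) (ω : Ω) (m n : ℕ) (s : ℕ → R) :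
    energy g ω (m + n) s
      = energy g ω m s + energy g (walkPos s m +ᵥ ω) n (fun i => s (m + i)) := by
  unfold energy
  rw [sum_range_add]
  congr 1
  refine sum_congr rfl fun k _ => ?_
  rw [walkPos_add, add_comm (walkPos s m), add_vadd]
  simp only [add_assoc]

lemma energy_congr (g : Ω → (Fin ℓ → R) → ℝ) (ω : Ω) {n : ℕ} {s s' : ℕ → R}
    (h : ∀ i < n + ℓ, s i = s' i) : energy g ω n s = energy g ω n s' := by
  refine sum_congr rfl fun k hk => ?_
  have hk := mem_range.1 hk
  rw [walkPos_congr (s' := s') fun i hi => h i (by omega)]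
  congr 1
  funext i
  exact h _ (by omega)

lemma neg_sum_envSum_le_energy (g : Ω → (Fin ℓ → R) → ℝ) (ω : Ω) (n : ℕ) (s : ℕ → R) :
    -∑ k ∈ range n, envSum g (walkPos s k +ᵥ ω) ≤ energy g ω n s := by
  unfold energy
  rw [← sum_neg_distrib]
  exact sum_le_sum fun k _ => (neg_le_neg (abs_le_envSum g _ _)).trans (neg_abs_le _)

/-- The energy up to time `n` depends on the steps after time `n` only through its `ℓ` last
terms. -/
lemma abs_energy_sub_le (g : Ω → (Fin ℓ → R) → ℝ) (ω : Ω) {n : ℕ} {s s' : ℕ → R}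
    (h : ∀ i < n, s i = s' i) :
    |energy g ω n s - energy g ω n s'| ≤ boundaryCost g (walkPos s n +ᵥ ω) := by
  set F : ℕ → ℝ := fun j => ∑ v : Fin (j + 1) → R,
    envSum g (-(∑ i, stepElt (v i)) +ᵥ (walkPos s n +ᵥ ω)) with hF
  have hF0 : ∀ j, 0 ≤ F j := fun j => sum_nonneg fun _ _ => envSum_nonneg g _
  have hterm : ∀ k ∈ range n, |g (walkPos s k +ᵥ ω) (fun i : Fin ℓ => s (k + i))
      - g (walkPos s' k +ᵥ ω) (fun i : Fin ℓ => s' (k + i))|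
      ≤ if n - 1 - k < ℓ then 2 * F (n - 1 - k) else 0 := by
    intro k hk
    have hk := mem_range.1 hk
    rw [← walkPos_congr (s := s) (s' := s') (n := k) fun i hi => h i (by omega)]
    split_ifs with hkl
    · have h1 : envSum g (walkPos s k +ᵥ ω) ≤ F (n - 1 - k) := by
        have h2 : walkPos s k +ᵥ ω =
            -(∑ i : Fin (n - 1 - k + 1), stepElt (s (k + i))) +ᵥ (walkPos s n +ᵥ ω) := by
          rw [vadd_vadd]
          congr 1
          have h3 : n = k + (n - 1 - k + 1) := by omega
          conv_rhs => rw [h3, walkPos_add]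
          have h4 : walkPos (fun i => s (k + i)) (n - 1 - k + 1)
              = ∑ i : Fin (n - 1 - k + 1), stepElt (s (k + i)) :=
            (Fin.sum_univ_eq_sum_range (fun i => stepElt (s (k + i))) _).symm
          have h5 : n - 1 - k + 1 = k + (n - 1 - k + 1) - 1 - k + 1 := by omega
          rw [← h5, h4]
          abel
        rw [h2]
        exact single_le_sum (f := fun v : Fin (n - 1 - k + 1) → R =>
          envSum g (-(∑ i, stepElt (v i)) +ᵥ (walkPos s n +ᵥ ω)))
          (fun _ _ => envSum_nonneg g _) (mem_univ _)
      have h2 := abs_sub (g (walkPos s k +ᵥ ω) (fun i : Fin ℓ => s (k + i)))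
        (g (walkPos s k +ᵥ ω) (fun i : Fin ℓ => s' (k + i)))
      have h3 := abs_le_envSum g (walkPos s k +ᵥ ω) (fun i : Fin ℓ => s (k + i))
      have h4 := abs_le_envSum g (walkPos s k +ᵥ ω) (fun i : Fin ℓ => s' (k + i))
      linarith
    · have : (fun i : Fin ℓ => s (k + i)) = fun i : Fin ℓ => s' (k + i) := by
        funext i
        exact h _ (by omega)
      rw [this]; simp
  calc |energy g ω n s - energy g ω n s'|
      ≤ ∑ k ∈ range n, |g (walkPos s k +ᵥ ω) (fun i : Fin ℓ => s (k + i))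
        - g (walkPos s' k +ᵥ ω) (fun i : Fin ℓ => s' (k + i))| := by
        unfold energy
        rw [← sum_sub_distrib]
        exact abs_sum_le_sum_abs _ _
    _ ≤ ∑ k ∈ range n, (fun j => if j < ℓ then 2 * F j else 0) (n - 1 - k) := sum_le_sum hterm
    _ = ∑ j ∈ range n, if j < ℓ then 2 * F j else 0 :=
        sum_range_reflect (fun j => if j < ℓ then 2 * F j else 0) n
    _ = ∑ j ∈ (range n).filter (· < ℓ), 2 * F j := (sum_filter _ _).symm
    _ ≤ ∑ j ∈ range ℓ, 2 * F j := by
        refine sum_le_sum_of_subset_of_nonneg (fun j hj => ?_) fun j _ _ => ?_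
        · exact mem_range.2 (mem_filter.1 hj).2
        · exact mul_nonneg zero_le_two (hF0 j)
    _ = boundaryCost g (walkPos s n +ᵥ ω) := by rw [← mul_sum]; rfl

/-- Concatenation of words makes the partition functions supermultiplicative up to the
boundary cost at the junction. -/
theorem wordPartition_mul_le (g : Ω → (Fin ℓ → R) → ℝ) (ω : Ω) (m n : ℕ) (x y : stepGroup R) :
    wordPartition g ω m {x} * wordPartition g (x +ᵥ ω) n {y}
      ≤ Real.exp (boundaryCost g (x +ᵥ ω)) * wordPartition g ω (m + n) {x + y} := by
  unfold wordPartition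
  rw [sum_mul_sum, ← sum_product', univ_product_univ, mul_sum,
    ← (Fin.appendEquiv m n).sum_comp (fun s : Fin (m + n) → R =>
      Real.exp (boundaryCost g (x +ᵥ ω)) *
      ({x + y} : Set (stepGroup R)).indicator (fun _ => (1 / (Fintype.card R : ℝ)) ^ (m + n) *
        Real.exp (energy g ω (m + n) (extendWord s))) (walkPos (extendWord s) (m + n)))]
  refine sum_le_sum fun p _ => ?_
  obtain ⟨s₁, s₂⟩ := p
  set s : Fin (m + n) → R := Fin.appendEquiv m n (s₁, s₂) with hs
  have hs' : s = Fin.append s₁ s₂ := rfl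
  have h1 : ∀ i < m, extendWord s i = extendWord s₁ i := by
    intro i hi
    rw [extendWord_apply s (by omega : i < m + n), extendWord_apply s₁ hi, hs']
    exact Fin.append_left s₁ s₂ ⟨i, hi⟩
  have h2 : (fun i => extendWord s (m + i)) = extendWord s₂ := by
    funext i
    by_cases hi : i < n
    · rw [extendWord_apply s (by omega : m + i < m + n), extendWord_apply s₂ hi, hs']
      exact Fin.append_right s₁ s₂ ⟨i, hi⟩
    · rw [extendWord, extendWord, dif_neg hi, dif_neg (by omega)]
  by_cases hx : walkPos (extendWord s₁) m = x
  · by_cases hy : walkPos (extendWord s₂) n = y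
    · have h3 : walkPos (extendWord s) m = x := by rw [walkPos_congr h1, hx]
      have h4 : walkPos (extendWord s) (m + n) = x + y := by rw [walkPos_add, h2, h3, hy]
      have h5 := abs_energy_sub_le g ω (n := m) h1
      have h6 := energy_add g ω m n (extendWord s)
      rw [h3] at h5
      rw [h2, h3] at h6
      rw [Set.indicator_of_mem (by simpa using hx), Set.indicator_of_mem (by simpa using hy),
        Set.indicator_of_mem (by simpa using h4)]
      have h7 : Real.exp (energy g ω m (extendWord s₁))
          * Real.exp (energy g (x +ᵥ ω) n (extendWord s₂)) ≤
          Real.exp (boundaryCost g (x +ᵥ ω)) * Real.exp (energy g ω (m + n) (extendWord s)) := by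
        rw [← Real.exp_add, ← Real.exp_add, Real.exp_le_exp, h6]
        have := (abs_le.1 h5).1
        linarith
      have h8 : (0 : ℝ) ≤ (1 / (Fintype.card R : ℝ)) ^ (m + n) := by positivity
      calc _ = (1 / (Fintype.card R : ℝ)) ^ (m + n) * (Real.exp (energy g ω m (extendWord s₁))
          * Real.exp (energy g (x +ᵥ ω) n (extendWord s₂))) := by rw [pow_add]; ring
        _ ≤ _ := mul_le_mul_of_nonneg_left h7 h8
        _ = _ := by ring
    · rw [Set.indicator_of_notMem (s := {y}) (by simpa using hy), mul_zero]
      exact mul_nonneg (Real.exp_nonneg _) (Set.indicator_nonneg (fun _ _ => by positivity) _)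
  · rw [Set.indicator_of_notMem (s := {x}) (by simpa using hx), zero_mul]
    exact mul_nonneg (Real.exp_nonneg _) (Set.indicator_nonneg (fun _ _ => by positivity) _)

lemma pathCost_append (g : Ω → (Fin ℓ → R) → ℝ) (ω : Ω) (u v : List R) :
    pathCost g ω (u ++ v) = pathCost g ω u + pathCost g ((u.map stepElt).sum +ᵥ ω) v := by
  induction u generalizing ω with
  | nil => simp [pathCost]
  | cons z u ih =>
    simp only [List.cons_append, pathCost, ih, List.map_cons, List.sum_cons]
    rw [add_comm (stepElt z), add_vadd]
    ring

lemma log_card_nonneg (R : Finset (Fin d → ℤ)) : 0 ≤ Real.log (Fintype.card R) :=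
  Real.log_natCast_nonneg _

lemma pathCost_nonneg (g : Ω → (Fin ℓ → R) → ℝ) (ω : Ω) (u : List R) : 0 ≤ pathCost g ω u := by
  induction u generalizing ω with
  | nil => simp [pathCost]
  | cons z u ih =>
    simp only [pathCost]
    linarith [ih (stepElt z +ᵥ ω), envSum_nonneg g ω, log_card_nonneg R]

lemma walkPos_of_list {s : ℕ → R} {u : List R} (h : ∀ i (hi : i < u.length), s i = u[i]) :
    walkPos s u.length = (u.map stepElt).sum := by
  induction u generalizing s with
  | nil => simp [walkPos]
  | cons z u ih =>
    have h1 := ih (s := fun i => s (1 + i)) fun i hi => by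
      have := h (1 + i) (by simp; omega)
      simpa [add_comm 1 i] using this
    rw [List.length_cons, add_comm, walkPos_add, h1, List.map_cons, List.sum_cons]
    congr 1
    rw [walkPos, sum_range_one]
    exact congrArg stepElt (h 0 (by simp))

lemma neg_energy_add_le_pathCost (g : Ω → (Fin ℓ → R) → ℝ) (ω : Ω) {s : ℕ → R} {u : List R}
    (h : ∀ i (hi : i < u.length), s i = u[i]) :
    -energy g ω u.length s + u.length * Real.log (Fintype.card R) ≤ pathCost g ω u := by
  induction u generalizing s ω with
  | nil => simp [energy, pathCost]
  | cons z u ih =>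
    have h0 : s 0 = z := h 0 (by simp)
    have h1 := ih (stepElt z +ᵥ ω) (s := fun i => s (1 + i)) fun i hi => by
      have := h (1 + i) (by simp; omega)
      simpa [add_comm 1 i] using this
    have h2 : walkPos s 1 = stepElt z := by simp [walkPos, h0]
    have h3 := energy_add g ω 1 u.length s
    rw [h2] at h3
    have h4 := neg_sum_envSum_le_energy g ω 1 s
    simp only [sum_range_one, walkPos_zero, zero_vadd] at h4
    rw [List.length_cons, add_comm u.length, h3, pathCost]
    push_cast
    linarith

/-- A single word bounds the partition function from below. -/
lemma exp_neg_pathCost_le (g : Ω → (Fin ℓ → R) → ℝ) (ω : Ω) (u : List R) :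
    Real.exp (-pathCost g ω u) ≤ wordPartition g ω u.length {(u.map stepElt).sum} := by
  set s : Fin u.length → R := fun i => u[i]
  have hs : ∀ i (hi : i < u.length), extendWord s i = u[i] := fun i hi => extendWord_apply s hi
  have h1 : Real.exp (-pathCost g ω u) ≤ (1 / (Fintype.card R : ℝ)) ^ u.length
      * Real.exp (energy g ω u.length (extendWord s)) := by
    have hc : (0 : ℝ) < Fintype.card R := by exact_mod_cast Fintype.card_pos
    have : (1 / (Fintype.card R : ℝ)) ^ u.length
        = Real.exp (-(u.length * Real.log (Fintype.card R))) := by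
      rw [Real.exp_neg, Real.exp_nat_mul, Real.exp_log hc, one_div, inv_pow]
    rw [this, ← Real.exp_add, Real.exp_le_exp]
    linarith [neg_energy_add_le_pathCost g ω hs]
  refine h1.trans ?_
  unfold wordPartition
  refine le_trans (le_of_eq ?_) (single_le_sum (f := fun s : Fin u.length → R =>
    ({(u.map stepElt).sum} : Set (stepGroup R)).indicator
      (fun _ => (1 / (Fintype.card R : ℝ)) ^ u.length
        * Real.exp (energy g ω u.length (extendWord s))) (walkPos (extendWord s) u.length))
    (fun _ _ => Set.indicator_nonneg (fun _ _ => by positivity) _) (mem_univ s))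
  rw [Set.indicator_of_mem]
  exact walkPos_of_list hs

/-- The endpoint of any path which uses each step `z` exactly `a z` times. -/
def countPos (a : R → ℕ) : stepGroup R := ∑ z, a z • stepElt z

/-- The logarithm of the partition function of the paths that have the length and the endpoint
of a path which uses each step `z` exactly `a z` times. -/
noncomputable def countEnergy (g : Ω → (Fin ℓ → R) → ℝ) (ω : Ω) (a : R → ℕ) : ℝ :=
  Real.log (wordPartition g ω (∑ z, a z) {countPos a})

lemma exists_word (a : R → ℕ) :
    ∃ u : List R, u.length = ∑ z, a z ∧ (u.map stepElt).sum = countPos a := by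
  refine ⟨(∑ z, a z • ({z} : Multiset R)).toList, ?_, ?_⟩
  · rw [Multiset.length_toList, Multiset.card_sum]
    simp
  · rw [← Multiset.sum_coe, ← Multiset.map_coe, Multiset.coe_toList]
    rw [← Multiset.coe_mapAddMonoidHom, map_sum, Multiset.sum_sum]
    simp [countPos, Multiset.map_nsmul, Multiset.sum_nsmul]

lemma wordPartition_count_pos (g : Ω → (Fin ℓ → R) → ℝ) (ω : Ω) (a : R → ℕ) :
    0 < wordPartition g ω (∑ z, a z) {countPos a} := by
  obtain ⟨u, h1, h2⟩ := exists_word a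
  rw [← h1, ← h2]
  exact lt_of_lt_of_le (Real.exp_pos _) (exp_neg_pathCost_le g ω u)

lemma countPos_add (a c : R → ℕ) : countPos (a + c) = countPos a + countPos c := by
  simp [countPos, add_smul, sum_add_distrib]

lemma countPos_nsmul (q : ℕ) (a : R → ℕ) : countPos (q • a) = q • countPos a := by
  simp [countPos, mul_smul, smul_sum]

lemma countEnergy_add_le (g : Ω → (Fin ℓ → R) → ℝ) (ω : Ω) (a c : R → ℕ) :
    countEnergy g ω a + countEnergy g (countPos a +ᵥ ω) c
      - boundaryCost g (countPos a +ᵥ ω) ≤ countEnergy g ω (a + c) := by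
  have h := wordPartition_mul_le g ω (∑ z, a z) (∑ z, c z) (countPos a) (countPos c)
  have h1 := wordPartition_count_pos g ω a
  have h2 := wordPartition_count_pos g (countPos a +ᵥ ω) c
  have h3 := wordPartition_count_pos g ω (a + c)
  have h4 : ∑ z, (a + c) z = ∑ z, a z + ∑ z, c z := by simp [sum_add_distrib]
  rw [countPos_add, h4] at h3
  unfold countEnergy
  rw [countPos_add, h4]
  have := Real.log_le_log (mul_pos h1 h2) h
  rw [Real.log_mul h1.ne' h2.ne', Real.log_mul (Real.exp_ne_zero _) h3.ne', Real.log_exp] at this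
  linarith

lemma neg_pathCost_le_countEnergy (g : Ω → (Fin ℓ → R) → ℝ) (ω : Ω) {a : R → ℕ} {u : List R}
    (h1 : u.length = ∑ z, a z) (h2 : (u.map stepElt).sum = countPos a) :
    -pathCost g ω u ≤ countEnergy g ω a := by
  have := Real.log_le_log (Real.exp_pos _) (exp_neg_pathCost_le g ω u)
  rwa [Real.log_exp, h1, h2] at this

end Words

/-! ### The walk and its words -/

section Law

open Finset

variable {d : ℕ} {R : Finset (Fin d → ℤ)} [Nonempty R] {Ω : Type*}
  [AddAction (stepGroup R) Ω] {ℓ : ℕ}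

lemma walkLaw_firstSteps (R : Finset (Fin d → ℤ)) [Nonempty R] {n : ℕ} (v : Fin n → R) :
    walkLaw R {s | (fun i : Fin n => s i) = v} = ((Fintype.card R : ENNReal)⁻¹) ^ n := by
  have h1 : {s : ℕ → R | (fun i : Fin n => s i) = v}
      = Set.pi (range n : Finset ℕ) (fun i => {extendWord v i}) := by
    ext s
    simp only [Set.mem_ofPred_eq, Set.mem_pi, Set.mem_singleton_iff, coe_range, Set.mem_Iio]
    constructor
    · rintro rfl i hi
      rw [extendWord_apply _ hi]
    · intro h
      funext i
      rw [h i i.2, extendWord_apply _ i.2]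
  rw [h1, walkLaw, Measure.infinitePi_pi _ fun i _ => measurableSet_singleton _]
  simp

instance : IsProbabilityMeasure (walkLaw R) := by
  unfold walkLaw; infer_instance

lemma measurable_firstSteps (n : ℕ) : Measurable (fun (s : ℕ → R) (i : Fin n) => s i) :=
  measurable_pi_lambda _ fun _ => measurable_pi_apply _

lemma integrable_firstSteps {n : ℕ} (F : (Fin n → R) → ℝ) :
    Integrable (fun s : ℕ → R => F (fun i => s i)) (walkLaw R) :=
  Integrable.comp_measurable (.of_finite) (measurable_firstSteps n)

/-- The expectation of a function of the first `n` steps is an average over words. -/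
lemma integral_firstSteps {n : ℕ} (F : (Fin n → R) → ℝ) :
    ∫ s, F (fun i => s i) ∂(walkLaw R) = ∑ v, (1 / (Fintype.card R : ℝ)) ^ n * F v := by
  have h1 := integral_map (μ := walkLaw R) (measurable_firstSteps n).aemeasurable
    (f := F) (measurable_of_finite F).aestronglyMeasurable
  rw [← h1, integral_fintype .of_finite]
  refine sum_congr rfl fun v _ => ?_
  rw [Measure.real, Measure.map_apply (measurable_firstSteps n) (measurableSet_singleton v)]
  have h2 : (fun (s : ℕ → R) (i : Fin n) => s i) ⁻¹' {v} = {s | (fun i : Fin n => s i) = v} := rfl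
  rw [h2, walkLaw_firstSteps]
  simp

/-- Freezing the steps after time `n` changes the partition function by a factor
controlled by the boundary cost at the endpoint. -/
theorem integral_indicator_mem_Icc (g : Ω → (Fin ℓ → R) → ℝ) (ω : Ω) (n : ℕ)
    (S : Set (stepGroup R)) {B : ℝ}
    (hB : ∀ s : ℕ → R, walkPos s n ∈ S → boundaryCost g (walkPos s n +ᵥ ω) ≤ B) :
    ∫ s, S.indicator (fun _ => Real.exp (energy g ω n s)) (walkPos s n) ∂(walkLaw R) ∈
      Set.Icc (Real.exp (-B) * wordPartition g ω n S) (Real.exp B * wordPartition g ω n S) := by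
  set f : (ℕ → R) → ℝ := fun s => S.indicator (fun _ => Real.exp (energy g ω n s)) (walkPos s n)
    with hf
  have hfe : ∀ s, f (extendWord fun i : Fin (n + ℓ) => s i) = f s := by
    intro s
    have h1 : ∀ i < n + ℓ, extendWord (fun i : Fin (n + ℓ) => s i) i = s i := fun i hi =>
      extendWord_apply _ hi
    simp only [hf]
    rw [energy_congr g ω h1, walkPos_congr (n := n) fun i hi => h1 i (by omega)]
  have hfi : Integrable f (walkLaw R) := by
    have := integrable_firstSteps (R := R) (n := n + ℓ) fun v => f (extendWord v)
    simpa only [hfe] using this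
  set F : (Fin n → R) → ℝ := fun v => f (extendWord v) with hF
  have hFi := integrable_firstSteps F
  have hFs : ∫ s, F (fun i => s i) ∂(walkLaw R) = wordPartition g ω n S := by
    rw [integral_firstSteps, wordPartition]
    refine sum_congr rfl fun v _ => ?_
    simp only [hF, hf]
    by_cases h : walkPos (extendWord v) n ∈ S
    · rw [Set.indicator_of_mem h, Set.indicator_of_mem h]
    · rw [Set.indicator_of_notMem h, Set.indicator_of_notMem h, mul_zero]
  have key : ∀ s, Real.exp (-B) * F (fun i => s i) ≤ f s ∧ f s ≤ Real.exp B * F (fun i => s i) := by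
    intro s
    have h1 : ∀ i < n, s i = extendWord (fun i : Fin n => s i) i := fun i hi =>
      (extendWord_apply (fun i : Fin n => s i) hi).symm
    have h2 := walkPos_congr h1
    simp only [hF, hf]
    rw [← h2]
    by_cases h : walkPos s n ∈ S
    · rw [Set.indicator_of_mem h, Set.indicator_of_mem h, ← Real.exp_add, ← Real.exp_add,
        Real.exp_le_exp, Real.exp_le_exp]
      have h3 := abs_le.1 ((abs_energy_sub_le g ω h1).trans (hB s h))
      constructor <;> linarith [h3.1, h3.2]
    · rw [Set.indicator_of_notMem h, Set.indicator_of_notMem h, mul_zero, mul_zero]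
      exact ⟨le_rfl, le_rfl⟩
  rw [← hFs, ← integral_const_mul, ← integral_const_mul]
  exact ⟨integral_mono (hFi.const_mul _) hfi fun s => (key s).1,
    integral_mono hfi (hFi.const_mul _) fun s => (key s).2⟩

theorem pointPartition_mem_Icc (g : Ω → (Fin ℓ → R) → ℝ) (ω : Ω) (n : ℕ) (x : stepGroup R) :
    pointPartition g ω n (x : Fin d → ℤ) ∈
      Set.Icc (Real.exp (-boundaryCost g (x +ᵥ ω)) * wordPartition g ω n {x})
        (Real.exp (boundaryCost g (x +ᵥ ω)) * wordPartition g ω n {x}) := by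
  have h := integral_indicator_mem_Icc g ω n {x} (B := boundaryCost g (x +ᵥ ω)) (by
    rintro s rfl; exact le_rfl)
  convert h using 2
  unfold pointPartition
  refine integral_congr_ae (ae_of_all _ fun s => ?_)
  simp only [Set.indicator, Set.mem_ofPred_eq, Set.mem_singleton_iff, Subtype.ext_iff]

theorem linePartition_mem_Icc (g : Ω → (Fin ℓ → R) → ℝ) (ω : Ω) (n : ℕ) {B : ℝ}
    (hB : ∀ s : ℕ → R, boundaryCost g (walkPos s n +ᵥ ω) ≤ B) :
    linePartition g ω n ∈ Set.Icc (Real.exp (-B) * wordPartition g ω n Set.univ)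
      (Real.exp B * wordPartition g ω n Set.univ) := by
  have h := integral_indicator_mem_Icc g ω n Set.univ fun s _ => hB s
  simpa [linePartition] using h

/-- The number of times that the word `s` uses each step. -/
def wordCount {n : ℕ} (s : Fin n → R) (z : R) : ℕ := by
  classical exact (univ.filter fun i => s i = z).card

lemma sum_wordCount {n : ℕ} (s : Fin n → R) : ∑ z, wordCount s z = n := by
  classical
  have := card_eq_sum_card_fiberwise (f := s) (s := univ) (t := univ)
    (fun _ _ => mem_coe.2 (mem_univ _))
  simpa [wordCount] using this.symm

lemma countPos_wordCount {n : ℕ} (s : ℕ → R) :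
    countPos (wordCount fun i : Fin n => s i) = walkPos s n := by
  classical
  rw [walkPos, ← Fin.sum_univ_eq_sum_range (fun i => stepElt (s i)),
    ← sum_fiberwise_of_maps_to (s := univ) (t := univ) (g := fun i : Fin n => s i)
      (fun _ _ => mem_univ _)]
  refine sum_congr rfl fun z _ => ?_
  rw [sum_congr rfl (g := fun _ => stepElt z) fun i hi => by rw [(mem_filter.1 hi).2], sum_const]
  rfl

lemma wordPartition_mono (g : Ω → (Fin ℓ → R) → ℝ) (ω : Ω) (n : ℕ) {S S' : Set (stepGroup R)}
    (h : S ⊆ S') : wordPartition g ω n S ≤ wordPartition g ω n S' :=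
  sum_le_sum fun _ _ => Set.indicator_le_indicator_of_subset h (fun _ => by positivity) _

/-- The free energy of all paths of length `n` exceeds that of the best endpoint by at most the
logarithm of the number of step counts. -/
theorem exists_log_wordPartition_univ_le (g : Ω → (Fin ℓ → R) → ℝ) (ω : Ω) (n : ℕ) :
    ∃ a : R → ℕ, ∑ z, a z = n ∧ Real.log (wordPartition g ω n Set.univ) ≤
      Fintype.card R * Real.log (n + 1) + countEnergy g ω a := by
  classical
  -- the step counts of length `n`
  set I : Finset (R → ℕ) := (Fintype.piFinset fun _ : R => range (n + 1)).filter
    fun a => ∑ z, a z = n with hI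
  have hmem : ∀ s : Fin n → R, wordCount s ∈ I := by
    intro s
    rw [hI, mem_filter]
    refine ⟨Fintype.mem_piFinset.2 fun z => mem_range.2 ?_, sum_wordCount s⟩
    have := single_le_sum (f := wordCount s) (fun _ _ => Nat.zero_le _) (mem_univ z)
    rw [sum_wordCount] at this
    omega
  have hne : I.Nonempty := ⟨_, hmem fun _ => Classical.arbitrary R⟩
  obtain ⟨a, ha, hmax⟩ := exists_max_image I (fun a => wordPartition g ω n {countPos a}) hne
  have han : ∑ z, a z = n := (mem_filter.1 ha).2
  refine ⟨a, han, ?_⟩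
  have h1 : wordPartition g ω n Set.univ ≤ ∑ b ∈ I, wordPartition g ω n {countPos b} := by
    unfold wordPartition
    rw [sum_comm]
    refine sum_le_sum fun s _ => ?_
    refine le_trans (le_of_eq ?_) (single_le_sum (fun b _ => Set.indicator_nonneg
      (fun _ _ => by positivity) _) (hmem s))
    rw [Set.indicator_of_mem (Set.mem_univ _), Set.indicator_of_mem]
    rw [Set.mem_singleton_iff, ← countPos_wordCount (n := n)]
    congr 1
    congr 1
    funext i
    rw [extendWord_apply s i.2]
  have h2 : (I.card : ℝ) ≤ ((n : ℝ) + 1) ^ Fintype.card R := by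
    have : I.card ≤ (n + 1) ^ Fintype.card R := by
      refine (card_filter_le _ _).trans ?_
      simp [Fintype.card_piFinset]
    exact_mod_cast this
  have hpos := wordPartition_count_pos g ω a
  rw [han] at hpos
  have h3 : wordPartition g ω n Set.univ
      ≤ ((n : ℝ) + 1) ^ Fintype.card R * wordPartition g ω n {countPos a} := by
    refine h1.trans ((sum_le_card_nsmul I _ _ hmax).trans ?_)
    rw [nsmul_eq_mul]
    exact mul_le_mul_of_nonneg_right h2 hpos.le
  have h4 : 0 < wordPartition g ω n Set.univ :=
    lt_of_lt_of_le hpos (wordPartition_mono g ω n (Set.subset_univ _))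
  have h5 := Real.log_le_log h4 h3
  rw [Real.log_mul (by positivity) hpos.ne', Real.log_pow] at h5
  rwa [countEnergy, han]

end Law

/-! ### Limits along multiples of a step count -/

section Kingman

open Finset

variable {d : ℕ} {R : Finset (Fin d → ℤ)} [Nonempty R] {Ω : Type*} [MeasurableSpace Ω]
  [AddAction (stepGroup R) Ω] [MeasurableConstVAdd (stepGroup R) Ω] {ℓ : ℕ}
  {μ : Measure Ω}

lemma measurable_envSum {g : Ω → (Fin ℓ → R) → ℝ} (hg : ∀ w, Measurable fun ω => g ω w) :
    Measurable (envSum g) :=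
  Finset.measurable_sum _ fun w _ => (hg w).abs

lemma measurable_boundaryCost {g : Ω → (Fin ℓ → R) → ℝ} (hg : ∀ w, Measurable fun ω => g ω w) :
    Measurable (boundaryCost g) :=
  (Finset.measurable_sum _ fun _ _ => Finset.measurable_sum _ fun _ _ =>
    (measurable_envSum hg).comp (measurable_const_vadd _)).const_mul 2

lemma measurable_pathCost {g : Ω → (Fin ℓ → R) → ℝ} (hg : ∀ w, Measurable fun ω => g ω w)
    (u : List R) : Measurable fun ω => pathCost g ω u := by
  induction u with
  | nil => exact measurable_const
  | cons z u ih =>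
    exact ((measurable_envSum hg).add measurable_const).add (ih.comp (measurable_const_vadd _))

lemma measurable_wordPartition {g : Ω → (Fin ℓ → R) → ℝ} (hg : ∀ w, Measurable fun ω => g ω w)
    (n : ℕ) (S : Set (stepGroup R)) : Measurable fun ω => wordPartition g ω n S := by
  refine Finset.measurable_sum _ fun s _ => ?_
  by_cases h : walkPos (extendWord s) n ∈ S
  · simp only [Set.indicator_of_mem h]
    exact (Real.measurable_exp.comp (Finset.measurable_sum _ fun k _ =>
      (hg _).comp (measurable_const_vadd _))).const_mul _
  · simp only [Set.indicator_of_notMem h]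
    exact measurable_const

variable [VAddInvariantMeasure (stepGroup R) Ω μ]

lemma integrable_envSum {g : Ω → (Fin ℓ → R) → ℝ} (hg : ∀ w, Integrable (fun ω => g ω w) μ) :
    Integrable (envSum g) μ :=
  integrable_finsetSum _ fun w _ => (hg w).abs

lemma integrable_comp_vadd {f : Ω → ℝ} (hf : Integrable f μ) (x : stepGroup R) :
    Integrable (fun ω => f (x +ᵥ ω)) μ :=
  (measurePreserving_vadd x μ).integrable_comp_of_integrable hf

lemma integrable_boundaryCost {g : Ω → (Fin ℓ → R) → ℝ}
    (hg : ∀ w, Integrable (fun ω => g ω w) μ) : Integrable (boundaryCost g) μ :=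
  (integrable_finsetSum _ fun _ _ => integrable_finsetSum _ fun _ _ =>
    integrable_comp_vadd (integrable_envSum hg) _).const_mul 2

lemma integrable_pathCost [IsFiniteMeasure μ] {g : Ω → (Fin ℓ → R) → ℝ}
    (hg : ∀ w, Integrable (fun ω => g ω w) μ) (u : List R) :
    Integrable (fun ω => pathCost g ω u) μ := by
  induction u with
  | nil => exact integrable_zero _ _ _
  | cons z u ih =>
    exact ((integrable_envSum hg).add (integrable_const _)).add (integrable_comp_vadd ih _)

lemma ae_hasLinearGrowth_nsmul_of_measurable [IsFiniteMeasure μ] {g : Ω → (Fin ℓ → R) → ℝ}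
    (hgm : ∀ w, Measurable fun ω => g ω w) (hg : ∀ w, Integrable (fun ω => g ω w) μ) (a : R → ℕ) :
    ∀ᵐ ω ∂μ, HasLinearGrowth fun q => countEnergy g ω (q • a) := by
  obtain ⟨u, hu1, hu2⟩ := exists_word a
  -- subtracting the boundary cost makes the process superadditive
  have key := ae_hasLinearGrowth_of_superadditive (measurePreserving_vadd (countPos a) μ)
    (G := fun q ω => countEnergy g ω (q • a) - boundaryCost g ω)
    (fun q => (Real.measurable_log.comp (measurable_wordPartition hgm _ _)).sub
      (measurable_boundaryCost hgm))
    (fun m n ω _ _ => by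
      have h := countEnergy_add_le g ω (m • a) (n • a)
      rw [← add_smul, countPos_nsmul] at h
      rw [vadd_iterate_apply]
      linarith)
    (f := fun ω => pathCost g ω u + boundaryCost g ω)
    ((measurable_pathCost hgm u).add (measurable_boundaryCost hgm))
    ((integrable_pathCost hg u).add (integrable_boundaryCost hg))
    (fun ω => add_nonneg (pathCost_nonneg g ω u) (boundaryCost_nonneg g ω))
    (fun ω => by
      have := neg_pathCost_le_countEnergy g ω hu1 hu2
      rw [one_smul]
      linarith)
  filter_upwards [key] with ω hω
  exact hω.of_abs_sub_le (C := boundaryCost g ω) fun q => by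
    rw [sub_sub_cancel_left, abs_neg, abs_of_nonneg (boundaryCost_nonneg g ω)]

lemma wordPartition_congr {g g' : Ω → (Fin ℓ → R) → ℝ} {ω : Ω}
    (h : ∀ (x : stepGroup R) w, g (x +ᵥ ω) w = g' (x +ᵥ ω) w) (n : ℕ) (S : Set (stepGroup R)) :
    wordPartition g ω n S = wordPartition g' ω n S := by
  simp only [wordPartition, energy, h]

/-- Almost surely the free energy along the multiples of each step count has a limiting slope. -/
theorem ae_hasLinearGrowth_nsmul [IsFiniteMeasure μ] {g : Ω → (Fin ℓ → R) → ℝ}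
    (hg : ∀ w, Integrable (fun ω => g ω w) μ) :
    ∀ᵐ ω ∂μ, ∀ a : R → ℕ, HasLinearGrowth fun q => countEnergy g ω (q • a) := by
  -- a measurable modification agrees with `g` on almost every orbit, the group being countable
  set g' : Ω → (Fin ℓ → R) → ℝ := fun ω w => (hg w).aestronglyMeasurable.mk _ ω
  have h1 : ∀ᵐ ω ∂μ, ∀ (x : stepGroup R) w, g (x +ᵥ ω) w = g' (x +ᵥ ω) w := by
    rw [ae_all_iff]; intro x
    rw [ae_all_iff]; intro w
    exact (measurePreserving_vadd x μ).quasiMeasurePreserving.ae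
      (hg w).aestronglyMeasurable.ae_eq_mk
  have h2 := ae_all_iff.2 fun a : R → ℕ => ae_hasLinearGrowth_nsmul_of_measurable (μ := μ) (g := g')
    (fun w => (hg w).aestronglyMeasurable.stronglyMeasurable_mk.measurable)
    (fun w => (hg w).congr (hg w).aestronglyMeasurable.ae_eq_mk) a
  filter_upwards [h1, h2] with ω h1 h2 a
  simpa only [countEnergy, wordPartition_congr h1] using h2 a

end Kingman

/-! ### Cheap connecting paths -/

section Runs

open Finset

variable {d : ℕ} {R : Finset (Fin d → ℤ)} [Nonempty R] {Ω : Type*}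
  [AddAction (stepGroup R) Ω] {ℓ : ℕ}

/-- The property of an environment which the class `𝓛` provides: straight runs of at most `ε n`
nonzero steps at distance of order `n` from the origin have a cost of at most `δ n`. -/
def HasSmallRuns (g : Ω → (Fin ℓ → R) → ℝ) (ω : Ω) : Prop :=
  ∀ K : ℕ, ∀ δ : ℝ, 0 < δ → ∃ ε : ℝ, 0 < ε ∧ ∀ᶠ n : ℕ in atTop, ∀ x : stepGroup R,
    ‖latticePt (x : Fin d → ℤ)‖ ≤ K * n → ∀ z : R, (z : Fin d → ℤ) ≠ 0 → ∀ m : ℕ, m ≤ ε * n →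
      ∑ k ∈ range m, (envSum g ((x + k • stepElt z) +ᵥ ω) + Real.log (Fintype.card R)) ≤ δ * n

/-- The normalized largest sum of `|g(·, w)|` along a run of `ε n` steps `z`. -/
noncomputable def maxRun (g : Ω → (Fin ℓ → R) → ℝ) (ω : Ω) (z : R) (w : Fin ℓ → R) (ε : ℝ)
    (n : ℕ) : ENNReal :=
  ⨆ (x : stepGroup R) (_ : ‖latticePt (x : Fin d → ℤ)‖ ≤ (n : ℝ)),
    ENNReal.ofReal ((1 / (n : ℝ)) *
      ∑ k ∈ Finset.range (⌊ε * (n : ℝ)⌋₊ + 1), |g ((x + k • stepElt z) +ᵥ ω) w|)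

lemma ClassL.ae_exists_run_le [MeasurableSpace Ω] {μ : Measure Ω} {g : Ω → (Fin ℓ → R) → ℝ}
    (hg : ClassL μ g) : ∀ᵐ ω ∂μ, ∀ z : R, (z : Fin d → ℤ) ≠ 0 → ∀ δ : ℝ, 0 < δ →
      ∃ ε : ℝ, 0 < ε ∧ ∀ᶠ n : ℕ in atTop, ∀ x : stepGroup R,
        ‖latticePt (x : Fin d → ℤ)‖ ≤ n →
        ∑ k ∈ range (⌊ε * (n : ℝ)⌋₊ + 1), envSum g ((x + k • stepElt z) +ᵥ ω) ≤ δ * n := by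
  have h : ∀ᵐ ω ∂μ, ∀ z : R, ∀ w, (z : Fin d → ℤ) ≠ 0 →
      limsup (fun ε : ℝ => limsup (maxRun g ω z w ε) atTop) (𝓝[>] 0) = 0 := by
    rw [ae_all_iff]; intro z
    rw [ae_all_iff]; intro w
    by_cases hz : (z : Fin d → ℤ) = 0
    · exact ae_of_all _ fun ω h => absurd hz h
    · filter_upwards [(hg w).2 z hz] with ω hω _
      simp only [Nat.cast_one] at hω
      exact hω
  filter_upwards [h] with ω hω z hz δ hδ
  set W : ℝ := (Fintype.card (Fin ℓ → R) : ℝ) + 1 with hW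
  have hW0 : 0 < W := by positivity
  have hδ' : 0 < δ / W := div_pos hδ hW0
  have h1 : ∀ᶠ ε : ℝ in 𝓝[>] 0, ∀ w,
      limsup (maxRun g ω z w ε) atTop < ENNReal.ofReal (δ / W) := by
    rw [eventually_all]
    intro w
    refine eventually_lt_of_limsup_lt ?_ (by isBoundedDefault)
    rw [hω z w hz]
    exact ENNReal.ofReal_pos.2 hδ'
  obtain ⟨ε, h2, hε⟩ := (h1.and self_mem_nhdsWithin).exists
  refine ⟨ε, hε, ?_⟩
  have h3 : ∀ᶠ n : ℕ in atTop, ∀ w, maxRun g ω z w ε n < ENNReal.ofReal (δ / W) := by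
    rw [eventually_all]
    intro w
    exact eventually_lt_of_limsup_lt (h2 w) (by isBoundedDefault)
  filter_upwards [h3, eventually_gt_atTop 0] with n hn hn0 x hx
  have hn0' : (0 : ℝ) < n := by exact_mod_cast hn0
  have h4 : ∀ w, ∑ k ∈ range (⌊ε * (n : ℝ)⌋₊ + 1), |g ((x + k • stepElt z) +ᵥ ω) w|
      ≤ δ / W * n := by
    intro w
    have h5 := (le_iSup₂ (f := fun (x : stepGroup R) (_ : ‖latticePt (x : Fin d → ℤ)‖ ≤ (n : ℝ)) =>
      ENNReal.ofReal ((1 / (n : ℝ)) *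
        ∑ k ∈ Finset.range (⌊ε * (n : ℝ)⌋₊ + 1), |g ((x + k • stepElt z) +ᵥ ω) w|)) x hx).trans_lt
      (hn w)
    have h6 := ((ENNReal.ofReal_lt_ofReal_iff hδ').1 h5).le
    rwa [one_div_mul_eq_div, div_le_iff₀ hn0'] at h6
  calc ∑ k ∈ range (⌊ε * (n : ℝ)⌋₊ + 1), envSum g ((x + k • stepElt z) +ᵥ ω)
      = ∑ w, ∑ k ∈ range (⌊ε * (n : ℝ)⌋₊ + 1), |g ((x + k • stepElt z) +ᵥ ω) w| := by
        unfold envSum; exact sum_comm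
    _ ≤ ∑ _w : Fin ℓ → R, δ / W * n := sum_le_sum fun w _ => h4 w
    _ = (W - 1) * (δ / W * n) := by simp [hW]
    _ ≤ W * (δ / W * n) := by
        refine mul_le_mul_of_nonneg_right (by linarith) (by positivity)
    _ = δ * n := by field_simp

theorem ClassL.ae_hasSmallRuns [MeasurableSpace Ω] {μ : Measure Ω} {g : Ω → (Fin ℓ → R) → ℝ}
    (hg : ClassL μ g) : ∀ᵐ ω ∂μ, HasSmallRuns g ω := by
  filter_upwards [hg.ae_exists_run_le] with ω hω K δ hδ
  set c : ℝ := Real.log (Fintype.card R) with hc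
  have hc0 : 0 ≤ c := log_card_nonneg R
  have hK : (0 : ℝ) < (K : ℝ) + 1 := by positivity
  have h1 : ∀ z : R, ∃ ε : ℝ, 0 < ε ∧ ∀ᶠ n : ℕ in atTop, ∀ x : stepGroup R,
      ‖latticePt (x : Fin d → ℤ)‖ ≤ K * n → (z : Fin d → ℤ) ≠ 0 → ∀ m : ℕ, m ≤ ε * n →
      ∑ k ∈ range m, (envSum g ((x + k • stepElt z) +ᵥ ω) + c) ≤ δ * n := by
    intro z
    by_cases hz : (z : Fin d → ℤ) = 0
    · exact ⟨1, one_pos, Eventually.of_forall fun n x _ h => absurd hz h⟩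
    obtain ⟨ε, hε, h⟩ := hω z hz (δ / 2 / (K + 1)) (by positivity)
    refine ⟨min ε (δ / 2 / (c + 1)), lt_min hε (by positivity), ?_⟩
    have ht : Tendsto (fun n : ℕ => (K + 1) * n) atTop atTop :=
      tendsto_id.const_mul_atTop' (Nat.succ_pos K)
    filter_upwards [ht.eventually h] with n hn x hx _ m hm
    have hn0 : (0 : ℝ) ≤ n := Nat.cast_nonneg n
    have h2 := hn x (by push_cast; nlinarith)
    have hm1 : (m : ℝ) ≤ ε * n := hm.trans (mul_le_mul_of_nonneg_right (min_le_left _ _) hn0)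
    have hm2 : (m : ℝ) ≤ δ / 2 / (c + 1) * n :=
      hm.trans (mul_le_mul_of_nonneg_right (min_le_right _ _) hn0)
    have h3 : m ≤ ⌊ε * (((K + 1) * n : ℕ) : ℝ)⌋₊ + 1 := by
      refine (Nat.le_floor ?_).trans (Nat.le_succ _)
      push_cast
      have : 0 ≤ ε * (K * n) := by positivity
      linarith [mul_assoc ε ((K : ℝ) + 1) n]
    have h4 : ∑ k ∈ range m, envSum g ((x + k • stepElt z) +ᵥ ω) ≤ δ / 2 * n := by
      refine (sum_le_sum_of_subset_of_nonneg (range_subset_range.2 h3)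
        fun _ _ _ => envSum_nonneg _ _).trans (h2.trans (le_of_eq ?_))
      push_cast
      field_simp
    have h5 : (m : ℝ) * c ≤ δ / 2 * n := by
      have : (m : ℝ) * (c + 1) ≤ δ / 2 * n := by
        have := mul_le_mul_of_nonneg_right hm2 (by linarith : (0 : ℝ) ≤ c + 1)
        have e : δ / 2 / (c + 1) * n * (c + 1) = δ / 2 * n := by field_simp
        linarith
      have hm0 : (0 : ℝ) ≤ m := Nat.cast_nonneg m
      linarith
    rw [sum_add_distrib, sum_const, card_range, nsmul_eq_mul]
    linarith
  choose ε hε h using h1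
  obtain ⟨z₀, hz₀⟩ := Finite.exists_min ε
  refine ⟨ε z₀, hε z₀, ?_⟩
  filter_upwards [eventually_all.2 h] with n hn x hx z hz m hm
  exact hn z x hx hz m (hm.trans (mul_le_mul_of_nonneg_right (hz₀ z) (Nat.cast_nonneg n)))

lemma latticePt_add (x y : Fin d → ℤ) : latticePt (x + y) = latticePt x + latticePt y := by
  ext i; simp [latticePt]

/-- The embedding of the lattice, as an additive homomorphism. -/
noncomputable def latticeHom (d : ℕ) : (Fin d → ℤ) →+ EuclideanSpace ℝ (Fin d) where
  toFun := latticePt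
  map_zero' := by ext i; simp [latticePt]
  map_add' := latticePt_add

/-- A bound for the length of a step. -/
noncomputable def stepBound (R : Finset (Fin d → ℤ)) : ℕ := ⌈∑ z : R, ‖latticePt (z : Fin d → ℤ)‖⌉₊

lemma norm_step_le (z : R) : ‖latticePt (z : Fin d → ℤ)‖ ≤ stepBound R :=
  (single_le_sum (f := fun z : R => ‖latticePt (z : Fin d → ℤ)‖) (fun _ _ => norm_nonneg _)
    (mem_univ z)).trans (Nat.le_ceil _)

lemma norm_latticePt_add_le (x y : stepGroup R) : ‖latticePt ((x + y : stepGroup R) : Fin d → ℤ)‖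
    ≤ ‖latticePt (x : Fin d → ℤ)‖ + ‖latticePt (y : Fin d → ℤ)‖ := by
  rw [AddSubgroup.coe_add, latticePt_add]
  exact norm_add_le _ _

lemma norm_sum_nsmul_le (s : Finset R) (c : R → ℕ) :
    ‖latticePt ((∑ z ∈ s, c z • stepElt z : stepGroup R) : Fin d → ℤ)‖
      ≤ stepBound R * ∑ z ∈ s, (c z : ℝ) := by
  have h : latticePt ((∑ z ∈ s, c z • stepElt z : stepGroup R) : Fin d → ℤ)
      = ∑ z ∈ s, c z • latticePt (z : Fin d → ℤ) := by
    have := map_sum ((latticeHom d).comp (stepGroup R).subtype) (fun z => c z • stepElt z) s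
    simp only [map_nsmul] at this
    exact this
  rw [h, mul_sum]
  refine norm_sum_le_of_le _ fun z _ => ?_
  rw [← Nat.cast_smul_eq_nsmul ℝ, norm_smul, Real.norm_natCast, mul_comm]
  exact mul_le_mul_of_nonneg_right (norm_step_le z) (Nat.cast_nonneg _)

lemma pathCost_replicate (g : Ω → (Fin ℓ → R) → ℝ) (ω : Ω) (x : stepGroup R) (z : R) (m : ℕ) :
    pathCost g (x +ᵥ ω) (List.replicate m z) =
      ∑ k ∈ range m, (envSum g ((x + k • stepElt z) +ᵥ ω) + Real.log (Fintype.card R)) := by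
  induction m generalizing x with
  | zero => simp [pathCost]
  | succ m ih =>
    rw [List.replicate_succ, pathCost, vadd_vadd, ih, sum_range_succ', add_comm]
    congr 1
    · refine sum_congr rfl fun k _ => ?_
      rw [add_smul, one_smul, add_comm (stepElt z) x]
      congr 3
      abel
    · simp

variable {g : Ω → (Fin ℓ → R) → ℝ} {ω : Ω}

/-- Sites at distance of order `n` have potential of order `o(n)`. -/
lemma HasSmallRuns.eventually_envSum_le (h : HasSmallRuns g ω) (K : ℕ) {δ : ℝ} (hδ : 0 < δ) :
    ∀ᶠ n : ℕ in atTop, ∀ x : stepGroup R, ‖latticePt (x : Fin d → ℤ)‖ ≤ K * n →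
      envSum g (x +ᵥ ω) ≤ δ * n := by
  by_cases hz : ∃ z : R, (z : Fin d → ℤ) ≠ 0
  · obtain ⟨z, hz⟩ := hz
    obtain ⟨ε, hε, h⟩ := h K δ hδ
    obtain ⟨N, hN⟩ := exists_nat_gt (1 / ε)
    filter_upwards [h, eventually_ge_atTop N] with n hn hNn x hx
    have h1 := hn x hx z hz 1 (by
      have : (N : ℝ) ≤ n := by exact_mod_cast hNn
      rw [div_lt_iff₀ hε] at hN
      push_cast
      nlinarith)
    simp only [sum_range_one, zero_smul, add_zero] at h1
    linarith [log_card_nonneg R]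
  · -- without nonzero steps the group is trivial
    push Not at hz
    have h0 : ∀ x : stepGroup R, x = 0 := by
      intro x
      have : stepGroup R ≤ ⊥ := (AddSubgroup.closure_le _).2 fun z hzR => by
        simpa using hz ⟨z, hzR⟩
      exact Subtype.ext (AddSubgroup.mem_bot.1 (this x.2))
    obtain ⟨N, hN⟩ := exists_nat_gt (envSum g ω / δ)
    filter_upwards [eventually_ge_atTop N] with n hn x _
    rw [h0 x, zero_vadd]
    rw [div_lt_iff₀ hδ] at hN
    have : (N : ℝ) * δ ≤ n * δ := mul_le_mul_of_nonneg_right (by exact_mod_cast hn) hδ.le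
    linarith

lemma HasSmallRuns.eventually_boundaryCost_le (h : HasSmallRuns g ω) (K : ℕ) {δ : ℝ}
    (hδ : 0 < δ) : ∀ᶠ n : ℕ in atTop, ∀ x : stepGroup R, ‖latticePt (x : Fin d → ℤ)‖ ≤ K * n →
      boundaryCost g (x +ᵥ ω) ≤ δ * n := by
  obtain ⟨M, hM⟩ : ∃ M : ℝ, M = ∑ j ∈ range ℓ, ∑ _v : Fin (j + 1) → R, (1 : ℝ) := ⟨_, rfl⟩
  have hM0 : 0 ≤ M := hM ▸ sum_nonneg fun _ _ => sum_nonneg fun _ _ => zero_le_one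
  filter_upwards [h.eventually_envSum_le (K + stepBound R * ℓ) (δ := δ / 2 / (M + 1))
    (by positivity), eventually_ge_atTop 1] with n hn hn1 x hx
  have hn1' : (1 : ℝ) ≤ n := by exact_mod_cast hn1
  have h1 : boundaryCost g (x +ᵥ ω) ≤ 2 * (M * (δ / 2 / (M + 1) * n)) := by
    generalize δ / 2 / (M + 1) * (n : ℝ) = t at hn ⊢
    refine mul_le_mul_of_nonneg_left ?_ zero_le_two
    rw [hM, sum_mul]
    refine sum_le_sum fun j hj => ?_
    rw [sum_mul]
    refine sum_le_sum fun v _ => ?_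
    rw [one_mul, vadd_vadd]
    refine hn _ ((norm_latticePt_add_le _ _).trans ?_)
    have h2 : ‖latticePt ((-(∑ i, stepElt (v i)) : stepGroup R) : Fin d → ℤ)‖
        ≤ stepBound R * ℓ := by
      have e : latticePt ((-(∑ i, stepElt (v i)) : stepGroup R) : Fin d → ℤ)
          = -∑ i, latticePt (v i : Fin d → ℤ) := by
        have := map_neg ((latticeHom d).comp (stepGroup R).subtype) (∑ i, stepElt (v i))
        rw [map_sum] at this
        exact this
      rw [e, norm_neg]
      refine (norm_sum_le_of_le _ fun i _ => norm_step_le (v i)).trans ?_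
      rw [sum_const, card_univ, Fintype.card_fin, nsmul_eq_mul, mul_comm]
      refine mul_le_mul_of_nonneg_left ?_ (Nat.cast_nonneg _)
      exact_mod_cast mem_range.1 hj
    rw [Nat.cast_add, Nat.cast_mul]
    have h3 : (stepBound R * ℓ : ℝ) * 1 ≤ stepBound R * ℓ * n :=
      mul_le_mul_of_nonneg_left hn1' (by positivity)
    linarith
  refine h1.trans ?_
  have h2 : M * (δ / 2 / (M + 1) * n) ≤ (M + 1) * (δ / 2 / (M + 1) * n) :=
    mul_le_mul_of_nonneg_right (by linarith) (by positivity)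
  have h3 : (M + 1) * (δ / 2 / (M + 1) * n) = δ / 2 * n := by field_simp
  linarith

/-- Nonzero steps can be made in any order, one straight run for each of them. -/
lemma exists_word_of_runs {b : stepGroup R} {s : Finset R} {c : R → ℕ} {C D : ℝ}
    (hrun : ∀ x : stepGroup R, ‖latticePt (x : Fin d → ℤ)‖ ≤ D → ∀ z ∈ s,
      ∑ k ∈ range (c z), (envSum g ((x + k • stepElt z) +ᵥ ω) + Real.log (Fintype.card R)) ≤ C)
    (hb : ‖latticePt (b : Fin d → ℤ)‖ + stepBound R * ∑ z ∈ s, (c z : ℝ) ≤ D) :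
    ∃ u : List R, u.length = ∑ z ∈ s, c z ∧ (u.map stepElt).sum = ∑ z ∈ s, c z • stepElt z ∧
      pathCost g (b +ᵥ ω) u ≤ s.card * C := by
  classical
  induction s using Finset.induction_on with
  | empty => exact ⟨[], by simp [pathCost]⟩
  | insert z s hz ih =>
    rw [sum_insert hz] at hb
    have hρ : (0 : ℝ) ≤ stepBound R * c z := by positivity
    obtain ⟨u, h1, h2, h3⟩ := ih (fun x hx z' hz' => hrun x hx z' (mem_insert_of_mem hz'))
      (by rw [mul_add] at hb; linarith)
    refine ⟨u ++ List.replicate (c z) z, ?_, ?_, ?_⟩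
    · rw [List.length_append, h1, List.length_replicate, sum_insert hz, add_comm]
    · rw [List.map_append, List.sum_append, h2, sum_insert hz, List.map_replicate,
        List.sum_replicate, add_comm]
    · rw [pathCost_append, vadd_vadd, pathCost_replicate, card_insert_of_notMem hz, h2]
      have h4 := hrun (∑ z ∈ s, c z • stepElt z + b) (by
        refine (norm_latticePt_add_le _ _).trans ?_
        have := norm_sum_nsmul_le s c
        rw [mul_add] at hb
        linarith) z (mem_insert_self z s)
      push_cast
      linarith

/-- A run of `c₁` steps `z₁` can be interrupted at its cheapest site for `c₀` zero steps. -/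
lemma exists_word_with_zeros {b : stepGroup R} {z₀ z₁ : R} (hz₀ : (z₀ : Fin d → ℤ) = 0)
    {c₀ c₁ K : ℕ} (hc : c₀ ≤ K * c₁) {C : ℝ}
    (hrun : ∑ k ∈ range c₁,
      (envSum g ((b + k • stepElt z₁) +ᵥ ω) + Real.log (Fintype.card R)) ≤ C) :
    ∃ u : List R, u.length = c₀ + c₁ ∧ (u.map stepElt).sum = c₀ • stepElt z₀ + c₁ • stepElt z₁ ∧
      pathCost g (b +ᵥ ω) u ≤ (K + 1) * C := by
  have hz : stepElt z₀ = 0 := Subtype.ext hz₀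
  set e : ℕ → ℝ := fun k => envSum g ((b + k • stepElt z₁) +ᵥ ω) + Real.log (Fintype.card R) with he
  have he0 : ∀ k, 0 ≤ e k := fun k => add_nonneg (envSum_nonneg _ _) (log_card_nonneg R)
  rcases Nat.eq_zero_or_pos c₁ with rfl | hc₁
  · obtain rfl : c₀ = 0 := by omega
    refine ⟨[], by simp, by simp, ?_⟩
    simp only [range_zero, sum_empty] at hrun
    simp only [pathCost]
    positivity
  obtain ⟨j, hj, hmin⟩ := exists_min_image (range c₁) e ⟨0, mem_range.2 hc₁⟩
  have hj := mem_range.1 hj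
  have h1 : (c₁ : ℝ) * e j ≤ C := by
    refine le_trans ?_ hrun
    have := card_nsmul_le_sum (range c₁) e (e j) hmin
    rwa [card_range, nsmul_eq_mul] at this
  have h2 : (c₀ : ℝ) * e j ≤ K * C := by
    have h3 : (c₀ : ℝ) ≤ K * c₁ := by exact_mod_cast hc
    calc (c₀ : ℝ) * e j ≤ K * c₁ * e j := mul_le_mul_of_nonneg_right h3 (he0 j)
      _ = K * (c₁ * e j) := by ring
      _ ≤ K * C := mul_le_mul_of_nonneg_left h1 (Nat.cast_nonneg K)
  refine ⟨List.replicate j z₁ ++ (List.replicate c₀ z₀ ++ List.replicate (c₁ - j) z₁), ?_, ?_, ?_⟩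
  · simp only [List.length_append, List.length_replicate]; omega
  · simp only [List.map_append, List.sum_append, List.map_replicate, List.sum_replicate, hz,
      smul_zero, zero_add]
    rw [← add_smul]
    congr 1
    omega
  · rw [pathCost_append, pathCost_append]
    simp only [List.map_replicate, List.sum_replicate, vadd_vadd, hz, smul_zero, zero_add]
    rw [pathCost_replicate, pathCost_replicate, pathCost_replicate]
    have e1 : ∑ k ∈ range c₀, (envSum g ((j • stepElt z₁ + b + k • stepElt z₀) +ᵥ ω)
        + Real.log (Fintype.card R)) = c₀ * e j := by
      simp only [hz, smul_zero, add_zero, sum_const, card_range, nsmul_eq_mul, he,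
        add_comm (j • stepElt z₁) b]
    have e2 : ∑ k ∈ range j, e k + ∑ k ∈ range (c₁ - j),
        (envSum g ((j • stepElt z₁ + b + k • stepElt z₁) +ᵥ ω) + Real.log (Fintype.card R))
        = ∑ k ∈ range c₁, e k := by
      conv_rhs => rw [← Nat.add_sub_cancel' hj.le, sum_range_add]
      congr 1
      refine sum_congr rfl fun k _ => ?_
      simp only [he, add_smul]
      congr 3
      abel
    rw [e1]
    linarith

/-- Steps `c` added to a path with step counts `a` cost `o(n)` if there are few of them and if
their numbers are comparable on the support of `a` and `c`. Comparability is needed for the zero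
step only: zero steps are affordable at a site with a small potential, and such a site exists
along a run of comparable length, or else the path has not left the origin. -/
theorem HasSmallRuns.exists_word (h : HasSmallRuns g ω) (K : ℕ) {δ : ℝ} (hδ : 0 < δ) :
    ∃ ε : ℝ, 0 < ε ∧ ∀ᶠ n : ℕ in atTop, ∀ a c : R → ℕ, ∑ z, a z ≤ K * n →
      (∀ z, (c z : ℝ) ≤ ε * n) → (∀ z z', a z' + c z' ≠ 0 → c z ≤ K * c z') →
      ∃ u : List R, u.length = ∑ z, c z ∧ (u.map stepElt).sum = countPos c ∧
        pathCost g (countPos a +ᵥ ω) u ≤ δ * n := by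
  classical
  set r : ℕ := Fintype.card R with hr
  set δ' : ℝ := δ / (r + K + 1) with hδ'
  have hδ'0 : 0 < δ' := by positivity
  have hrδ : (r + K + 1) * δ' = δ := by rw [hδ']; field_simp
  obtain ⟨ε, hε, hrun⟩ := h (stepBound R * (K + r)) δ' hδ'0
  set e₀ : ℝ := envSum g ω + Real.log (Fintype.card R) with he₀
  have he₀0 : 0 ≤ e₀ := add_nonneg (envSum_nonneg _ _) (log_card_nonneg R)
  refine ⟨min (min ε 1) (δ / (e₀ + 1)), by positivity, ?_⟩
  filter_upwards [hrun] with n hn a c ha hc hac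
  have hn0 : (0 : ℝ) ≤ n := Nat.cast_nonneg n
  have hc1 : ∀ z, (c z : ℝ) ≤ ε * n := fun z => (hc z).trans
    (mul_le_mul_of_nonneg_right ((min_le_left _ _).trans (min_le_left _ _)) hn0)
  have hc2 : ∀ z, (c z : ℝ) ≤ n := fun z => (hc z).trans ((mul_le_mul_of_nonneg_right
    ((min_le_left _ _).trans (min_le_right _ _)) hn0).trans_eq (one_mul _))
  have hc3 : ∀ z, (c z : ℝ) * e₀ ≤ δ * n := fun z => by
    have h1 := (hc z).trans (mul_le_mul_of_nonneg_right (min_le_right _ _) hn0)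
    have h2 := mul_le_mul_of_nonneg_right h1 (by linarith : (0 : ℝ) ≤ e₀ + 1)
    have h3 : δ / (e₀ + 1) * n * (e₀ + 1) = δ * n := by field_simp
    have h4 : (0 : ℝ) ≤ c z := Nat.cast_nonneg _
    linarith
  have hsum : ∀ s : Finset R, ∑ z ∈ s, (c z : ℝ) ≤ r * n := by
    intro s
    calc ∑ z ∈ s, (c z : ℝ) ≤ ∑ z, (c z : ℝ) :=
          sum_le_sum_of_subset_of_nonneg (subset_univ s) fun _ _ _ => Nat.cast_nonneg _
      _ ≤ ∑ _z : R, (n : ℝ) := sum_le_sum fun z _ => hc2 z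
      _ = r * n := by simp [hr]
  have hpos : ‖latticePt (countPos a : Fin d → ℤ)‖ ≤ stepBound R * (K * n) := by
    refine (norm_sum_nsmul_le univ a).trans (mul_le_mul_of_nonneg_left ?_ (Nat.cast_nonneg _))
    exact_mod_cast ha
  have hD : ((stepBound R * (K + r) : ℕ) : ℝ) * n
      = stepBound R * (K * n) + stepBound R * (r * n) := by push_cast; ring
  have hbound : ∀ s : Finset R, ‖latticePt (countPos a : Fin d → ℤ)‖
      + stepBound R * ∑ z ∈ s, (c z : ℝ) ≤ ((stepBound R * (K + r) : ℕ) : ℝ) * n := by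
    intro s
    rw [hD]
    exact add_le_add hpos (mul_le_mul_of_nonneg_left (hsum s) (Nat.cast_nonneg _))
  have hcard : ∀ s : Finset R, (s.card : ℝ) * (δ' * n) ≤ r * (δ' * n) := fun s =>
    mul_le_mul_of_nonneg_right (by exact_mod_cast card_le_univ s) (by positivity)
  have hfin : (r + (K + 1)) * (δ' * n) = δ * n := by rw [← hrδ]; ring
  have hKn : 0 ≤ (K + 1) * (δ' * n) := by positivity
  by_cases hz : ∃ z₀ : R, (z₀ : Fin d → ℤ) = 0
  · obtain ⟨z₀, hz₀⟩ := hz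
    have hne : ∀ z : R, z ≠ z₀ → (z : Fin d → ℤ) ≠ 0 := fun z h1 h2 =>
      h1 (Subtype.ext (h2.trans hz₀.symm))
    by_cases hz₁ : ∃ z₁ : R, z₁ ≠ z₀ ∧ a z₁ + c z₁ ≠ 0
    · obtain ⟨z₁, hz₁, hz₁'⟩ := hz₁
      set s : Finset R := (univ.erase z₀).erase z₁ with hs
      have hsumr : ∀ {M : Type} [AddCommMonoid M] (f : R → M),
          ∑ z, f z = ∑ z ∈ s, f z + (f z₀ + f z₁) := by
        intro M _ f
        rw [← add_sum_erase univ f (mem_univ z₀), ← add_sum_erase (univ.erase z₀) f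
          (mem_erase.2 ⟨hz₁, mem_univ z₁⟩), ← add_assoc, add_comm]
      obtain ⟨u, hu1, hu2, hu3⟩ := exists_word_of_runs (s := s) (fun x hx z hzs =>
        hn x hx z (hne z (mem_erase.1 (mem_erase.1 hzs).2).1) (c z) (hc1 z)) (hbound s)
      obtain ⟨v, hv1, hv2, hv3⟩ := exists_word_with_zeros (g := g) (ω := ω)
        (b := (u.map stepElt).sum + countPos a) hz₀ (hac z₀ z₁ hz₁')
        (hn _ (by
          refine (norm_latticePt_add_le _ _).trans ?_
          rw [hu2]
          have := norm_sum_nsmul_le s c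
          linarith [hbound s]) z₁ (hne z₁ hz₁) (c z₁) (hc1 z₁))
      refine ⟨u ++ v, ?_, ?_, ?_⟩
      · rw [List.length_append, hu1, hv1, hsumr]
      · rw [List.map_append, List.sum_append, hu2, hv2, countPos, hsumr]
      · rw [pathCost_append, vadd_vadd]
        linarith [hcard s]
    · push Not at hz₁
      have ha0 : countPos a = 0 := by
        rw [countPos]
        refine sum_eq_zero fun z _ => ?_
        by_cases h1 : z = z₀
        · have : stepElt z = 0 := Subtype.ext (by rw [h1]; exact hz₀)
          rw [this, smul_zero]
        · rw [(Nat.add_eq_zero_iff.1 (hz₁ z h1)).1, zero_smul]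
      have hc0 : ∀ z, z ≠ z₀ → c z = 0 := fun z h1 => (Nat.add_eq_zero_iff.1 (hz₁ z h1)).2
      refine ⟨List.replicate (c z₀) z₀, ?_, ?_, ?_⟩
      · rw [List.length_replicate, Fintype.sum_eq_single z₀ hc0]
      · rw [List.map_replicate, List.sum_replicate, countPos, Fintype.sum_eq_single z₀]
        intro z h1
        rw [hc0 z h1, zero_smul]
      · have : stepElt z₀ = 0 := Subtype.ext hz₀
        rw [ha0, pathCost_replicate]
        simp only [this, smul_zero, add_zero, zero_vadd, sum_const, card_range, nsmul_eq_mul]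
        exact hc3 z₀
  · push Not at hz
    obtain ⟨u, hu1, hu2, hu3⟩ := exists_word_of_runs (s := univ) (fun x hx z _ =>
        hn x hx z (hz z) (c z) (hc1 z)) (hbound univ)
    exact ⟨u, hu1, hu2, by linarith [hcard univ]⟩

/-- Adding few steps changes the free energy by a lower order term from below. -/
theorem HasSmallRuns.exists_countEnergy_le (h : HasSmallRuns g ω) (K : ℕ) {δ : ℝ}
    (hδ : 0 < δ) :
    ∃ ε : ℝ, 0 < ε ∧ ∀ᶠ n : ℕ in atTop, ∀ a c : R → ℕ, ∑ z, a z ≤ K * n →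
      (∀ z, (c z : ℝ) ≤ ε * n) → (∀ z z', a z' + c z' ≠ 0 → c z ≤ K * c z') →
      countEnergy g ω a - δ * n ≤ countEnergy g ω (a + c) := by
  obtain ⟨ε, hε, h1⟩ := h.exists_word K (half_pos hδ)
  refine ⟨ε, hε, ?_⟩
  filter_upwards [h1, h.eventually_boundaryCost_le (stepBound R * K) (half_pos hδ)]
    with n hn hb a c ha hc hac
  obtain ⟨u, hu1, hu2, hu3⟩ := hn a c ha hc hac
  have h2 := neg_pathCost_le_countEnergy g (countPos a +ᵥ ω) hu1 hu2
  have h3 := countEnergy_add_le g ω a c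
  have h4 := hb (countPos a) (by
    refine (norm_sum_nsmul_le univ a).trans ?_
    push_cast
    rw [mul_assoc]
    refine mul_le_mul_of_nonneg_left ?_ (Nat.cast_nonneg _)
    exact_mod_cast ha)
  linarith

end Runs

/-! ### Limits of functions of step counts -/

section Counts

open Finset

variable {ι : Type*} [Fintype ι]

/-- A function of step counts which loses at most `o(n)` when a path of length of order `n` is
continued by few steps, provided that the numbers of these steps are comparable. -/
def StableUnderFewSteps (h : (ι → ℕ) → ℝ) : Prop :=
  ∀ K : ℕ, ∀ δ : ℝ, 0 < δ → ∃ ε : ℝ, 0 < ε ∧ ∀ᶠ n : ℕ in atTop, ∀ a c : ι → ℕ,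
    ∑ z, a z ≤ K * n → (∀ z, (c z : ℝ) ≤ ε * n) →
    (∀ z z', a z' + c z' ≠ 0 → c z ≤ K * c z') → h a - δ * n ≤ h (a + c)

/-- Probability weights on the set of steps. -/
structure IsWeight (β : ι → ℝ) : Prop where
  nonneg : ∀ z, 0 ≤ β z
  sum_eq_one : ∑ z, β z = 1

/-- Step counts of paths of length `n` which follow the weights `β` up to rounding. -/
structure Follows (β : ι → ℝ) (a : ℕ → ι → ℕ) : Prop where
  sum_eq : ∀ n, ∑ z, a n z = n
  abs_sub_le : ∀ n z, |(a n z : ℝ) - n * β z| ≤ 1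
  eq_zero : ∀ n z, β z = 0 → a n z = 0

/-- The step count `a` has the frequencies `β` up to a relative error `η`. -/
def IsApprox (β : ι → ℝ) (η : ℝ) (a : ι → ℕ) : Prop :=
  0 < ∑ z, a z ∧ ∀ z, |(a z : ℝ) - (∑ z, a z : ℕ) * β z| ≤ η * ((∑ z, a z : ℕ) * β z)

variable {h : (ι → ℕ) → ℝ} {β β' : ι → ℝ}

lemma IsWeight.le_one (hβ : IsWeight β) (z : ι) : β z ≤ 1 :=
  hβ.sum_eq_one ▸ single_le_sum (f := β) (fun z _ => hβ.nonneg z) (mem_univ z)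

/-- Two step counts whose difference is nearly proportional to `β` can be compared. -/
lemma StableUnderFewSteps.exists_le_of_between (hh : StableUnderFewSteps h) (hβ : IsWeight β)
    {δ : ℝ} (hδ : 0 < δ) : ∃ θ₀ : ℝ, 0 < θ₀ ∧ ∀ θ : ℝ, 0 < θ → θ ≤ θ₀ → ∀ᶠ n : ℕ in atTop,
      ∀ x y : ι → ℕ, ∑ z, x z ≤ 3 * n → (∀ z, β z = 0 → x z = 0) →
        (∀ z, θ * n * β z / 2 ≤ (y z : ℝ) - x z ∧ (y z : ℝ) - x z ≤ 2 * (θ * n * β z)) →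
        h x - δ * n ≤ h y := by
  -- `K` bounds the ratios of the positive weights
  obtain ⟨K, hK⟩ := exists_nat_ge (∑ z, 4 / β z)
  have hK' : ∀ z', β z' ≠ 0 → 4 ≤ (K : ℝ) * β z' := by
    intro z' hz'
    have hpos : 0 < β z' := lt_of_le_of_ne (hβ.nonneg z') (Ne.symm hz')
    have h1 : 4 / β z' ≤ K := (single_le_sum (f := fun z => 4 / β z)
      (fun z _ => div_nonneg (by norm_num) (hβ.nonneg z)) (mem_univ z')).trans hK
    rwa [div_le_iff₀ hpos] at h1
  obtain ⟨ε, hε, hcmp⟩ := hh (K + 3) δ hδ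
  refine ⟨ε / 2, half_pos hε, fun θ hθ0 hθ => ?_⟩
  filter_upwards [hcmp] with n hn x y hx hx0 hxy
  have hn0 : (0 : ℝ) ≤ n := Nat.cast_nonneg n
  have hle : x ≤ y := by
    intro z
    have h1 : 0 ≤ θ * n * β z / 2 := by have := hβ.nonneg z; positivity
    have h2 : (x z : ℝ) ≤ y z := by linarith [(hxy z).1]
    exact_mod_cast h2
  have hc : ∀ z, (((y - x) z : ℕ) : ℝ) = y z - x z := fun z => by
    rw [Pi.sub_apply, Nat.cast_sub (hle z)]
  have key := hn x (y - x) (hx.trans (Nat.mul_le_mul_right _ (by omega))) (fun z => ?_)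
    fun z z' hz' => ?_
  · rwa [add_tsub_cancel_of_le hle] at key
  · rw [hc]
    refine (hxy z).2.trans ?_
    have h1 : θ * n * β z ≤ θ * n * 1 := mul_le_mul_of_nonneg_left (hβ.le_one z) (by positivity)
    have h2 : θ * n ≤ ε / 2 * n := mul_le_mul_of_nonneg_right hθ hn0
    linarith
  · have hz0 : β z' ≠ 0 := by
      intro h0
      refine hz' ?_
      have h1 := hxy z'
      rw [h0] at h1
      have h2 : (((y - x) z' : ℕ) : ℝ) = 0 := by rw [hc]; linarith [h1.1, h1.2]
      rw [hx0 z' h0, zero_add]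
      exact_mod_cast h2
    have h1 : (((y - x) z : ℕ) : ℝ) ≤ ((K + 3 : ℕ) : ℝ) * (((y - x) z' : ℕ) : ℝ) := by
      have h3 : 0 ≤ θ * n := by positivity
      have h4 : θ * n * β z ≤ θ * n := mul_le_of_le_one_right h3 (hβ.le_one z)
      have h5 : θ * n * 4 ≤ θ * n * (K * β z') := mul_le_mul_of_nonneg_left (hK' z' hz0) h3
      have h6 : (K : ℝ) * (θ * n * β z' / 2) ≤ K * ((y z' : ℝ) - x z') :=
        mul_le_mul_of_nonneg_left (hxy z').1 (Nat.cast_nonneg K)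
      have h7 : 0 ≤ θ * n * β z' / 2 := by have := hβ.nonneg z'; positivity
      rw [hc, hc]
      push_cast
      linarith [(hxy z').1, (hxy z).2]
    exact_mod_cast h1

lemma natFloor_div_mul_bounds {t k : ℝ} (ht : 0 ≤ t) (hk : 0 < k) :
    (⌊t / k⌋₊ : ℝ) * k ≤ t ∧ t ≤ (⌊t / k⌋₊ : ℝ) * k + k := by
  have h1 := Nat.floor_le (div_nonneg ht hk.le)
  have h2 := (Nat.lt_floor_add_one (t / k)).le
  rw [le_div_iff₀ hk] at h1
  rw [div_le_iff₀ hk] at h2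
  exact ⟨h1, by linarith⟩

lemma natCeil_div_mul_bounds {t k : ℝ} (ht : 0 ≤ t) (hk : 0 < k) :
    t ≤ (⌈t / k⌉₊ : ℝ) * k ∧ (⌈t / k⌉₊ : ℝ) * k ≤ t + k := by
  have h1 := Nat.le_ceil (t / k)
  have h2 := mul_le_mul_of_nonneg_right (Nat.ceil_lt_add_one (div_nonneg ht hk.le)).le hk.le
  rw [div_le_iff₀ hk] at h1
  rw [add_mul, div_mul_cancel₀ _ hk.ne', one_mul] at h2
  exact ⟨h1, h2⟩

/-- A sequence following the weights `β` is squeezed between the multiples `q • a` of an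
approximation `a` of `β`, with `q` slightly below and slightly above `n / ∑ z, a z`. -/
lemma StableUnderFewSteps.exists_squeeze (hh : StableUnderFewSteps h) (hβ : IsWeight β)
    {δ : ℝ} (hδ : 0 < δ) : ∃ θ₀ : ℝ, 0 < θ₀ ∧ ∀ θ : ℝ, 0 < θ → θ ≤ θ₀ → θ ≤ 1 →
      ∀ b : ℕ → ι → ℕ, Follows β b → ∀ a : ι → ℕ, IsApprox β (θ / 10) a → ∀ᶠ n : ℕ in atTop,
        h (⌊(1 - θ) * n / (∑ z, a z : ℕ)⌋₊ • a) - δ * n ≤ h (b n) ∧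
        h (b n) - δ * n ≤ h (⌈(1 + θ) * n / (∑ z, a z : ℕ)⌉₊ • a) := by
  obtain ⟨θ₀, hθ₀, hcmp⟩ := hh.exists_le_of_between hβ hδ
  refine ⟨θ₀, hθ₀, fun θ hθ0 hθ hθ1 b hb a ⟨hk0, ha⟩ => ?_⟩
  have hsum : ∀ q : ℕ, ∑ z, (q • a) z = q * ∑ z, a z := fun q => by
    simp [mul_sum]
  set k : ℕ := ∑ z, a z
  have hk : (0 : ℝ) < k := by exact_mod_cast hk0
  have hlarge : ∀ z, ∀ᶠ n : ℕ in atTop, β z = 0 ∨ 4 * ((k : ℝ) + 1) ≤ θ * n * β z := by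
    intro z
    by_cases hz : β z = 0
    · exact Eventually.of_forall fun n => Or.inl hz
    · have hz' : 0 < θ * β z := mul_pos hθ0 (lt_of_le_of_ne (hβ.nonneg z) (Ne.symm hz))
      obtain ⟨N, hN⟩ := exists_nat_ge (4 * ((k : ℝ) + 1) / (θ * β z))
      filter_upwards [eventually_ge_atTop N] with n hn
      right
      rw [div_le_iff₀ hz'] at hN
      have : (N : ℝ) * (θ * β z) ≤ n * (θ * β z) :=
        mul_le_mul_of_nonneg_right (by exact_mod_cast hn) hz'.le
      linarith
  filter_upwards [hcmp θ hθ0 hθ, eventually_all.2 hlarge, eventually_ge_atTop k]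
    with n hn hL hnk
  have hn0 : (0 : ℝ) ≤ n := Nat.cast_nonneg n
  have ha' : ∀ z, (1 - θ / 10) * (k * β z) ≤ a z ∧ (a z : ℝ) ≤ (1 + θ / 10) * (k * β z) := by
    intro z
    have := abs_le.1 (ha z)
    constructor <;> linarith [this.1, this.2]
  have ha0 : ∀ z, β z = 0 → a z = 0 := by
    intro z hz
    have := ha z
    rw [hz, mul_zero, mul_zero, sub_zero] at this
    exact_mod_cast abs_nonpos_iff.1 this
  have hb' : ∀ z, n * β z - 1 ≤ b n z ∧ (b n z : ℝ) ≤ n * β z + 1 := by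
    intro z
    have := abs_le.1 (hb.abs_sub_le n z)
    constructor <;> linarith [this.1, this.2]
  constructor
  · set q : ℕ := ⌊(1 - θ) * n / k⌋₊
    obtain ⟨hq1, hq2⟩ := natFloor_div_mul_bounds (mul_nonneg (by linarith) hn0 : 0 ≤ (1 - θ) * n) hk
    refine hn _ _ ?_ (fun z hz => by simp [ha0 z hz]) fun z => ?_
    · rw [hsum]
      have : (q : ℝ) * k ≤ n := hq1.trans (by nlinarith)
      have : q * k ≤ n := by exact_mod_cast this
      omega
    · rw [Pi.smul_apply, smul_eq_mul, Nat.cast_mul]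
      rcases hL z with hz | hz
      · simp [ha0 z hz, hb.eq_zero n z hz, hz]
      have hz0 := hβ.nonneg z
      have hz1 := hβ.le_one z
      have hq0 : (0 : ℝ) ≤ q := Nat.cast_nonneg q
      have e1 : (q : ℝ) * a z ≤ (1 + θ / 10) * ((1 - θ) * n * β z) := by
        calc (q : ℝ) * a z ≤ q * ((1 + θ / 10) * (k * β z)) :=
              mul_le_mul_of_nonneg_left (ha' z).2 hq0
          _ = (1 + θ / 10) * (q * k * β z) := by ring
          _ ≤ _ := mul_le_mul_of_nonneg_left (mul_le_mul_of_nonneg_right hq1 hz0) (by linarith)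
      have e2 : (1 - θ / 10) * (((1 - θ) * n - k) * β z) ≤ (q : ℝ) * a z := by
        calc (1 - θ / 10) * (((1 - θ) * n - k) * β z) ≤ (1 - θ / 10) * (q * k * β z) :=
              mul_le_mul_of_nonneg_left (mul_le_mul_of_nonneg_right (by linarith) hz0)
                (by linarith)
          _ = q * ((1 - θ / 10) * (k * β z)) := by ring
          _ ≤ _ := mul_le_mul_of_nonneg_left (ha' z).1 hq0
      have hX : 0 ≤ n * β z := by positivity
      have hθX : 0 ≤ θ * (θ * (n * β z)) := by positivity
      have hkβ : (k : ℝ) * β z ≤ k := mul_le_of_le_one_right hk.le hz1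
      have hθkβ : 0 ≤ θ * (k * β z) := by positivity
      constructor
      · linarith [(hb' z).1, (hb' z).2]
      · linarith [(hb' z).1, (hb' z).2, mul_nonneg hθ0.le hX]
  · set q : ℕ := ⌈(1 + θ) * n / k⌉₊
    obtain ⟨hq1, hq2⟩ := natCeil_div_mul_bounds (by positivity : 0 ≤ (1 + θ) * n) hk
    refine hn _ _ ?_ (fun z hz => hb.eq_zero n z hz) fun z => ?_
    · rw [hb.sum_eq]; omega
    · rw [Pi.smul_apply, smul_eq_mul, Nat.cast_mul]
      rcases hL z with hz | hz
      · simp [ha0 z hz, hb.eq_zero n z hz, hz]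
      have hz0 := hβ.nonneg z
      have hz1 := hβ.le_one z
      have hq0 : (0 : ℝ) ≤ q := Nat.cast_nonneg q
      have e1 : (q : ℝ) * a z ≤ (1 + θ / 10) * (((1 + θ) * n + k) * β z) := by
        calc (q : ℝ) * a z ≤ q * ((1 + θ / 10) * (k * β z)) :=
              mul_le_mul_of_nonneg_left (ha' z).2 hq0
          _ = (1 + θ / 10) * (q * k * β z) := by ring
          _ ≤ _ := mul_le_mul_of_nonneg_left (mul_le_mul_of_nonneg_right hq2 hz0) (by linarith)
      have e2 : (1 - θ / 10) * ((1 + θ) * n * β z) ≤ (q : ℝ) * a z := by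
        calc (1 - θ / 10) * ((1 + θ) * n * β z) ≤ (1 - θ / 10) * (q * k * β z) :=
              mul_le_mul_of_nonneg_left (mul_le_mul_of_nonneg_right hq1 hz0)
                (by linarith)
          _ = q * ((1 - θ / 10) * (k * β z)) := by ring
          _ ≤ _ := mul_le_mul_of_nonneg_left (ha' z).1 hq0
      have hX : 0 ≤ n * β z := by positivity
      have hθX : 0 ≤ θ * (n * β z) := by positivity
      have hθX2 : θ * (θ * (n * β z)) ≤ θ * (n * β z) := mul_le_of_le_one_left hθX hθ1
      have hkβ : (k : ℝ) * β z ≤ k := mul_le_of_le_one_right hk.le hz1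
      have hkβ0 : 0 ≤ (k : ℝ) * β z := by positivity
      have hθkβ : θ * (k * β z) ≤ k * β z := mul_le_of_le_one_left hkβ0 hθ1
      constructor
      · linarith [(hb' z).1, (hb' z).2]
      · linarith [(hb' z).1, (hb' z).2]

lemma tendsto_natFloor_mul_div {t k : ℝ} (ht : 0 < t) (hk : 0 < k) :
    Tendsto (fun n : ℕ => ⌊t * n / k⌋₊) atTop atTop := by
  refine tendsto_nat_floor_atTop.comp ?_
  exact (tendsto_natCast_atTop_atTop.const_mul_atTop ht).atTop_div_const hk

lemma tendsto_natCeil_mul_div {t k : ℝ} (ht : 0 < t) (hk : 0 < k) :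
    Tendsto (fun n : ℕ => ⌈t * n / k⌉₊) atTop atTop := by
  refine tendsto_nat_ceil_atTop.comp ?_
  exact (tendsto_natCast_atTop_atTop.const_mul_atTop ht).atTop_div_const hk

lemma eventually_const_le_mul (C : ℝ) {δ : ℝ} (hδ : 0 < δ) : ∀ᶠ n : ℕ in atTop, C ≤ δ * n :=
  (tendsto_natCast_atTop_atTop.const_mul_atTop hδ).eventually_ge_atTop C

/-- If the weights `β` and `β'` have simultaneous approximations with the same values of `h`, then
a slope exceeded infinitely often along `β'` is eventually almost exceeded along `β`. -/
theorem StableUnderFewSteps.eventually_le_of_frequently (hh : StableUnderFewSteps h)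
    (hlim : ∀ a, HasLinearGrowth fun q => h (q • a)) (hβ : IsWeight β) (hβ' : IsWeight β')
    (happ : ∀ η : ℝ, 0 < η → ∃ a a', IsApprox β η a ∧ IsApprox β' η a' ∧
      ∑ z, a z = ∑ z, a' z ∧ ∀ q : ℕ, h (q • a) = h (q • a'))
    {b b' : ℕ → ι → ℕ} (hb : Follows β b) (hb' : Follows β' b') {M₁ M₂ : ℝ} (hM : M₂ < M₁)
    (hfr : ∃ᶠ n : ℕ in atTop, M₁ * n ≤ h (b' n)) : ∀ᶠ n : ℕ in atTop, M₂ * n ≤ h (b n) := by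
  set δ : ℝ := (M₁ - M₂) / 6 with hδ
  have hδ0 : 0 < δ := by rw [hδ]; linarith
  obtain ⟨θ₁, hθ₁, hsq⟩ := hh.exists_squeeze hβ hδ0
  obtain ⟨θ₂, hθ₂, hsq'⟩ := hh.exists_squeeze hβ' hδ0
  have hA : 0 < 2 * (|M₁| + 2 * δ) := by positivity
  obtain ⟨θ, hθ0, hθ⟩ : ∃ θ : ℝ, 0 < θ ∧
      θ ≤ min (min θ₁ θ₂) (min (1 / 2) (δ / (2 * (|M₁| + 2 * δ)))) :=
    ⟨_, by positivity, le_rfl⟩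
  simp only [le_min_iff] at hθ
  obtain ⟨⟨hθ1, hθ2⟩, hθ3, hθ4⟩ := hθ
  rw [le_div_iff₀ hA] at hθ4
  obtain ⟨a, a', ha, ha', hk, hq⟩ := happ (θ / 10) (by positivity)
  have hs := hsq θ hθ0 hθ1 (by linarith) b hb a ha
  have hs' := hsq' θ hθ0 hθ2 (by linarith) b' hb' a' ha'
  rw [← hk] at hs'
  have hk0 : (0 : ℝ) < (∑ z, a z : ℕ) := by exact_mod_cast ha.1
  set k : ℕ := ∑ z, a z
  -- the slope along the multiples of `a'`, per step
  set m : ℝ := (M₁ - 2 * δ) / (1 + θ) with hm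
  have hm' : m * (1 + θ) = M₁ - 2 * δ := by rw [hm]; field_simp
  have hfr' : ∃ᶠ q : ℕ in atTop, m * k * q ≤ h (q • a) := by
    refine (tendsto_natCeil_mul_div (by linarith : (0 : ℝ) < 1 + θ) hk0).frequently
      (p := fun q : ℕ => m * k * q ≤ h (q • a)) ?_
    refine (hfr.and_eventually (hs'.and (eventually_const_le_mul (|m| * k) hδ0))).mono ?_
    rintro n ⟨h1, ⟨-, h2⟩, h3⟩
    rw [hq]
    set q : ℕ := ⌈(1 + θ) * n / k⌉₊
    obtain ⟨hq1, hq2⟩ := natCeil_div_mul_bounds (by positivity : 0 ≤ (1 + θ) * n) hk0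
    have h4 : m * (q * k - (1 + θ) * n) ≤ |m| * k :=
      (mul_le_mul_of_nonneg_right (le_abs_self m) (by linarith)).trans
        (mul_le_mul_of_nonneg_left (by linarith) (abs_nonneg m))
    have h5 : m * ((1 + θ) * n) = (M₁ - 2 * δ) * n := by rw [← hm']; ring
    nlinarith
  have hev := (hlim a).2 (m * k) ((m - δ) * k) (by nlinarith) hfr'
  have hev' := (tendsto_natFloor_mul_div (by linarith : (0 : ℝ) < 1 - θ) hk0).eventually hev
  filter_upwards [hs, hev', eventually_const_le_mul (|m - δ| * k) hδ0] with n h1 h2 h3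
  have hn0 : (0 : ℝ) ≤ n := Nat.cast_nonneg n
  set q : ℕ := ⌊(1 - θ) * n / k⌋₊
  obtain ⟨hq1, hq2⟩ := natFloor_div_mul_bounds (mul_nonneg (by linarith) hn0 : 0 ≤ (1 - θ) * n) hk0
  have h4 : (m - δ) * ((1 - θ) * n - q * k) ≤ |m - δ| * k :=
    (mul_le_mul_of_nonneg_right (le_abs_self _) (by linarith)).trans
      (mul_le_mul_of_nonneg_left (by linarith) (abs_nonneg _))
  have h5 : M₂ + 2 * δ ≤ (m - δ) * (1 - θ) := by
    have h6 : |m| ≤ |M₁| + 2 * δ := by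
      rw [hm, abs_div, abs_of_pos (by linarith : (0 : ℝ) < 1 + θ), div_le_iff₀ (by linarith)]
      have h7 : |M₁ - 2 * δ| ≤ |M₁| + 2 * δ := by
        refine (abs_sub _ _).trans_eq ?_
        rw [abs_of_pos (by linarith : (0 : ℝ) < 2 * δ)]
      have : 0 ≤ (|M₁| + 2 * δ) * θ := by positivity
      linarith
    have h8 : m * (1 - θ) = (M₁ - 2 * δ) - 2 * (m * θ) := by rw [← hm']; ring
    have h9 : m * θ ≤ (|M₁| + 2 * δ) * θ :=
      mul_le_mul_of_nonneg_right ((le_abs_self m).trans h6) hθ0.le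
    have h10 : 0 ≤ δ * θ := by positivity
    have h11 : M₁ = M₂ + 6 * δ := by rw [hδ]; ring
    linarith
  have h12 : (M₂ + 2 * δ) * n ≤ (m - δ) * (1 - θ) * n := mul_le_mul_of_nonneg_right h5 hn0
  linarith [h1.1]

/-- Along a sequence following weights `β` that have approximations, `h` has a limiting slope. -/
theorem StableUnderFewSteps.hasLinearGrowth (hh : StableUnderFewSteps h)
    (hlim : ∀ a, HasLinearGrowth fun q => h (q • a)) (hβ : IsWeight β)
    (happ : ∀ η : ℝ, 0 < η → ∃ a, IsApprox β η a) {b : ℕ → ι → ℕ} (hb : Follows β b) :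
    HasLinearGrowth fun n => h (b n) := by
  refine ⟨?_, fun M₁ M₂ hM hfr => hh.eventually_le_of_frequently hlim hβ hβ (fun η hη => ?_)
    hb hb hM hfr⟩
  · obtain ⟨θ₀, hθ₀, hsq⟩ := hh.exists_squeeze hβ one_pos
    obtain ⟨a, ha⟩ := happ (min θ₀ (1 / 2) / 10) (by positivity)
    set θ := min θ₀ (1 / 2)
    have hθ0 : 0 < θ := by positivity
    have hθ1 : θ ≤ 1 / 2 := min_le_right _ _
    have hs := hsq θ hθ0 (min_le_left _ _) (by linarith) b hb a ha
    have hk0 : (1 : ℝ) ≤ (∑ z, a z : ℕ) := by exact_mod_cast ha.1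
    set k : ℕ := ∑ z, a z
    obtain ⟨⟨M, hM⟩, -⟩ := hlim a
    refine ⟨-|M| - 1, ?_⟩
    filter_upwards [hs, (tendsto_natFloor_mul_div (by linarith : (0 : ℝ) < 1 - θ)
      (by linarith : (0 : ℝ) < k)).eventually hM] with n h1 h2
    have hn0 : (0 : ℝ) ≤ n := Nat.cast_nonneg n
    have hq : ((⌊(1 - θ) * n / k⌋₊ : ℕ) : ℝ) ≤ n := by
      refine (Nat.floor_le (div_nonneg (mul_nonneg (by linarith) hn0) (by linarith))).trans ?_
      rw [div_le_iff₀ (by linarith)]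
      nlinarith
    have h3 : -(|M| * n) ≤ M * (⌊(1 - θ) * n / k⌋₊ : ℕ) := by
      have h4 := neg_abs_le M
      have h5 : (0 : ℝ) ≤ (⌊(1 - θ) * n / k⌋₊ : ℕ) := Nat.cast_nonneg _
      have h6 := mul_le_mul_of_nonneg_right h4 h5
      have h7 := mul_le_mul_of_nonneg_left hq (abs_nonneg M)
      linarith
    linarith [h1.1]
  · obtain ⟨a, ha⟩ := happ η hη
    exact ⟨a, a, ha, ha, rfl, fun _ => rfl⟩

/-- A slope which the maximum of `h` over all step counts of length `n` exceeds infinitely often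
is almost exceeded along the multiples of a single step count, all of whose entries are positive.
It is found by the pigeonhole principle among finitely many candidates, one of which is slightly
larger than the rescaled maximizer. -/
theorem StableUnderFewSteps.exists_eventually_le [Nonempty ι] (hh : StableUnderFewSteps h)
    (hlim : ∀ a, HasLinearGrowth fun q => h (q • a)) {u : ℕ → ℝ} {r : ℝ}
    (hu : ∀ n, ∃ a : ι → ℕ, ∑ z, a z = n ∧ u n ≤ r * Real.log (n + 1) + h a)
    {M₁ M₂ : ℝ} (hM : M₂ < M₁) (hfr : ∃ᶠ n : ℕ in atTop, M₁ * n ≤ u n) :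
    ∃ c : ι → ℕ, (∀ z, 0 < c z) ∧ ∀ᶠ q : ℕ in atTop, M₂ * (q * (∑ z, c z : ℕ)) ≤ h (q • c) := by
  classical
  set δ : ℝ := (M₁ - M₂) / 4 with hδ
  have hδ0 : 0 < δ := by rw [hδ]; linarith
  set s : ℝ := (Fintype.card ι : ℝ) with hs
  have hs0 : 0 < s := by rw [hs]; exact_mod_cast Fintype.card_pos
  have hw : IsWeight (fun _ : ι => 1 / s) := ⟨fun _ => by positivity, by simp [hs]⟩
  obtain ⟨θ₀, hθ₀, hcmp⟩ := hh.exists_le_of_between hw hδ0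
  set m : ℝ := M₁ - 2 * δ with hm
  -- `K` is the resolution at which step counts are rescaled
  obtain ⟨K, hK⟩ := exists_nat_gt (max (2 * s / θ₀) (4 * s * |m| / δ))
  rw [max_lt_iff] at hK
  have hK0 : (0 : ℝ) < K := lt_trans (by positivity) hK.1
  have hK0' : 0 < K := by exact_mod_cast hK0
  have hK1 : 2 * s / K ≤ θ₀ := by
    have := hK.1
    rw [div_lt_iff₀ hθ₀] at this
    rw [div_le_iff₀ hK0]
    linarith
  have hK2 : |m| * (2 * s / K) ≤ δ / 2 := by
    have := hK.2
    rw [div_lt_iff₀ hδ0] at this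
    rw [← mul_div_assoc, div_le_iff₀ hK0]
    linarith
  set F : Finset (ι → ℕ) := Fintype.piFinset fun _ : ι => range (K + 3) with hF
  have hlog : ∀ᶠ n : ℕ in atTop, r * Real.log (n + 1) ≤ δ * n := by
    have h1 : (fun n : ℕ => r * Real.log ((n : ℝ) + 1)) =o[atTop] fun n : ℕ => (n : ℝ) + 1 :=
      (Real.isLittleO_log_id_atTop.comp_tendsto
        (tendsto_atTop_add_const_right _ 1 tendsto_natCast_atTop_atTop)).const_mul_left r
    filter_upwards [h1.bound (half_pos hδ0), eventually_ge_atTop 1] with n hn hn1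
    have hn1' : (1 : ℝ) ≤ n := by exact_mod_cast hn1
    rw [Real.norm_eq_abs, Real.norm_of_nonneg (by linarith)] at hn
    have := (le_abs_self _).trans hn
    nlinarith
  have hex : ∃ c ∈ F, (∀ z, 0 < c z) ∧
      ∃ᶠ q : ℕ in atTop, (m - δ) * (q * (∑ z, c z : ℕ)) ≤ h (q • c) := by
    by_contra hcon
    push Not at hcon
    have h1 : ∀ᶠ q : ℕ in atTop, ∀ c ∈ F, (∀ z, 0 < c z) →
        h (q • c) < (m - δ) * (q * (∑ z, c z : ℕ)) := by
      rw [Filter.eventually_all_finset]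
      intro c hc
      by_cases hc0 : ∀ z, 0 < c z
      · filter_upwards [hcon c hc hc0] with q hq _ using hq
      · exact Eventually.of_forall fun q h => absurd h hc0
    have ht : Tendsto (fun n : ℕ => ⌈(1 : ℝ) * n / K⌉₊) atTop atTop :=
      tendsto_natCeil_mul_div one_pos hK0
    refine hfr ?_
    filter_upwards [ht.eventually h1, hcmp (2 * s / K) (by positivity) hK1, hlog,
      eventually_gt_atTop 0, eventually_const_le_mul (K + 2) (by positivity : (0 : ℝ) < 2 / K),
      eventually_const_le_mul (|m| * (K + 2 * s)) (half_pos hδ0)] with n hq hn hl hn0 hnK hnm hMn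
    rw [one_mul] at hq
    have hn0' : (0 : ℝ) < n := by exact_mod_cast hn0
    obtain ⟨a, han, hua⟩ := hu n
    have haz : ∀ z, a z ≤ n := fun z => han ▸ single_le_sum (f := a) (fun _ _ => Nat.zero_le _)
      (mem_univ z)
    set c : ι → ℕ := fun z => K * a z / n + 2 with hc
    have hcF : c ∈ F := by
      refine Fintype.mem_piFinset.2 fun z => mem_range.2 ?_
      have : K * a z / n ≤ K := Nat.div_le_of_le_mul (by
        rw [mul_comm n]; exact Nat.mul_le_mul_left K (haz z))
      simp only [hc]
      omega
    have hq := hq c hcF fun z => by simp [hc]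
    set q : ℕ := ⌈(n : ℝ) / K⌉₊
    obtain ⟨hq1, hq2⟩ := natCeil_div_mul_bounds hn0'.le hK0
    have hc1 : ∀ z, (K * a z : ℝ) / n + 1 ≤ c z := by
      intro z
      have h2 : ((K * a z : ℕ) : ℝ) / n < ((K * a z / n : ℕ) : ℝ) + 1 := by
        rw [div_lt_iff₀ hn0']
        exact_mod_cast Nat.lt_mul_of_div_lt (Nat.lt_succ_self _) hn0
      simp only [hc]
      push_cast at h2 ⊢
      linarith
    have hc2 : ∀ z, (c z : ℝ) ≤ (K * a z : ℝ) / n + 2 := by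
      intro z
      have h2 : ((K * a z / n : ℕ) : ℝ) ≤ ((K * a z : ℕ) : ℝ) / n := Nat.cast_div_le
      simp only [hc]
      push_cast at h2 ⊢
      linarith
    have hq0 : (0 : ℝ) ≤ q := Nat.cast_nonneg q
    have key := hn a (q • c) (by omega) (fun z hz => absurd hz (by positivity)) (fun z => by
      rw [Pi.smul_apply, smul_eq_mul, Nat.cast_mul]
      have hqd1 : (n : ℝ) / K ≤ q := Nat.le_ceil _
      have hqd2 : (q : ℝ) ≤ (n : ℝ) / K + 1 := (Nat.ceil_lt_add_one (by positivity)).le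
      have haz' : (a z : ℝ) ≤ n := by exact_mod_cast haz z
      have h0 : (0 : ℝ) ≤ (K * a z : ℝ) / n + 1 := by positivity
      have e1 : (n : ℝ) / K * ((K * a z : ℝ) / n + 1) = a z + n / K := by field_simp
      have e2 : ((n : ℝ) / K + 1) * ((K * a z : ℝ) / n + 2)
          = a z + 2 * (n / K) + K * a z / n + 2 := by field_simp; ring
      have h3 : (n : ℝ) / K * ((K * a z : ℝ) / n + 1) ≤ q * c z :=
        mul_le_mul hqd1 (hc1 z) h0 hq0
      have h4 : (q : ℝ) * c z ≤ ((n : ℝ) / K + 1) * ((K * a z : ℝ) / n + 2) :=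
        mul_le_mul hqd2 (hc2 z) (Nat.cast_nonneg _) (by positivity)
      have h5 : (K * a z : ℝ) / n ≤ K := by
        rw [div_le_iff₀ hn0']
        exact mul_le_mul_of_nonneg_left haz' hK0.le
      have e3 : 2 * s / K * n * (1 / s) = 2 * (n / K) := by field_simp
      have e4 : 2 / (K : ℝ) * n = 2 * (n / K) := by ring
      rw [e3]
      rw [e4] at hnK
      constructor <;> linarith)
    have hS1 : (K : ℝ) ≤ (∑ z, c z : ℕ) := by
      have h2 : ∑ z, ((K * a z : ℝ) / n + 1) ≤ ∑ z, (c z : ℝ) := sum_le_sum fun z _ => hc1 z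
      rw [sum_add_distrib, ← sum_div, ← mul_sum, ← Nat.cast_sum univ a, han] at h2
      rw [Nat.cast_sum]
      have h3 : (K : ℝ) * n / n = K := by field_simp
      have h4 : (0 : ℝ) ≤ ∑ _z : ι, (1 : ℝ) := by positivity
      linarith
    have hS2 : ((∑ z, c z : ℕ) : ℝ) ≤ K + 2 * s := by
      have h2 : ∑ z, (c z : ℝ) ≤ ∑ z, ((K * a z : ℝ) / n + 2) := sum_le_sum fun z _ => hc2 z
      rw [sum_add_distrib, ← sum_div, ← mul_sum, ← Nat.cast_sum univ a, han] at h2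
      rw [Nat.cast_sum]
      have h3 : (K : ℝ) * n / n = K := by field_simp
      have h4 : ∑ _z : ι, (2 : ℝ) = 2 * s := by simp [hs, mul_comm]
      linarith
    set S : ℝ := ((∑ z, c z : ℕ) : ℝ)
    have h6 : (n : ℝ) ≤ q * S := hq1.trans (mul_le_mul_of_nonneg_left hS1 hq0)
    have h7 : q * S - n ≤ 2 * s / K * n + (K + 2 * s) := by
      have h8 : q * S ≤ q * K * (1 + 2 * s / K) := by
        have e : (q : ℝ) * K * (1 + 2 * s / K) = q * (K + 2 * s) := by field_simp
        rw [e]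
        exact mul_le_mul_of_nonneg_left hS2 hq0
      have h9 : (q : ℝ) * K * (1 + 2 * s / K) ≤ (n + K) * (1 + 2 * s / K) :=
        mul_le_mul_of_nonneg_right hq2 (by positivity)
      have e : ((n : ℝ) + K) * (1 + 2 * s / K) = n + 2 * s / K * n + (K + 2 * s) := by
        field_simp
      linarith
    have h8 : m * (q * S - n) ≤ δ * n := by
      have h9 : m * (q * S - n) ≤ |m| * (2 * s / K * n + (K + 2 * s)) :=
        (mul_le_mul_of_nonneg_right (le_abs_self m) (by linarith)).trans
          (mul_le_mul_of_nonneg_left h7 (abs_nonneg m))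
      have h10 : |m| * (2 * s / K) * n ≤ δ / 2 * n := mul_le_mul_of_nonneg_right hK2 hn0'.le
      linarith
    have h9 : δ * n ≤ δ * (q * S) := mul_le_mul_of_nonneg_left h6 hδ0.le
    have h10 : m * n = M₁ * n - 2 * (δ * n) := by rw [hm]; ring
    linarith
  obtain ⟨c, -, hc0, hc⟩ := hex
  refine ⟨c, hc0, ?_⟩
  have hS : (0 : ℝ) < (∑ z, c z : ℕ) := by
    exact_mod_cast sum_pos (fun z _ => hc0 z) univ_nonempty
  have := (hlim c).2 ((m - δ) * (∑ z, c z : ℕ)) (M₂ * (∑ z, c z : ℕ))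
    (mul_lt_mul_of_pos_right (by rw [hm, hδ]; linarith) hS) (hc.mono fun q hq => by linarith)
  filter_upwards [this] with q hq
  linarith

end Counts

/-! ### Simultaneous approximation of weights -/

section Approximation

open Finset

variable {κ : Type*} [Fintype κ]

/-- Dirichlet's simultaneous approximation theorem, with denominators divisible by `N`. -/
lemma exists_int_approx (β : κ → ℝ) {η : ℝ} (hη : 0 < η) {N : ℕ} (hN : 0 < N) :
    ∃ k : ℕ, 0 < k ∧ N ∣ k ∧ ∃ p : κ → ℤ, ∀ z, |(p z : ℝ) - k * β z| ≤ η := by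
  have hmem : ∀ j : ℕ, (fun z => Int.fract ((j * N : ℕ) * β z)) ∈ Set.Icc (0 : κ → ℝ) 1 := fun j =>
    ⟨fun z => Int.fract_nonneg _, fun z => (Int.fract_lt_one _).le⟩
  obtain ⟨x, -, φ, hφ, hx⟩ := isCompact_Icc.tendsto_subseq hmem
  obtain ⟨M, hM⟩ := Metric.cauchySeq_iff.1 hx.cauchySeq η hη
  have hd := hM (M + 1) (by omega) M le_rfl
  have hlt : φ M < φ (M + 1) := hφ (Nat.lt_succ_self M)
  refine ⟨(φ (M + 1) - φ M) * N, Nat.mul_pos (by omega) hN, dvd_mul_left _ _,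
    fun z => ⌊((φ (M + 1) * N : ℕ) : ℝ) * β z⌋ - ⌊((φ M * N : ℕ) : ℝ) * β z⌋, fun z => ?_⟩
  have h1 := (dist_pi_lt_iff hη).1 hd z
  rw [Real.dist_eq] at h1
  refine le_trans (le_of_eq ?_) h1.le
  rw [← abs_neg]
  congr 1
  have h2 : (((φ (M + 1) - φ M) * N : ℕ) : ℝ) = (φ (M + 1) * N : ℕ) - (φ M * N : ℕ) := by
    rw [Nat.cast_mul, Nat.cast_sub hlt.le]; push_cast; ring
  simp only [Function.comp, Int.fract]
  rw [h2]
  push_cast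
  ring

lemma exists_nat_approx {β : κ → ℝ} (hβ : ∀ z, 0 ≤ β z) {η : ℝ} (hη : 0 < η) (hη1 : η < 1)
    {N : ℕ} (hN : 0 < N) :
    ∃ k : ℕ, 0 < k ∧ N ∣ k ∧ ∃ a : κ → ℕ, ∀ z, |(a z : ℝ) - k * β z| ≤ η := by
  obtain ⟨k, hk, hNk, p, hp⟩ := exists_int_approx β hη hN
  refine ⟨k, hk, hNk, fun z => (p z).toNat, fun z => ?_⟩
  have h1 : 0 ≤ p z := by
    have h2 : (-1 : ℝ) < p z := by
      have := (abs_le.1 (hp z)).1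
      have h3 : 0 ≤ (k : ℝ) * β z := mul_nonneg (Nat.cast_nonneg k) (hβ z)
      linarith
    have h3 : (-1 : ℤ) < p z := by exact_mod_cast h2
    omega
  have h2 : (((p z).toNat : ℕ) : ℝ) = p z := by
    have := Int.toNat_of_nonneg h1
    exact_mod_cast this
  rw [h2]
  exact hp z

/-- Good integer approximations satisfy the same integral linear equations exactly. -/
lemma sum_mul_eq_of_approx {β : κ → ℝ} {η : ℝ} {k : ℕ} {a : κ → ℕ}
    (ha : ∀ z, |(a z : ℝ) - k * β z| ≤ η) (w : κ → ℤ) (hw : η * ∑ z, |(w z : ℝ)| < 1) (t : ℤ)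
    (ht : k * ∑ z, w z * β z = t) : ∑ z, w z * (a z : ℤ) = t := by
  have h1 : |((∑ z, w z * (a z : ℤ) - t : ℤ) : ℝ)| < 1 := by
    refine lt_of_le_of_lt ?_ hw
    rw [Int.cast_sub, ← ht, Int.cast_sum, mul_sum, ← sum_sub_distrib, mul_sum]
    refine (abs_sum_le_sum_abs _ _).trans (sum_le_sum fun z _ => ?_)
    have e : ((w z * (a z : ℤ) : ℤ) : ℝ) - k * (w z * β z) = (a z - k * β z) * w z := by
      push_cast; ring
    rw [e, abs_mul]
    exact mul_le_mul_of_nonneg_right (ha z) (abs_nonneg _)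
  have h2 : |∑ z, w z * (a z : ℤ) - t| < 1 := by exact_mod_cast h1
  have := Int.abs_lt_one_iff.1 h2
  omega

variable {d : ℕ} {R : Finset (Fin d → ℤ)}

lemma sum_smul_latticePt_apply (β : R → ℝ) (i : Fin d) :
    (∑ z, β z • latticePt (z : Fin d → ℤ)) i = ∑ z : R, ((z : Fin d → ℤ) i : ℝ) * β z := by
  rw [WithLp.ofLp_sum, Finset.sum_apply]
  refine sum_congr rfl fun z _ => ?_
  simp [latticePt, mul_comm]

lemma countPos_coe_apply (a : R → ℕ) (i : Fin d) :
    (countPos a : Fin d → ℤ) i = ∑ z : R, (z : Fin d → ℤ) i * (a z : ℤ) := by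
  rw [countPos, AddSubgroup.val_finsetSum, Finset.sum_apply]
  refine sum_congr rfl fun z _ => ?_
  simp [stepElt, mul_comm]

/-- Bounds the coefficients of all the linear equations that say what the endpoint and the length
of a path are. -/
def coeffBound (R : Finset (Fin d → ℤ)) : ℝ := ∑ z : R, (1 + ∑ i, |((z : Fin d → ℤ) i : ℝ)|)

lemma coeffBound_nonneg (R : Finset (Fin d → ℤ)) : 0 ≤ coeffBound R :=
  sum_nonneg fun _ _ => add_nonneg zero_le_one (sum_nonneg fun _ _ => abs_nonneg _)

lemma sum_one_le_coeffBound : ∑ _z : R, (1 : ℝ) ≤ coeffBound R :=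
  sum_le_sum fun z _ => by
    have : 0 ≤ ∑ i, |((z : Fin d → ℤ) i : ℝ)| := sum_nonneg fun _ _ => abs_nonneg _
    linarith

lemma sum_abs_le_coeffBound (i : Fin d) : ∑ z : R, |((z : Fin d → ℤ) i : ℝ)| ≤ coeffBound R :=
  sum_le_sum fun z _ => by
    have := single_le_sum (f := fun i => |((z : Fin d → ℤ) i : ℝ)|) (fun _ _ => abs_nonneg _)
      (mem_univ i)
    linarith

/-- Two representations of the same point have simultaneous approximations which lead to the
same lattice point in the same number of steps. -/
theorem exists_isApprox_pair {β β' : R → ℝ} (hβ : IsWeight β) (hβ' : IsWeight β')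
    (heq : ∑ z, β z • latticePt (z : Fin d → ℤ) = ∑ z, β' z • latticePt (z : Fin d → ℤ))
    {η : ℝ} (hη : 0 < η) :
    ∃ a a' : R → ℕ, IsApprox β η a ∧ IsApprox β' η a' ∧ ∑ z, a z = ∑ z, a' z ∧
      countPos a = countPos a' := by
  set C := coeffBound R
  have hC : 0 ≤ C := coeffBound_nonneg R
  set η₀ : ℝ := 1 / (2 * C + 2) with hη₀
  have hη₀0 : 0 < η₀ := by positivity
  have hη₀C : η₀ * (2 * C) < 1 := by
    rw [hη₀, one_div_mul_eq_div, div_lt_one (by positivity)]; linarith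
  have hη₀1 : η₀ < 1 := by
    rw [hη₀, div_lt_one (by positivity)]; linarith
  -- the denominator is so large that the absolute error `η₀` becomes a relative error `η`
  obtain ⟨N, hN⟩ := exists_nat_gt (∑ z, (η₀ / (η * β z) + η₀ / (η * β' z)))
  have hterm : ∀ z, 0 ≤ η₀ / (η * β z) ∧ 0 ≤ η₀ / (η * β' z) := fun z =>
    ⟨div_nonneg hη₀0.le (mul_nonneg hη.le (hβ.nonneg z)),
      div_nonneg hη₀0.le (mul_nonneg hη.le (hβ'.nonneg z))⟩
  have hNz : ∀ z, η₀ / (η * β z) ≤ N ∧ η₀ / (η * β' z) ≤ N := by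
    intro z
    have := single_le_sum (f := fun z => η₀ / (η * β z) + η₀ / (η * β' z))
      (fun z _ => add_nonneg (hterm z).1 (hterm z).2) (mem_univ z)
    constructor <;> linarith [(hterm z).1, (hterm z).2]
  have hN0 : 0 < N := by
    have : (0 : ℝ) < N := lt_of_le_of_lt
      (sum_nonneg fun z _ => add_nonneg (hterm z).1 (hterm z).2) hN
    exact_mod_cast this
  obtain ⟨k, hk, hNk, a, ha⟩ := exists_nat_approx (β := Sum.elim β β')
    (by rintro (z | z); exacts [hβ.nonneg z, hβ'.nonneg z]) hη₀0 hη₀1 hN0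
  have hkN : (N : ℝ) ≤ k := by exact_mod_cast Nat.le_of_dvd hk hNk
  have h1 : ∑ z, a (Sum.inl z) = k := by
    have := sum_mul_eq_of_approx ha (Sum.elim (fun _ => 1) fun _ => 0) (by
      rw [Fintype.sum_sum_type]
      have := mul_le_mul_of_nonneg_left (sum_one_le_coeffBound (R := R)) hη₀0.le
      have h0 : 0 ≤ η₀ * C := by positivity
      simp only [Sum.elim_inl, Sum.elim_inr, Int.cast_one, Int.cast_zero, abs_one, abs_zero,
        sum_const_zero, add_zero]
      linarith) k (by simp [-univ_eq_attach, Fintype.sum_sum_type, hβ.sum_eq_one])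
    simp only [Fintype.sum_sum_type, Sum.elim_inl, Sum.elim_inr, one_mul, zero_mul,
      sum_const_zero, add_zero] at this
    exact_mod_cast this
  have h2 : ∑ z, a (Sum.inr z) = k := by
    have := sum_mul_eq_of_approx ha (Sum.elim (fun _ => 0) fun _ => 1) (by
      rw [Fintype.sum_sum_type]
      have := mul_le_mul_of_nonneg_left (sum_one_le_coeffBound (R := R)) hη₀0.le
      have h0 : 0 ≤ η₀ * C := by positivity
      simp only [Sum.elim_inl, Sum.elim_inr, Int.cast_one, Int.cast_zero, abs_one, abs_zero,
        sum_const_zero, zero_add]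
      linarith) k (by simp [-univ_eq_attach, Fintype.sum_sum_type, hβ'.sum_eq_one])
    simp only [Fintype.sum_sum_type, Sum.elim_inl, Sum.elim_inr, one_mul, zero_mul,
      sum_const_zero, zero_add] at this
    exact_mod_cast this
  have h3 : countPos (fun z => a (Sum.inl z)) = countPos (fun z => a (Sum.inr z)) := by
    refine Subtype.ext (funext fun i => ?_)
    rw [countPos_coe_apply, countPos_coe_apply]
    have hi : (∑ z, β z • latticePt (z : Fin d → ℤ)) i
        = (∑ z, β' z • latticePt (z : Fin d → ℤ)) i := by rw [heq]
    rw [sum_smul_latticePt_apply, sum_smul_latticePt_apply] at hi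
    have := sum_mul_eq_of_approx ha
      (Sum.elim (fun z : R => (z : Fin d → ℤ) i) fun z : R => -(z : Fin d → ℤ) i) (by
      rw [Fintype.sum_sum_type]
      have := mul_le_mul_of_nonneg_left (sum_abs_le_coeffBound (R := R) i) hη₀0.le
      simp only [Sum.elim_inl, Sum.elim_inr, Int.cast_neg, abs_neg]
      linarith) 0 (by
        rw [Fintype.sum_sum_type]
        simp only [Sum.elim_inl, Sum.elim_inr, Int.cast_neg, neg_mul, sum_neg_distrib, hi]
        simp)
    simp only [Fintype.sum_sum_type, Sum.elim_inl, Sum.elim_inr, neg_mul, sum_neg_distrib] at this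
    linarith
  have hrel : ∀ (b : ℝ), 0 ≤ b → η₀ / (η * b) ≤ N → ∀ m : ℕ, |(m : ℝ) - k * b| ≤ η₀ →
      |(m : ℝ) - k * b| ≤ η * (k * b) := by
    intro b hb hbN m hm
    rcases hb.eq_or_lt with rfl | hb
    · rw [mul_zero, sub_zero, mul_zero] at *
      have hm1 : |(m : ℝ)| < 1 := lt_of_le_of_lt hm hη₀1
      rw [Nat.abs_cast] at hm1
      have : m = 0 := by
        have : m < 1 := by exact_mod_cast hm1
        omega
      simp [this]
    · refine hm.trans ?_
      rw [div_le_iff₀ (by positivity)] at hbN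
      have := mul_le_mul_of_nonneg_right hkN (by positivity : 0 ≤ η * b)
      linarith
  refine ⟨fun z => a (Sum.inl z), fun z => a (Sum.inr z), ⟨?_, fun z => ?_⟩, ⟨?_, fun z => ?_⟩,
    h1.trans h2.symm, h3⟩
  · rw [h1]; exact hk
  · rw [h1]; exact hrel _ (hβ.nonneg z) (hNz z).1 _ (ha (Sum.inl z))
  · rw [h2]; exact hk
  · rw [h2]; exact hrel _ (hβ'.nonneg z) (hNz z).2 _ (ha (Sum.inr z))

lemma exists_isWeight_of_mem_hull {ζ : EuclideanSpace ℝ (Fin d)} (hζ : ζ ∈ hull R) :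
    ∃ β : R → ℝ, IsWeight β ∧ ∑ z, β z • latticePt (z : Fin d → ℤ) = ζ := by
  classical
  obtain ⟨ι, _, w, y, hw0, hw1, hy, hsum⟩ := mem_convexHull_iff_exists_fintype.1 hζ
  choose r hr hry using hy
  set f : ι → R := fun i => ⟨r i, hr i⟩
  refine ⟨fun z => ∑ i with f i = z, w i, ⟨fun z => sum_nonneg fun i _ => hw0 i, ?_⟩, ?_⟩
  · rw [sum_fiberwise]; exact hw1
  · rw [← hsum, ← sum_fiberwise (g := f)]
    refine sum_congr rfl fun z _ => ?_
    rw [sum_smul]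
    refine sum_congr rfl fun i hi => ?_
    rw [← hry i, ← (mem_filter.1 hi).2]

lemma mem_hull_of_isWeight {β : R → ℝ} (hβ : IsWeight β) :
    ∑ z, β z • latticePt (z : Fin d → ℤ) ∈ hull R :=
  mem_convexHull_of_exists_fintype β (fun z : R => latticePt (z : Fin d → ℤ)) hβ.nonneg
    hβ.sum_eq_one (fun z => ⟨z, z.2, rfl⟩) rfl

/-- A rational point of the hull has a representation with rational weights: round a real
representation with a denominator divisible by that of the point. -/
lemma exists_isConvexRep {ζ : EuclideanSpace ℝ (Fin d)} (hζ : ζ ∈ hull R) :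
    ∃ β : R → ℝ, IsConvexRep ζ β := by
  obtain ⟨β, hβ, hβζ⟩ := exists_isWeight_of_mem_hull hζ
  by_cases hrat : ζ ∈ rationalPts d
  swap
  · exact ⟨β, fun z => ⟨hβ.nonneg z, hβ.le_one z⟩, hβ.sum_eq_one, hβζ, fun h => absurd h hrat⟩
  choose x hx using hrat
  set C := coeffBound R
  have hC : 0 ≤ C := coeffBound_nonneg R
  have hη₀ : (0 : ℝ) < 1 / (C + 2) := by positivity
  have hη₀C : ∀ t ≤ C, 1 / (C + 2) * t < 1 := by
    intro t ht
    rw [one_div_mul_eq_div, div_lt_one (by positivity)]; linarith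
  obtain ⟨k, hk, hNk, a, ha⟩ := exists_nat_approx hβ.nonneg hη₀
    (by rw [div_lt_one (by positivity)]; linarith)
    (N := ∏ i, (x i).den) (prod_pos fun i _ => (x i).den_pos)
  have hk0 : (0 : ℝ) < k := by exact_mod_cast hk
  have h1 : ∑ z, (a z : ℤ) = k := by
    have := sum_mul_eq_of_approx ha (fun _ => 1)
      (by simpa using hη₀C _ (sum_one_le_coeffBound (R := R))) k
      (by simp [-univ_eq_attach, hβ.sum_eq_one])
    simpa using this
  have h2 : ∀ i, ∑ z : R, (((z : Fin d → ℤ) i : ℝ)) * (a z : ℝ) = k * ζ i := by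
    intro i
    obtain ⟨c, hc⟩ := (dvd_prod_of_mem (fun i => (x i).den) (mem_univ i)).trans hNk
    have hden : ((x i).den : ℝ) * (x i : ℝ) = (x i).num := by
      exact_mod_cast Rat.den_mul_eq_num (x i)
    have ht : (k : ℝ) * ζ i = ((c * (x i).num : ℤ) : ℝ) := by
      rw [hx, hc]; push_cast; rw [← hden]; ring
    have := sum_mul_eq_of_approx ha (fun z : R => (z : Fin d → ℤ) i)
      (hη₀C _ (sum_abs_le_coeffBound (R := R) i)) (c * (x i).num) (by
        rw [← ht, ← hβζ, sum_smul_latticePt_apply])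
    rw [ht, ← this]
    push_cast
    rfl
  have hw : IsWeight fun z : R => (a z : ℝ) / k := by
    refine ⟨fun z => by positivity, ?_⟩
    rw [← sum_div, div_eq_one_iff_eq hk0.ne']
    exact_mod_cast h1
  refine ⟨fun z => (a z : ℝ) / k, fun z => ⟨hw.nonneg z, hw.le_one z⟩, hw.sum_eq_one, ?_,
    fun _ z => ⟨(a z : ℚ) / k, by push_cast; rfl⟩⟩
  ext i
  rw [sum_smul_latticePt_apply]
  have := h2 i
  simp only [← mul_div_assoc]
  rw [← sum_div, this]
  field_simp

lemma IsConvexRep.isWeight {ζ : EuclideanSpace ℝ (Fin d)} {β : R → ℝ} (h : IsConvexRep ζ β) :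
    IsWeight β := ⟨fun z => (h.mem_unit z).1, h.sum_eq_one⟩

/-- The fractional parts of `n β` have an integer sum, at most the number of positive weights. -/
lemma exists_isRounding {β : R → ℝ} (hβ : IsWeight β) : ∃ b : ℕ → R → ℤ, IsRounding β b := by
  classical
  have key : ∀ n : ℕ, ∃ s : Finset R, s ⊆ univ.filter (fun z => β z ≠ 0) ∧
      ((s.card : ℕ) : ℤ) = n - ∑ z, ⌊(n : ℝ) * β z⌋ := by
    intro n
    set m : ℤ := n - ∑ z, ⌊(n : ℝ) * β z⌋ with hm
    have hmr : (m : ℝ) = ∑ z, Int.fract ((n : ℝ) * β z) := by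
      simp only [Int.fract, sum_sub_distrib, ← mul_sum, hβ.sum_eq_one, hm]
      push_cast
      ring
    have hm0 : 0 ≤ m := by
      have : (0 : ℝ) ≤ m := hmr ▸ sum_nonneg fun z _ => Int.fract_nonneg _
      exact_mod_cast this
    have hm1 : m ≤ (univ.filter (fun z => β z ≠ 0)).card := by
      have : (m : ℝ) ≤ (univ.filter (fun z => β z ≠ 0)).card := by
        rw [hmr, card_filter, Nat.cast_sum]
        refine sum_le_sum fun z _ => ?_
        by_cases hz : β z = 0
        · simp [hz]
        · simpa [hz] using (Int.fract_lt_one _).le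
      exact_mod_cast this
    obtain ⟨s, hs, hcard⟩ := exists_subset_card_eq (s := univ.filter (fun z => β z ≠ 0))
      (n := m.toNat) (by omega)
    exact ⟨s, hs, by rw [hcard]; omega⟩
  choose s hs hcard using key
  refine ⟨fun n z => if z ∈ s n then 1 else 0, fun n z => ?_, fun n z hz => ?_, fun n => ?_⟩
  · split_ifs <;> simp
  · refine if_neg fun hzs => ?_
    exact (mem_filter.1 (hs n hzs)).2 hz
  · rw [← hcard n]; simp [-univ_eq_attach]

/-- The step counts of the paths to `x̂_n`. -/
noncomputable def roundCount (β : R → ℝ) (b : ℕ → R → ℤ) (n : ℕ) (z : R) : ℕ :=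
  (⌊(n : ℝ) * β z⌋ + b n z).toNat

lemma roundCount_cast {β : R → ℝ} (hβ : IsWeight β) {b : ℕ → R → ℤ} (hb : IsRounding β b) (n : ℕ)
    (z : R) : (roundCount β b n z : ℤ) = ⌊(n : ℝ) * β z⌋ + b n z := by
  have h1 : 0 ≤ ⌊(n : ℝ) * β z⌋ := Int.floor_nonneg.2 (mul_nonneg (Nat.cast_nonneg n) (hβ.nonneg z))
  have h2 := hb.zero_or_one n z
  rw [roundCount, Int.toNat_of_nonneg (by omega)]

lemma follows_roundCount {β : R → ℝ} (hβ : IsWeight β) {b : ℕ → R → ℤ} (hb : IsRounding β b) :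
    Follows β (roundCount β b) := by
  refine ⟨fun n => ?_, fun n z => ?_, fun n z hz => ?_⟩
  · have h1 : ((∑ z, roundCount β b n z : ℕ) : ℤ) = n := by
      rw [Nat.cast_sum]
      simp only [roundCount_cast hβ hb, sum_add_distrib, hb.sum_eq]
      ring
    exact_mod_cast h1
  · have h1 : (roundCount β b n z : ℝ) = ⌊(n : ℝ) * β z⌋ + b n z := by
      exact_mod_cast congrArg (Int.cast : ℤ → ℝ) (roundCount_cast hβ hb n z)
    rw [h1, abs_le]
    have h2 := Int.floor_le ((n : ℝ) * β z)
    have h3 := (Int.lt_floor_add_one ((n : ℝ) * β z)).le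
    rcases hb.zero_or_one n z with h | h <;> rw [h] <;> push_cast <;> constructor <;> linarith
  · simp [roundCount, hz, hb.eq_zero n z hz]

lemma xhat_eq_countPos {β : R → ℝ} (hβ : IsWeight β) {b : ℕ → R → ℤ} (hb : IsRounding β b)
    (n : ℕ) : xhat β b n = (countPos (roundCount β b n) : Fin d → ℤ) := by
  funext i
  rw [countPos_coe_apply, xhat, Finset.sum_apply]
  refine sum_congr rfl fun z _ => ?_
  rw [roundCount_cast hβ hb, Pi.smul_apply, smul_eq_mul, mul_comm]

/-- With the weights `c z / ∑ c`, no rounding takes place at the multiples of `∑ c`. -/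
lemma roundCount_mul {c : R → ℕ} (hc : 0 < ∑ z, c z) {b : ℕ → R → ℤ}
    (hw : IsWeight fun z => (c z : ℝ) / (∑ z, c z : ℕ))
    (hb : IsRounding (fun z => (c z : ℝ) / (∑ z, c z : ℕ)) b) (q : ℕ) :
    roundCount (fun z => (c z : ℝ) / (∑ z, c z : ℕ)) b (q * ∑ z, c z) = q • c := by
  have hS : ((∑ z, c z : ℕ) : ℝ) ≠ 0 := by exact_mod_cast hc.ne'
  have h1 : ∀ z, ⌊((q * ∑ z, c z : ℕ) : ℝ) * ((c z : ℝ) / (∑ z, c z : ℕ))⌋ = (q * c z : ℕ) := by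
    intro z
    have : ((q * ∑ z, c z : ℕ) : ℝ) * ((c z : ℝ) / (∑ z, c z : ℕ)) = ((q * c z : ℕ) : ℝ) := by
      rw [Nat.cast_mul, Nat.cast_mul]; field_simp
    rw [this, Int.floor_natCast]
  have h2 : ∀ z, b (q * ∑ z, c z) z = 0 := by
    have h3 := hb.sum_eq (q * ∑ z, c z)
    simp only [h1] at h3
    have h4 : ∑ z, b (q * ∑ z, c z) z = 0 := by
      rw [h3]; push_cast; rw [mul_sum]; ring
    have h5 := (sum_eq_zero_iff_of_nonneg fun z _ => by
      have := hb.zero_or_one (q * ∑ z, c z) z; omega).1 h4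
    exact fun z => h5 z (mem_univ z)
  funext z
  have h6 := roundCount_cast hw hb (q * ∑ z, c z) z
  rw [h1, h2, add_zero] at h6
  rw [Pi.smul_apply, smul_eq_mul]
  exact_mod_cast h6

end Approximation

/-! ### The quenched free energies -/

section FreeEnergy

open Finset

lemma eventually_cast_pos : ∀ᶠ n : ℕ in atTop, (0 : ℝ) < n := by
  filter_upwards [eventually_gt_atTop 0] with n hn using by exact_mod_cast hn

/-- Limits of slopes are insensitive to perturbations of order `o(n)`. -/
lemma tendsto_slope_congr {u v : ℕ → ℝ} {L : EReal}
    (hu : Tendsto (fun n : ℕ => (((1 / (n : ℝ)) * u n : ℝ) : EReal)) atTop (𝓝 L))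
    (h : ∀ δ : ℝ, 0 < δ → ∀ᶠ n : ℕ in atTop, |u n - v n| ≤ δ * n) :
    Tendsto (fun n : ℕ => (((1 / (n : ℝ)) * v n : ℝ) : EReal)) atTop (𝓝 L) := by
  have h0 : Tendsto (fun n : ℕ => (1 / (n : ℝ)) * (v n - u n)) atTop (𝓝 0) := by
    rw [Metric.tendsto_nhds]
    intro δ hδ
    filter_upwards [h (δ / 2) (half_pos hδ), eventually_cast_pos] with n hn hn0
    rw [Real.dist_eq, sub_zero, abs_mul, abs_sub_comm, abs_of_pos (by positivity),
      one_div_mul_eq_div, div_lt_iff₀ hn0]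
    nlinarith
  have h1 : Tendsto (fun n : ℕ => (((1 / (n : ℝ)) * (v n - u n) : ℝ) : EReal)) atTop (𝓝 0) :=
    (EReal.tendsto_coe.2 h0)
  have h2 := (EReal.continuousAt_add (p := (L, 0)) (Or.inr EReal.zero_ne_bot)
    (Or.inr EReal.zero_ne_top)).tendsto.comp (hu.prodMk_nhds h1)
  rw [add_zero] at h2
  refine h2.congr fun n => ?_
  simp only [Function.comp]
  rw [← EReal.coe_add]
  congr 1
  ring

/-- Comparison of limiting slopes. -/
lemma le_of_slope_cross {u v : ℕ → ℝ} {L L' : EReal}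
    (hu : Tendsto (fun n : ℕ => (((1 / (n : ℝ)) * u n : ℝ) : EReal)) atTop (𝓝 L))
    (hv : Tendsto (fun n : ℕ => (((1 / (n : ℝ)) * v n : ℝ) : EReal)) atTop (𝓝 L'))
    (h : ∀ M₁ M₂ : ℝ, M₂ < M₁ → (∃ᶠ n : ℕ in atTop, M₁ * n ≤ v n) →
      ∀ᶠ n : ℕ in atTop, M₂ * n ≤ u n) : L' ≤ L := by
  refine EReal.ge_of_forall_gt_iff_ge.1 fun c hc => ?_
  obtain ⟨c', h1, h2⟩ := EReal.lt_iff_exists_real_btwn.1 hc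
  have h3 : ∀ᶠ n : ℕ in atTop, c' * n ≤ v n := by
    filter_upwards [hv.eventually (lt_mem_nhds h2), eventually_cast_pos] with n hn hn0
    have := EReal.coe_lt_coe_iff.1 hn
    rw [one_div_mul_eq_div, lt_div_iff₀ hn0] at this
    exact this.le
  have h4 := h c' c (EReal.coe_lt_coe_iff.1 h1) h3.frequently
  refine ge_of_tendsto hu ?_
  filter_upwards [h4, eventually_cast_pos] with n hn hn0
  refine EReal.coe_le_coe_iff.2 ?_
  rw [one_div_mul_eq_div, le_div_iff₀ hn0]
  exact hn

lemma abs_log_sub_le {x y B : ℝ} (hx : 0 < x)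
    (h : y ∈ Set.Icc (Real.exp (-B) * x) (Real.exp B * x)) : |Real.log x - Real.log y| ≤ B := by
  have hy : 0 < y := lt_of_lt_of_le (mul_pos (Real.exp_pos _) hx) h.1
  have h1 := Real.log_le_log (mul_pos (Real.exp_pos _) hx) h.1
  have h2 := Real.log_le_log hy h.2
  rw [Real.log_mul (Real.exp_ne_zero _) hx.ne', Real.log_exp] at h1 h2
  rw [abs_le]
  constructor <;> linarith

variable {d : ℕ} {R : Finset (Fin d → ℤ)} [Nonempty R] {Ω : Type*}
  [AddAction (stepGroup R) Ω] {ℓ : ℕ} {g : Ω → (Fin ℓ → R) → ℝ} {ω : Ω}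

lemma HasSmallRuns.stable (h : HasSmallRuns g ω) : StableUnderFewSteps (countEnergy g ω) :=
  fun K _ hδ => h.exists_countEnergy_le K hδ

lemma HasSmallRuns.abs_countEnergy_sub_log_le (h : HasSmallRuns g ω) {β : R → ℝ}
    (hβ : IsWeight β) {b : ℕ → R → ℤ} (hb : IsRounding β b) {δ : ℝ} (hδ : 0 < δ) :
    ∀ᶠ n : ℕ in atTop, |countEnergy g ω (roundCount β b n)
      - Real.log (pointPartition g ω n (xhat β b n))| ≤ δ * n := by
  have hF := follows_roundCount hβ hb
  filter_upwards [h.eventually_boundaryCost_le (stepBound R) hδ] with n hn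
  have h1 := pointPartition_mem_Icc g ω n (countPos (roundCount β b n))
  have h2 := wordPartition_count_pos g ω (roundCount β b n)
  rw [countEnergy, xhat_eq_countPos hβ hb]
  rw [hF.sum_eq] at h2 ⊢
  refine (abs_log_sub_le h2 h1).trans (hn _ ?_)
  refine (norm_sum_nsmul_le univ _).trans (le_of_eq ?_)
  rw [← Nat.cast_sum, hF.sum_eq]

lemma wordPartition_univ_pos (g : Ω → (Fin ℓ → R) → ℝ) (ω : Ω) (n : ℕ) :
    0 < wordPartition g ω n Set.univ := by
  have h := wordPartition_count_pos g ω (fun z => if z = Classical.arbitrary R then n else 0)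
  have h1 : ∑ z : R, (if z = Classical.arbitrary R then n else 0) = n := by
    rw [Fintype.sum_eq_single (Classical.arbitrary R) fun z hz => if_neg hz, if_pos rfl]
  rw [h1] at h
  exact lt_of_lt_of_le h (wordPartition_mono g ω n (Set.subset_univ _))

lemma HasSmallRuns.abs_log_wordPartition_sub_log_le (h : HasSmallRuns g ω) {δ : ℝ} (hδ : 0 < δ) :
    ∀ᶠ n : ℕ in atTop, |Real.log (wordPartition g ω n Set.univ)
      - Real.log (linePartition g ω n)| ≤ δ * n := by
  filter_upwards [h.eventually_boundaryCost_le (stepBound R) hδ] with n hn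
  refine abs_log_sub_le (wordPartition_univ_pos g ω n)
    (linePartition_mem_Icc g ω n fun s => hn _ ?_)
  rw [← countPos_wordCount (n := n)]
  refine (norm_sum_nsmul_le univ _).trans (le_of_eq ?_)
  rw [← Nat.cast_sum, sum_wordCount]

lemma countEnergy_le_log_wordPartition_univ (g : Ω → (Fin ℓ → R) → ℝ) (ω : Ω) {a : R → ℕ} {n : ℕ}
    (ha : ∑ z, a z = n) : countEnergy g ω a ≤ Real.log (wordPartition g ω n Set.univ) := by
  subst ha
  exact Real.log_le_log (wordPartition_count_pos g ω a)
    (wordPartition_mono g ω _ (Set.subset_univ _))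

lemma exists_isApprox_pair_countEnergy (g : Ω → (Fin ℓ → R) → ℝ) (ω : Ω) {β β' : R → ℝ}
    (hβ : IsWeight β) (hβ' : IsWeight β')
    (heq : ∑ z, β z • latticePt (z : Fin d → ℤ) = ∑ z, β' z • latticePt (z : Fin d → ℤ)) (η : ℝ)
    (hη : 0 < η) : ∃ a a', IsApprox β η a ∧ IsApprox β' η a' ∧ ∑ z, a z = ∑ z, a' z ∧
      ∀ q : ℕ, countEnergy g ω (q • a) = countEnergy g ω (q • a') := by
  obtain ⟨a, a', h1, h2, h3, h4⟩ := exists_isApprox_pair hβ hβ' heq hη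
  refine ⟨a, a', h1, h2, h3, fun q => ?_⟩
  have : ∑ z, (q • a) z = ∑ z, (q • a') z := by
    simp only [Pi.smul_apply, ← smul_sum, h3]
  rw [countEnergy, countEnergy, countPos_nsmul, countPos_nsmul, h4, this]

lemma HasSmallRuns.hasLinearGrowth_roundCount (h : HasSmallRuns g ω)
    (hlim : ∀ a : R → ℕ, HasLinearGrowth fun q => countEnergy g ω (q • a)) {β : R → ℝ}
    (hβ : IsWeight β) {b : ℕ → R → ℤ} (hb : IsRounding β b) :
    HasLinearGrowth fun n => countEnergy g ω (roundCount β b n) :=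
  h.stable.hasLinearGrowth hlim hβ (fun η hη => by
    obtain ⟨a, -, ha, -⟩ := exists_isApprox_pair_countEnergy g ω hβ hβ rfl η hη
    exact ⟨a, ha⟩) (follows_roundCount hβ hb)

/-- The point-to-point free energy in direction `ζ`, for all representations of `ζ` at once. -/
theorem HasSmallRuns.exists_pointLimit (h : HasSmallRuns g ω)
    (hlim : ∀ a : R → ℕ, HasLinearGrowth fun q => countEnergy g ω (q • a))
    {ζ : EuclideanSpace ℝ (Fin d)} (hζ : ζ ∈ hull R) :
    ∃ L : EReal, ⊥ < L ∧ ∀ (β : R → ℝ) (b : ℕ → R → ℤ), IsConvexRep ζ β → IsRounding β b →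
      Tendsto (fun n : ℕ => (((1 / (n : ℝ)) * countEnergy g ω (roundCount β b n) : ℝ) : EReal))
        atTop (𝓝 L) := by
  obtain ⟨β₀, hβ₀⟩ := exists_isConvexRep hζ
  obtain ⟨b₀, hb₀⟩ := exists_isRounding hβ₀.isWeight
  obtain ⟨L, hL, hL'⟩ := (h.hasLinearGrowth_roundCount hlim hβ₀.isWeight hb₀).exists_tendsto
  refine ⟨L, hL, fun β b hβ hb => ?_⟩
  obtain ⟨L₁, -, hL₁⟩ := (h.hasLinearGrowth_roundCount hlim hβ.isWeight hb).exists_tendsto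
  have heq := hβ.sum_eq.trans hβ₀.sum_eq.symm
  have h1 : L₁ ≤ L := le_of_slope_cross hL' hL₁ fun M₁ M₂ hM hfr =>
    h.stable.eventually_le_of_frequently hlim hβ₀.isWeight hβ.isWeight
      (exists_isApprox_pair_countEnergy g ω hβ₀.isWeight hβ.isWeight heq.symm)
      (follows_roundCount hβ₀.isWeight hb₀) (follows_roundCount hβ.isWeight hb) hM hfr
  have h2 : L ≤ L₁ := le_of_slope_cross hL₁ hL' fun M₁ M₂ hM hfr =>
    h.stable.eventually_le_of_frequently hlim hβ.isWeight hβ₀.isWeight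
      (exists_isApprox_pair_countEnergy g ω hβ.isWeight hβ₀.isWeight heq)
      (follows_roundCount hβ.isWeight hb) (follows_roundCount hβ₀.isWeight hb₀) hM hfr
  rwa [le_antisymm h2 h1]

/-- A slope which the point-to-line free energy exceeds infinitely often is eventually almost
exceeded by the point-to-point free energy in some rational direction. -/
theorem HasSmallRuns.exists_rational_eventually_le (h : HasSmallRuns g ω)
    (hlim : ∀ a : R → ℕ, HasLinearGrowth fun q => countEnergy g ω (q • a)) {M₁ M₂ : ℝ}
    (hM : M₂ < M₁)
    (hfr : ∃ᶠ n : ℕ in atTop, M₁ * n ≤ Real.log (wordPartition g ω n Set.univ)) :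
    ∃ ξ ∈ hull R ∩ rationalPts d, ∃ (β : R → ℝ) (b : ℕ → R → ℤ), IsConvexRep ξ β ∧
      IsRounding β b ∧ ∀ᶠ n : ℕ in atTop, M₂ * n ≤ countEnergy g ω (roundCount β b n) := by
  obtain ⟨c, hc0, hc⟩ := h.stable.exists_eventually_le hlim
    (exists_log_wordPartition_univ_le g ω) (by linarith : (M₁ + M₂) / 2 < M₁) hfr
  have hS : 0 < ∑ z, c z := sum_pos (fun z _ => hc0 z) univ_nonempty
  have hS' : ((∑ z, c z : ℕ) : ℝ) ≠ 0 := by exact_mod_cast hS.ne'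
  set β : R → ℝ := fun z => (c z : ℝ) / (∑ z, c z : ℕ) with hβ
  have hw : IsWeight β := by
    refine ⟨fun z => by positivity, ?_⟩
    rw [hβ, ← sum_div, div_eq_one_iff_eq hS', Nat.cast_sum]
  have hrat : ∀ z, ∃ q : ℚ, β z = q := fun z => ⟨(c z : ℚ) / (∑ z, c z : ℕ), by push_cast [hβ]; rfl⟩
  have hrep : IsConvexRep (∑ z, β z • latticePt (z : Fin d → ℤ)) β :=
    ⟨fun z => ⟨hw.nonneg z, hw.le_one z⟩, hw.sum_eq_one, rfl, fun _ => hrat⟩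
  obtain ⟨b, hb⟩ := exists_isRounding hw
  refine ⟨_, ⟨mem_hull_of_isWeight hw, fun i => ?_⟩, β, b, hrep, hb, ?_⟩
  · choose q hq using hrat
    refine ⟨∑ z : R, ((z : Fin d → ℤ) i : ℚ) * q z, ?_⟩
    rw [sum_smul_latticePt_apply]
    push_cast
    exact sum_congr rfl fun z _ => by rw [hq]
  · refine (h.hasLinearGrowth_roundCount hlim hw hb).2 ((M₁ + M₂) / 2) M₂ (by linarith) ?_
    -- at the multiples of `∑ c` the sequence runs through the multiples of `c`
    have ht : Tendsto (fun q : ℕ => q * ∑ z, c z) atTop atTop :=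
      tendsto_id.atTop_mul_const' hS
    refine ht.frequently (p := fun n : ℕ =>
      (M₁ + M₂) / 2 * n ≤ countEnergy g ω (roundCount β b n)) ?_
    refine (hc.mono fun q hq => ?_).frequently
    rw [roundCount_mul hS hw hb, Nat.cast_mul]
    exact hq

/-- The point-to-line free energy exists and is the supremum of the point-to-point ones. -/
theorem HasSmallRuns.exists_lineLimit (h : HasSmallRuns g ω)
    (hlim : ∀ a : R → ℕ, HasLinearGrowth fun q => countEnergy g ω (q • a))
    {Λ : EuclideanSpace ℝ (Fin d) → EReal}
    (hΛ : ∀ ζ ∈ hull R, ∀ (β : R → ℝ) (b : ℕ → R → ℤ), IsConvexRep ζ β → IsRounding β b →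
      Tendsto (fun n : ℕ => (((1 / (n : ℝ)) * countEnergy g ω (roundCount β b n) : ℝ) : EReal))
        atTop (𝓝 (Λ ζ))) :
    ∃ L : EReal, ⊥ < L ∧ Tendsto (fun n : ℕ => (((1 / (n : ℝ)) *
        Real.log (wordPartition g ω n Set.univ) : ℝ) : EReal)) atTop (𝓝 L) ∧
      L = (⨆ ξ ∈ hull R ∩ rationalPts d, Λ ξ) ∧ L = ⨆ ζ ∈ hull R, Λ ζ := by
  have hle : ∀ {β : R → ℝ} {b : ℕ → R → ℤ}, IsWeight β → IsRounding β b → ∀ n : ℕ,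
      countEnergy g ω (roundCount β b n) ≤ Real.log (wordPartition g ω n Set.univ) :=
    fun hβ hb n => countEnergy_le_log_wordPartition_univ g ω ((follows_roundCount hβ hb).sum_eq n)
  have hgrowth : HasLinearGrowth fun n => Real.log (wordPartition g ω n Set.univ) := by
    refine ⟨?_, fun M₁ M₂ hM hfr => ?_⟩
    · have hz : latticePt ((Classical.arbitrary R : R) : Fin d → ℤ) ∈ hull R :=
        subset_convexHull _ _ ⟨_, (Classical.arbitrary R).2, rfl⟩
      obtain ⟨β, hβ⟩ := exists_isConvexRep hz
      obtain ⟨b, hb⟩ := exists_isRounding hβ.isWeight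
      obtain ⟨⟨M, hM⟩, -⟩ := h.hasLinearGrowth_roundCount hlim hβ.isWeight hb
      exact ⟨M, hM.mono fun n hn => hn.trans (hle hβ.isWeight hb n)⟩
    · obtain ⟨ξ, -, β, b, hβ, hb, hev⟩ := h.exists_rational_eventually_le hlim hM hfr
      exact hev.mono fun n hn => hn.trans (hle hβ.isWeight hb n)
  obtain ⟨L, hL, hLt⟩ := hgrowth.exists_tendsto
  have h1 : ⨆ ζ ∈ hull R, Λ ζ ≤ L := by
    refine iSup₂_le fun ζ hζ => ?_
    obtain ⟨β, hβ⟩ := exists_isConvexRep hζ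
    obtain ⟨b, hb⟩ := exists_isRounding hβ.isWeight
    refine le_of_tendsto_of_tendsto' (hΛ ζ hζ β b hβ hb) hLt fun n => ?_
    exact EReal.coe_le_coe_iff.2 (mul_le_mul_of_nonneg_left (hle hβ.isWeight hb n) (by positivity))
  have h2 : ⨆ ξ ∈ hull R ∩ rationalPts d, Λ ξ ≤ ⨆ ζ ∈ hull R, Λ ζ :=
    biSup_mono fun ξ hξ => hξ.1
  have h3 : L ≤ ⨆ ξ ∈ hull R ∩ rationalPts d, Λ ξ := by
    refine EReal.ge_of_forall_gt_iff_ge.1 fun c hc => ?_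
    obtain ⟨c', h4, h5⟩ := EReal.lt_iff_exists_real_btwn.1 hc
    have h6 : ∀ᶠ n : ℕ in atTop, c' * n ≤ Real.log (wordPartition g ω n Set.univ) := by
      filter_upwards [hLt.eventually (lt_mem_nhds h5), eventually_cast_pos] with n hn hn0
      have := EReal.coe_lt_coe_iff.1 hn
      rw [one_div_mul_eq_div, lt_div_iff₀ hn0] at this
      exact this.le
    obtain ⟨ξ, hξ, β, b, hβ, hb, hev⟩ := h.exists_rational_eventually_le hlim
      (EReal.coe_lt_coe_iff.1 h4) h6.frequently
    refine le_trans ?_ (le_iSup₂ (f := fun ξ (_ : ξ ∈ hull R ∩ rationalPts d) => Λ ξ) ξ hξ)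
    refine ge_of_tendsto (hΛ ξ hξ.1 β b hβ hb) ?_
    filter_upwards [hev, eventually_cast_pos] with n hn hn0
    refine EReal.coe_le_coe_iff.2 ?_
    rw [one_div_mul_eq_div, le_div_iff₀ hn0]
    exact hn
  exact ⟨L, hL, hLt, le_antisymm h3 (h2.trans h1), le_antisymm (h3.trans h2) h1⟩

end FreeEnergy

end RWRP

theorem mainTheorem2 {d : ℕ} (R : Finset (Fin d → ℤ)) [Nonempty R]
    {Ω : Type*} [MeasurableSpace Ω] [AddAction (RWRP.stepGroup R) Ω]
    [MeasurableConstVAdd (RWRP.stepGroup R) Ω]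
    (μ : Measure Ω) [IsProbabilityMeasure μ] [VAddInvariantMeasure (RWRP.stepGroup R) Ω μ]
    {ℓ : ℕ} (g : Ω → (Fin ℓ → R) → ℝ) (hg : RWRP.ClassL μ g) :
    ∀ᵐ ω ∂μ, ∃ Λ : EuclideanSpace ℝ (Fin d) → EReal,
      (∀ ζ ∈ RWRP.hull R,
        (∃ (β : R → ℝ) (b : ℕ → R → ℤ), RWRP.IsConvexRep ζ β ∧ RWRP.IsRounding β b) ∧
        ⊥ < Λ ζ ∧
        ∀ (β : R → ℝ) (b : ℕ → R → ℤ), RWRP.IsConvexRep ζ β → RWRP.IsRounding β b →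
          Tendsto (fun n : ℕ => (((1 / (n : ℝ)) *
            Real.log (RWRP.pointPartition g ω n (RWRP.xhat β b n)) : ℝ) : EReal))
            atTop (𝓝 (Λ ζ))) ∧
      ∃ Λline : EReal,
        ⊥ < Λline ∧
        Tendsto (fun n : ℕ => (((1 / (n : ℝ)) *
          Real.log (RWRP.linePartition g ω n) : ℝ) : EReal)) atTop (𝓝 Λline) ∧
        Λline = (⨆ ξ ∈ RWRP.hull R ∩ RWRP.rationalPts d, Λ ξ) ∧
        Λline = ⨆ ζ ∈ RWRP.hull R, Λ ζ := by
  filter_upwards [hg.ae_hasSmallRuns, RWRP.ae_hasLinearGrowth_nsmul fun w => (hg w).1]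
    with ω hruns hlim
  choose! Λ hΛ using fun ζ (hζ : ζ ∈ RWRP.hull R) => hruns.exists_pointLimit hlim hζ
  obtain ⟨L, hL, hLt, hL1, hL2⟩ := hruns.exists_lineLimit hlim fun ζ hζ => (hΛ ζ hζ).2
  refine ⟨Λ, fun ζ hζ => ⟨?_, (hΛ ζ hζ).1, fun β b hβ hb => ?_⟩, L, hL, ?_, hL1, hL2⟩
  · obtain ⟨β, hβ⟩ := RWRP.exists_isConvexRep hζ
    obtain ⟨b, hb⟩ := RWRP.exists_isRounding hβ.isWeight
    exact ⟨β, b, hβ, hb⟩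
  · exact RWRP.tendsto_slope_congr ((hΛ ζ hζ).2 β b hβ hb) fun δ hδ =>
      hruns.abs_countEnergy_sub_log_le hβ.isWeight hb hδ
  · exact RWRP.tendsto_slope_congr hLt fun δ hδ => hruns.abs_log_wordPartition_sub_log_le hδ
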